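/- **Permutations.** Permutations of $1,\dots,n$ are viewed as sequences. The stack-sorting operator $S$ on sequences of distinct integers is defined by $S(\epsilon)=\epsilon$ and $S(A_L\cdot m\cdot A_R)=S(A_L)\cdot S(A_R)\cdot m$, where $m$ is the largest entry. A *two-stack sortable permutation* (2SSP) is a permutation $\pi$ of $1,\dots,n$ with $n\ge 1$ and $S(S(\pi))=12\cdots n$. For a sequence $\sigma$, let $\sigma^{+k}$ be obtained by adding $k$ to each entry, and $\sigma^{+(k_1,m,k_2)}$ by adding $k_1$ to the entries smaller than $m$ and $k_2$ to the others. For permutations $\pi_1,\pi_2$ of lengths $k,\ell$ put $$C_1(\pi_1,\pi_2)=\pi_1\cdot(k+\ell+1)\cdot\pi_2^{+k},\qquad C_2(\pi_1,\pi_2,i)=\pi_1^{+(0,k,a_i)}\cdot(k+\ell+1)\cdot\pi_2^{+(k-1,a_i+1,k)},$$ where, in $C_2$, $\pi_1,\pi_2$ are non-empty and $a_i$ is the $i$-th left-to-right maximum of $S(\pi_2)$. **Fighting fish.** Cells are unit squares rotated by 45 degrees; an edge of a cell is *free* if it is adjacent to only one cell. A *fighting fish* is obtained from a single cell, the *head*,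 by successively adding cells in one of three ways: (a) glue the lower left edge of the new cell to a free upper right edge of a cell; (b) glue the upper left edge of the new cell to a free lower right edge of a cell; (c) if cells $b$ and $c$ are attached to the upper right and the lower right edge of a same cell, and $b$ has a free lower right edge and $c$ a free upper right edge, glue the new cell to both of these edges. Fish with the same cells and the same gluings (up to renaming the cells) are identified. A *tail* is the right vertex of a cell whose two right edges are free. The *fin* is the path of free edges that starts at the left vertex of the head and follows the boundary counter-clockwise to the first tail. For a fighting fish $P$ and an initial part $f_1,\dots,f_m$ ($m\ge1$) of its fin, *adding a strip along* $f_1,\dots,f_m$ means adding a new cell $d_r$ to each $f_r$ that is a lower left edge (the upper right edge of $d_r$ is glued to $f_r$), and gluing, for each such $r\ge 2$, the upper left edge of $d_r$ to $g_{r-1}$; here $g_r$ is the lower right edge of $d_r$ if $f_r$ is a lower left edge, and $g_r=f_r$ if $f_r$ is a lower right edge. The cell $d_1$ is the new head. Let $\epsilon^\bullet$ be the empty fish. Define $C_1^\bullet(\epsilon^\bullet,\epsilon^\bullet)$ as the single cell; $C_1^\bullet(P_1,\epsilon^\bullet)$ as $P_1$ with a new head glued, along its lower right edge, to the upper left edge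 of the head of $P_1$; $C_1^\bullet(\epsilon^\bullet,P_2)$ as $P_2$ with a strip added along its whole fin; and $C_1^\bullet(P_1,P_2)$ as the same, with moreover the upper left edge of the head of $P_1$ glued to the last edge of the fin of $P_2$. If the fin of $P_2$ has length $k+1$ and $1\le i\le k$, let $C_2^\bullet(P_1,P_2,i)$ be $P_2$ with a strip added along the first $m=k-i+1$ edges of its fin, and with the upper left edge of the head of $P_1$ glued to $g_m$. **Theorem.** There is a bijection $\phi$ from two-stack sortable permutations to fighting fish that, with $\phi(\epsilon)=\epsilon^\bullet$, is given recursively by $$\phi(C_1(\pi_1,\pi_2))=C_1^\bullet(\phi(\pi_1),\phi(\pi_2)),\qquad \phi(C_2(\pi_1,\pi_2,i))=C_2^\bullet(\phi(\pi_1),\phi(\pi_2),i),$$ where $\pi_1,\pi_2$ are 2SSPs or, in the first rule, empty. If $\pi$ has length $n$, $i$ ascents and $j$ descents, and if $S(\pi)$ has $k$ left-to-right maxima and $\ell$ entries $a$ that precede the entry $a-1$, then $\phi(\pi)$ has $n+1$ lower free edges, of which $i+1$ are left and $j+1$ are right, its fin has length $k+1$, and it has $\ell+1$ tails. -/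

import Mathlib

/-! ### Permutations as sequences, and stack sorting -/

/-- The largest entry of a list of natural numbers (`0` for the empty list). -/
def listMax (A : List ℕ) : ℕ := A.foldr max 0

theorem listMax_mem : ∀ (a : ℕ) (A : List ℕ), listMax (a :: A) ∈ a :: A
  | a, [] => by simp [listMax]
  | a, b :: A => by
      have ih := listMax_mem b A
      change max a (listMax (b :: A)) ∈ a :: b :: A
      rcases le_total a (listMax (b :: A)) with h | h
      · rw [max_eq_right h]; exact List.mem_cons_of_mem _ ih
      · rw [max_eq_left h]; simp

/-- The part of `A` before the first occurrence of `m`. -/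
def partBefore (m : ℕ) (A : List ℕ) : List ℕ := A.takeWhile (fun x => decide (x ≠ m))

/-- The part of `A` after the first occurrence of `m`. -/
def partAfter (m : ℕ) (A : List ℕ) : List ℕ := (A.dropWhile (fun x => decide (x ≠ m))).tail

theorem partBefore_append_partAfter {m : ℕ} {A : List ℕ} (h : m ∈ A) :
    partBefore m A ++ m :: partAfter m A = A := by
  induction A with
  | nil => simp at h
  | cons b A ih =>
      by_cases hb : b = m
      · subst hb; simp [partBefore, partAfter]
      · have h' : m ∈ A := by
          rcases List.mem_cons.1 h with h | h
          · exact absurd h.symm hb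
          · exact h
        have := ih h'
        simp only [partBefore, partAfter] at this ⊢
        simp [hb] at this ⊢
        exact this

theorem length_partBefore_add_partAfter (a : ℕ) (A : List ℕ) :
    (partBefore (listMax (a :: A)) (a :: A)).length +
      (partAfter (listMax (a :: A)) (a :: A)).length = A.length := by
  have h := congrArg List.length (partBefore_append_partAfter (listMax_mem a A))
  simp only [List.length_append, List.length_cons] at h
  omega

/-- The stack-sorting operator: `S(ε) = ε` and `S(A_L · n · A_R) = S(A_L) · S(A_R) · n`, where `n`
is the largest entry. -/
def stackSort : List ℕ → List ℕ
  | [] => []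
  | a :: A =>
      stackSort (partBefore (listMax (a :: A)) (a :: A)) ++
        stackSort (partAfter (listMax (a :: A)) (a :: A)) ++ [listMax (a :: A)]
termination_by A => A.length
decreasing_by
  · have := length_partBefore_add_partAfter a A
    simp only [List.length_cons]; omega
  · have := length_partBefore_add_partAfter a A
    simp only [List.length_cons]; omega

/-- The identity permutation `1, 2, …, n`. -/
def idSeq (n : ℕ) : List ℕ := List.range' 1 n

/-- `π` is a non-empty permutation of `1, …, n` (with `n` its length) that is sorted by two passes
through a stack. -/
def IsTwoStackSortable (π : List ℕ) : Prop :=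
  π ≠ [] ∧ π.Perm (idSeq π.length) ∧ stackSort (stackSort π) = idSeq π.length

/-- The two-stack sortable permutations (the empty permutation excluded). -/
def TwoStackSortable : Type := {π : List ℕ // IsTwoStackSortable π}

/-- The number of ascents: indices `i` with `σ(i) < σ(i+1)`. -/
def ascents (σ : List ℕ) : ℕ := (σ.zip σ.tail).countP (fun p => decide (p.1 < p.2))

/-- The number of descents: indices `i` with `σ(i) > σ(i+1)`. -/
def descents (σ : List ℕ) : ℕ := (σ.zip σ.tail).countP (fun p => decide (p.2 < p.1))

/-- The list of left-to-right maxima of `σ`, in order of appearance: the entries `σ(i)` such that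
`σ(j) < σ(i)` for all `j < i`. -/
def lrMaxima (σ : List ℕ) : List ℕ :=
  ((List.range σ.length).filter
    (fun i => decide (∀ j < i, σ.getD j 0 < σ.getD i 0))).map (fun i => σ.getD i 0)

/-- The number of entries `a` of `σ` that precede `a - 1` in `σ` (so `a - 1` is an entry too). -/
def leftDescents (σ : List ℕ) : ℕ := σ.countP (fun a => decide ([a, a - 1].Sublist σ))

/-- Add `k₁` to the numbers smaller than `m`, and `k₂` to the others. -/
def shift (k₁ m k₂ x : ℕ) : ℕ := if x < m then x + k₁ else x + k₂

/-- `C₁(π₁, π₂) = π₁ · (k+ℓ+1) · π₂^{+k}`, where `k`, `ℓ` are the lengths of `π₁`, `π₂`. -/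
def permC1 (π₁ π₂ : List ℕ) : List ℕ :=
  π₁ ++ (π₁.length + π₂.length + 1) :: π₂.map (fun x => x + π₁.length)

/-- `π₁^{+(0,k,a)} · (k+ℓ+1) · π₂^{+(k-1,a+1,k)}`, where `k`, `ℓ` are the lengths of `π₁`, `π₂`;
this is `C₂(π₁, π₂, i)` when `a` is the `i`-th left-to-right maximum of `S(π₂)`. -/
def permC2 (π₁ π₂ : List ℕ) (a : ℕ) : List ℕ :=
  π₁.map (shift 0 π₁.length a) ++ (π₁.length + π₂.length + 1) ::
    π₂.map (shift (π₁.length - 1) (a + 1) π₁.length)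

/-! ### Cells glued along edges -/

/-- Finitely many cells (unit squares rotated by 45 degrees) with a distinguished cell, the head,
and a record of which edges are glued: `up a b` says that the upper right edge of `a` is glued to
the lower left edge of `b`, and `low a b` that the lower right edge of `a` is glued to the upper
left edge of `b`. This is only the raw data; fighting fish are the ones that can be grown. -/
structure GluedCells where
  Cell : Type
  finite : Finite Cell
  head : Cell
  up : Cell → Cell → Prop
  low : Cell → Cell → Prop

/-- The four edges of a cell, in counter-clockwise order. -/
inductive Side
  | lowerLeft | lowerRight | upperRight | upperLeft

/-- The side after a given one, counter-clockwise around a cell. -/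
def Side.next : Side → Side
  | .lowerLeft => .lowerRight
  | .lowerRight => .upperRight
  | .upperRight => .upperLeft
  | .upperLeft => .lowerLeft

namespace GluedCells

/-- Two systems of cells are the same if they differ by a renaming of the cells. -/
def Iso (P Q : GluedCells) : Prop :=
  ∃ e : P.Cell ≃ Q.Cell, e P.head = Q.head ∧ (∀ a b, P.up a b ↔ Q.up (e a) (e b)) ∧
    (∀ a b, P.low a b ↔ Q.low (e a) (e b))

theorem Iso.refl (P : GluedCells) : Iso P P :=
  ⟨Equiv.refl _, rfl, fun _ _ => Iff.rfl, fun _ _ => Iff.rfl⟩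

theorem Iso.symm {P Q : GluedCells} : Iso P Q → Iso Q P := by
  rintro ⟨e, h, hu, hl⟩
  refine ⟨e.symm, by rw [← h]; simp, fun a b => ?_, fun a b => ?_⟩
  · rw [hu]; simp
  · rw [hl]; simp

theorem Iso.trans {P Q R : GluedCells} : Iso P Q → Iso Q R → Iso P R := by
  rintro ⟨e, h, hu, hl⟩ ⟨f, h', hu', hl'⟩
  exact ⟨e.trans f, by simp [h, h'], fun a b => by rw [hu, hu']; rfl,
    fun a b => by rw [hl, hl']; rfl⟩

/-- An edge of a cell. -/
abbrev Edge (P : GluedCells) : Type := P.Cell × Side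

/-- Two edges of cells are glued together. -/
inductive Glued (P : GluedCells) : P.Edge → P.Edge → Prop
  | up {a b : P.Cell} : P.up a b → Glued P (a, .upperRight) (b, .lowerLeft)
  | up' {a b : P.Cell} : P.up a b → Glued P (b, .lowerLeft) (a, .upperRight)
  | low {a b : P.Cell} : P.low a b → Glued P (a, .lowerRight) (b, .upperLeft)
  | low' {a b : P.Cell} : P.low a b → Glued P (b, .upperLeft) (a, .lowerRight)

/-- An edge is free if it is adjacent to only one cell. -/
def Free (P : GluedCells) (e : P.Edge) : Prop := ∀ f, ¬ P.Glued e f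

/-- The head alone. -/
def single : GluedCells where
  Cell := Unit
  finite := inferInstance
  head := ()
  up := fun _ _ => False
  low := fun _ _ => False

/-- Add a new cell (`none`) whose lower left edge is glued to the upper right edge of the cells in
`U`, and whose upper left edge is glued to the lower right edge of the cells in `L`. -/
def attach (P : GluedCells) (U L : P.Cell → Prop) : GluedCells where
  Cell := Option P.Cell
  finite := haveI := P.finite; inferInstance
  head := some P.head
  up := fun x y => match x, y with
    | some a, some b => P.up a b
    | some a, none => U a
    | none, _ => False
  low := fun x y => match x, y with
    | some a, some b => P.low a b
    | some a, none => L a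
    | none, _ => False

/-- Fighting fish: start with the head and add cells one by one, (a) to a free upper right edge,
(b) to a free lower right edge, (c) to two cells `b` and `c` attached to the upper right and lower
right edge of a same cell `a`, such that `b` has a free lower right and `c` a free upper right
edge. The names of the cells are irrelevant. -/
inductive IsFish : GluedCells → Prop
  | head : IsFish single
  | upper {P : GluedCells} (c : P.Cell) : IsFish P → P.Free (c, .upperRight) →
      IsFish (P.attach (fun x => x = c) (fun _ => False))
  | lower {P : GluedCells} (c : P.Cell) : IsFish P → P.Free (c, .lowerRight) →
      IsFish (P.attach (fun _ => False) (fun x => x = c))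
  | double {P : GluedCells} (a b c : P.Cell) : IsFish P → P.up a b → P.low a c →
      P.Free (b, .lowerRight) → P.Free (c, .upperRight) →
      IsFish (P.attach (fun x => x = c) (fun x => x = b))
  | rename {P Q : GluedCells} : IsFish P → Iso P Q → IsFish Q

/-! ### Statistics -/

/-- The number of free edges on a given side of the cells. -/
noncomputable def freeCount (P : GluedCells) (s : Side) : ℕ :=
  {c : P.Cell | P.Free (c, s)}.ncard

/-- The number of lower free edges (left and right). -/
noncomputable def lowerFreeCount (P : GluedCells) : ℕ :=
  {e : P.Edge | (e.2 = .lowerLeft ∨ e.2 = .lowerRight) ∧ P.Free e}.ncard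

/-- The number of tails, that is, of cells with both right edges free. -/
noncomputable def tailCount (P : GluedCells) : ℕ :=
  {c : P.Cell | P.Free (c, .upperRight) ∧ P.Free (c, .lowerRight)}.ncard

/-- `Turn e g`: rotating around the initial vertex of `e`, from `e` on and across glued edges,
the first free edge met is `g`. -/
inductive Turn (P : GluedCells) : P.Edge → P.Edge → Prop
  | here {e : P.Edge} : P.Free e → Turn P e e
  | cross {e f g : P.Edge} : P.Glued e f → Turn P (f.1, f.2.next) g → Turn P e g

/-- `g` is the free edge that follows the free edge `e` counter-clockwise along the boundary. -/
def BoundaryNext (P : GluedCells) (e g : P.Edge) : Prop := P.Turn (e.1, e.2.next) g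

/-- The free edge `e`, followed counter-clockwise, ends at a tail. -/
def EndsAtTail (P : GluedCells) (e : P.Edge) : Prop :=
  e.2 = .lowerRight ∧ P.Free (e.1, .lowerRight) ∧ P.Free (e.1, .upperRight)

/-- `l` is the list of the edges of the fin: the path of free edges that starts at the nose (the
left vertex of the head) and goes counter-clockwise to the first tail. -/
def IsFin (P : GluedCells) (l : List P.Edge) : Prop :=
  l.head? = some (P.head, .lowerLeft) ∧ l.IsChain P.BoundaryNext ∧
    (∃ e ∈ l.getLast?, P.EndsAtTail e) ∧ ∀ e ∈ l.dropLast, ¬ P.EndsAtTail e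

/-- The fin has length `k`. -/
def HasFinLength (P : GluedCells) (k : ℕ) : Prop := ∃ l, P.IsFin l ∧ l.length = k

/-! ### The constructions on fighting fish -/

/-- The right edge left exposed by an edge `e` of the fin once new cells have been added to the
lower left edges of an initial part `l` of the fin. If `e` is a lower left edge, it is the lower
right edge of the new cell added to `e`; otherwise it is `e` itself. `Carrier P l x e` says that
`x` is the cell (old or new) having this edge as its lower right edge. -/
inductive Carrier (P : GluedCells) (l : List P.Edge) :
    P.Cell ⊕ {c : P.Cell // (c, Side.lowerLeft) ∈ l} → P.Edge → Prop
  | new (d : {c : P.Cell // (c, Side.lowerLeft) ∈ l}) : Carrier P l (.inr d) (d.1, .lowerLeft)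
  | old (c : P.Cell) : Carrier P l (.inl c) (c, .lowerRight)

/-- Add a new cell to every lower left edge in the initial part `l` of the fin, gluing each new
cell, along its upper left edge, to the right edge exposed by the preceding edge of `l`. The new
head is the cell added to the lower left edge of the old head. -/
def strip (P : GluedCells) (l : List P.Edge) (h : (P.head, Side.lowerLeft) ∈ l) : GluedCells where
  Cell := P.Cell ⊕ {c : P.Cell // (c, Side.lowerLeft) ∈ l}
  finite := haveI := P.finite; inferInstance
  head := .inr ⟨P.head, h⟩
  up := fun x y => match x, y with
    | .inl a, .inl b => P.up a b
    | .inr d, .inl b => d.1 = b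
    | _, .inr _ => False
  low := fun x y => match x, y with
    | .inl a, .inl b => P.low a b
    | .inr _, .inl _ => False
    | x, .inr d => ∃ e, Carrier P l x e ∧ [e, (d.1, Side.lowerLeft)].IsInfix l

/-- Glue the upper left edge of the head of `R` to the lower right edge of the cell `x` of `Q`. -/
def glueHead (Q : GluedCells) (x : Q.Cell) (R : GluedCells) : GluedCells where
  Cell := Q.Cell ⊕ R.Cell
  finite := haveI := Q.finite; haveI := R.finite; inferInstance
  head := .inl Q.head
  up := fun y z => match y, z with
    | .inl a, .inl b => Q.up a b
    | .inr a, .inr b => R.up a b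
    | _, _ => False
  low := fun y z => match y, z with
    | .inl a, .inl b => Q.low a b
    | .inr a, .inr b => R.low a b
    | .inl a, .inr b => a = x ∧ b = R.head
    | .inr _, .inl _ => False

/-- `Q` is obtained from `P₂` by adding new cells along the initial part `l` of its fin, and then
gluing the head of `P₁` to the right edge exposed by the last edge of `l`. -/
def IsWaist (P₁ P₂ : GluedCells) (l : List P₂.Edge) (Q : GluedCells) : Prop :=
  ∃ (h : (P₂.head, Side.lowerLeft) ∈ l) (x : (P₂.strip l h).Cell),
    (∃ e ∈ l.getLast?, Carrier P₂ l x e) ∧ Iso Q ((P₂.strip l h).glueHead x P₁)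

/-- `Q = C₁(F₁, F₂)`, where `none` is the empty fish. -/
def IsC1 (F₁ F₂ : Option GluedCells) (Q : GluedCells) : Prop :=
  match F₁, F₂ with
  | none, none => Iso Q single
  | some P₁, none => Iso Q (single.glueHead () P₁)
  | none, some P₂ => ∃ (l : List P₂.Edge) (h : (P₂.head, Side.lowerLeft) ∈ l),
      P₂.IsFin l ∧ Iso Q (P₂.strip l h)
  | some P₁, some P₂ => ∃ l : List P₂.Edge, P₂.IsFin l ∧ IsWaist P₁ P₂ l Q

/-- `Q = C₂(P₁, P₂, i)`: if the fin of `P₂` has length `k + 1`, new cells are added along its first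
`k - i + 1` edges, where `1 ≤ i ≤ k`. -/
def IsC2 (P₁ P₂ : GluedCells) (i : ℕ) (Q : GluedCells) : Prop :=
  ∃ l : List P₂.Edge, P₂.IsFin l ∧ 1 ≤ i ∧ i < l.length ∧
    IsWaist P₁ P₂ (l.take (l.length - i)) Q

end GluedCells

/-- Fighting fish, up to the names of the cells. -/
instance fishSetoid : Setoid {P : GluedCells // P.IsFish} where
  r P Q := GluedCells.Iso P.1 Q.1
  iseqv := ⟨fun P => GluedCells.Iso.refl P.1, fun h => h.symm, fun h h' => h.trans h'⟩

/-- The fighting fish. -/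
def FightingFish : Type 1 := Quotient fishSetoid

/-- The system of cells `P` is one of those that represent the fighting fish `F`. -/
def FightingFish.IsRep (F : FightingFish) (P : GluedCells) : Prop :=
  ∃ h : P.IsFish, (Quotient.mk fishSetoid ⟨P, h⟩ : FightingFish) = F

/-- The correspondence defined recursively by `ε ↦ ε`,
`C₁(π₁, π₂) ↦ C₁(φ(π₁), φ(π₂))` and `C₂(π₁, π₂, i) ↦ C₂(φ(π₁), φ(π₂), i)`,
where `none` is the empty fish and, in the last case, `π₁`, `π₂` are non-empty. -/
inductive Corresponds : List ℕ → Option GluedCells → Prop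
  | empty : Corresponds [] none
  | c1 {π₁ π₂ : List ℕ} {F₁ F₂ : Option GluedCells} {Q : GluedCells} :
      Corresponds π₁ F₁ → Corresponds π₂ F₂ → GluedCells.IsC1 F₁ F₂ Q →
      Corresponds (permC1 π₁ π₂) (some Q)
  | c2 {π₁ π₂ : List ℕ} {P₁ P₂ Q : GluedCells} {i a : ℕ} :
      Corresponds π₁ (some P₁) → Corresponds π₂ (some P₂) → 1 ≤ i →
      (lrMaxima (stackSort π₂))[i - 1]? = some a → GluedCells.IsC2 P₁ P₂ i Q →
      Corresponds (permC2 π₁ π₂ a) (some Q)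

-- A fish is encoded by its boundary word: the sides of its free edges, read counter-clockwise from
-- the nose. In this word `LL` and `UR` match as brackets, and so do `LR` and `UL`. The words that
-- occur are those of `IsFishWord`, apart from `LL UR`, which is kept to stand for the empty fish.
--
-- Words determine fish (`IsFish.exists_isIso`). A factor `LR UR` consists of the two right edges of
-- one cell, hence of a tail. A tail other than the head can be moved to the end of the growth and
-- peeled off, and the letters around it tell how it was attached; induction applies to the smaller
-- fish.
--
-- Both compositions act on words in one way. A strip copies the letters of the covered part of the
-- fin and leaves one exposed `LR` behind it; gluing a head replaces this `LR` by the word of the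
-- glued fish without its final `UL`. If `w₂ = f t`, where `f` is the fin of `w₂` without its last
-- `i` letters, the result is `f · insertion w₁ · t · UL` (`waist`), with `i = 0` for C₁. Every fish
-- word other than `LL UR` arises so in exactly one way (`exists_decomposition`,
-- `decomposition_unique`). The inserted factor is recovered as the leftmost bracket `LL … UR`
-- opened in the fin after its first letter whose surplus of `LR` over `UL` exceeds by exactly one
-- the run of `UL` that follows, together with this run; if there is none, it is the last `LR` of
-- the fin.
--
-- On permutations, C₁ is C₂ with `a = 0`. By Knuth's theorem the condition is that `S(π)` avoids
-- 231. If `π = A n B` then `S(π) = S(A) S(B) n`, and avoidance forces all entries of `A` but the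
-- largest to lie below those of `B`; the height `a` of the exceptional entry is `0` or a
-- left-to-right maximum of the standardised `S(B)`. So every nonempty 2SSP decomposes in exactly
-- one way (`IsTwoStack.exists_datum`, `IsPermDatum.unique`).
--
-- The two recursions agree because the fin has one edge more than `S(π)` has left-to-right maxima,
-- so the admissible indices `i` are the same on both sides. `HasFishWord` is the resulting
-- bijection, and the statistics obey the same recursions. That `waist` preserves fish words is not
-- checked on letters: it follows because the composition of two fish is again a fish.

attribute [reducible] GluedCells.attach GluedCells.single GluedCells.strip GluedCells.glueHead

local notation "LL" => Side.lowerLeft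
local notation "LR" => Side.lowerRight
local notation "UR" => Side.upperRight
local notation "UL" => Side.upperLeft

instance : DecidableEq Side := fun a b => by
  cases a <;> cases b <;> first | exact isTrue rfl | exact isFalse (by simp)

/-! ### Boundary words -/

/-- The height reached by a word whose letters have weights `f`. -/
def ht (f : Side → ℤ) (w : List Side) : ℤ := (w.map f).sum

@[simp] theorem ht_nil (f : Side → ℤ) : ht f [] = 0 := rfl

@[simp] theorem ht_cons (f : Side → ℤ) (s : Side) (w : List Side) :
    ht f (s :: w) = f s + ht f w := by simp [ht]

@[simp] theorem ht_append (f : Side → ℤ) (u v : List Side) :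
    ht f (u ++ v) = ht f u + ht f v := by simp [ht]

@[simp] theorem ht_replicate (f : Side → ℤ) (n : ℕ) (s : Side) :
    ht f (List.replicate n s) = n * f s := by simp [ht]

/-- Starting at height `k`, the word `w` never leads below height `0`. -/
def Stays (f : Side → ℤ) : ℤ → List Side → Prop
  | k, [] => 0 ≤ k
  | k, s :: w => 0 ≤ k ∧ Stays f (k + f s) w

@[simp] theorem stays_nil {f : Side → ℤ} {k : ℤ} : Stays f k [] ↔ 0 ≤ k := Iff.rfl

@[simp] theorem stays_cons {f : Side → ℤ} {k : ℤ} {s : Side} {w : List Side} :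
    Stays f k (s :: w) ↔ 0 ≤ k ∧ Stays f (k + f s) w := Iff.rfl

theorem Stays.nonneg {f : Side → ℤ} {k : ℤ} {w : List Side} (h : Stays f k w) : 0 ≤ k := by
  cases w with
  | nil => exact h
  | cons s w => exact h.1

theorem stays_append {f : Side → ℤ} {u v : List Side} : ∀ {k : ℤ},
    Stays f k (u ++ v) ↔ Stays f k u ∧ Stays f (k + ht f u) v := by
  induction u with
  | nil => intro k; simpa using fun h => h.nonneg
  | cons s u ih => intro k; simp [ih, and_assoc, add_assoc]

theorem Stays.ht_nonneg {f : Side → ℤ} {k : ℤ} {w : List Side} (h : Stays f k w) :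
    0 ≤ k + ht f w := by
  rw [← List.append_nil w, stays_append] at h; exact h.2

theorem Stays.mono {f : Side → ℤ} {w : List Side} : ∀ {k l : ℤ}, Stays f k w → k ≤ l →
    Stays f l w := by
  induction w with
  | nil => intro k l h hl; exact le_trans h hl
  | cons s w ih => intro k l h hl; exact ⟨h.1.trans hl, ih h.2 (by omega)⟩

theorem stays_iff {f : Side → ℤ} {w : List Side} {k : ℤ} :
    Stays f k w ↔ ∀ u v, w = u ++ v → 0 ≤ k + ht f u := by
  constructor
  · rintro h u v rfl
    exact (stays_append.1 h).1.ht_nonneg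
  · induction w generalizing k with
    | nil => intro h; simpa using h [] [] rfl
    | cons s w ih =>
      intro h
      refine ⟨by simpa using h [] (s :: w) rfl, ih fun u v huv => ?_⟩
      have := h (s :: u) v (by rw [huv]; rfl)
      simpa [add_assoc] using this

/-- A word that leads below `0` has a first step that does. -/
theorem exists_dip {f : Side → ℤ} {w : List Side} : ∀ {k : ℤ}, 0 ≤ k → ¬ Stays f k w →
    ∃ u s v, w = u ++ s :: v ∧ Stays f k u ∧ k + ht f u + f s < 0 := by
  induction w with
  | nil => intro k hk h; exact absurd hk h
  | cons s w ih =>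
    intro k hk h
    by_cases hs : 0 ≤ k + f s
    · obtain ⟨u, t, v, rfl, hu, ht'⟩ := ih hs (fun h' => h ⟨hk, h'⟩)
      exact ⟨s :: u, t, v, rfl, ⟨hk, hu⟩, by simp only [ht_cons]; omega⟩
    · exact ⟨[], s, w, rfl, hk, by simp; omega⟩

/-- Lower left edges open brackets that are closed by upper right edges. -/
def wA : Side → ℤ
  | LL => 1
  | UR => -1
  | _ => 0

/-- Lower right edges open brackets that are closed by upper left edges. -/
def wB : Side → ℤ
  | LR => 1
  | UL => -1
  | _ => 0

@[simp] theorem wA_ll : wA LL = 1 := rfl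
@[simp] theorem wA_lr : wA LR = 0 := rfl
@[simp] theorem wA_ur : wA UR = -1 := rfl
@[simp] theorem wA_ul : wA UL = 0 := rfl
@[simp] theorem wB_ll : wB LL = 0 := rfl
@[simp] theorem wB_lr : wB LR = 1 := rfl
@[simp] theorem wB_ur : wB UR = 0 := rfl
@[simp] theorem wB_ul : wB UL = -1 := rfl

theorem wA_dip {k : ℤ} {s : Side} (hk : 0 ≤ k) (h : k + wA s < 0) : k = 0 ∧ s = UR := by
  cases s <;> simp at h ⊢ <;> omega

theorem wB_dip {k : ℤ} {s : Side} (hk : 0 ≤ k) (h : k + wB s < 0) : k = 0 ∧ s = UL := by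
  cases s <;> simp at h ⊢ <;> omega

/-- No letter lowers the height by more than one, so the first descent below `0` starts from height
exactly `0`, at a `UR`. This locates the letter that closes a bracket opened just before `w`. -/
theorem exists_dip_wA {w : List Side} (h : ¬ Stays wA 0 w) :
    ∃ u v, w = u ++ UR :: v ∧ Stays wA 0 u ∧ ht wA u = 0 := by
  obtain ⟨u, s, v, rfl, hu, hs⟩ := exists_dip le_rfl h
  obtain ⟨h1, rfl⟩ := wA_dip hu.ht_nonneg hs
  exact ⟨u, v, rfl, hu, by simpa using h1⟩

theorem exists_dip_wB {w : List Side} (h : ¬ Stays wB 0 w) :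
    ∃ u v, w = u ++ UL :: v ∧ Stays wB 0 u ∧ ht wB u = 0 := by
  obtain ⟨u, s, v, rfl, hu, hs⟩ := exists_dip le_rfl h
  obtain ⟨h1, rfl⟩ := wB_dip hu.ht_nonneg hs
  exact ⟨u, v, rfl, hu, by simpa using h1⟩

/-- A word that leads above `0` has an opening bracket of level `0` that is not closed. -/
theorem exists_open {w : List Side} (h : 0 < ht wA w) :
    ∃ u v, w = u ++ LL :: v ∧ ht wA u = 0 ∧ Stays wA 0 v := by
  induction w using List.reverseRecOn with
  | nil => simp at h
  | append_singleton w s ih =>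
    by_cases hw : 0 < ht wA w
    · obtain ⟨u, v, rfl, hu, hv⟩ := ih hw
      refine ⟨u, v ++ [s], by simp, hu, ?_⟩
      rw [stays_append]
      have := hv.ht_nonneg
      simp at h
      refine ⟨hv, by omega, by simp; omega⟩
    · cases s <;> simp at h <;> try omega
      exact ⟨w, [], rfl, by omega, by simp⟩

/-- Both bracketings of `w` are balanced. -/
def IsBalanced (w : List Side) : Prop :=
  Stays wA 0 w ∧ ht wA w = 0 ∧ Stays wB 0 w ∧ ht wB w = 0

/-- The words of lower and upper edges read along the boundary of a fish: both bracketings are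
balanced, no proper factor is closed under both, and a bracket of the second kind can only be closed
inside a bracket of the first kind if it is opened there. -/
structure IsFishWord (w : List Side) : Prop where
  start : ∃ u, w = LL :: u
  bal : IsBalanced w
  conn : ∀ u x v, w = u ++ (x ++ v) → x ≠ [] → IsBalanced x → u = [] ∧ v = []
  cross : ∀ u x v, w = u ++ LL :: (x ++ v) → Stays wA 0 x → 0 ≤ ht wB x

namespace IsFishWord

variable {w : List Side}

/-- The field `cross` bounds only the final height of `x`, but every prefix of `x` satisfies its
hypothesis too. -/
theorem stays_wB (h : IsFishWord w) {u x v : List Side} (hw : w = u ++ LL :: (x ++ v))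
    (hx : Stays wA 0 x) : Stays wB 0 x := by
  rw [stays_iff]
  rintro y z rfl
  rw [zero_add]
  exact h.cross u y (z ++ v) (by simp [hw]) (stays_append.1 hx).1

theorem not_balanced (h : IsFishWord w) {u x v : List Side} (hw : w = u ++ (x ++ v)) (hx : x ≠ [])
    (huv : u ≠ [] ∨ v ≠ []) : ¬ IsBalanced x := fun hb => by
  have := h.conn u x v hw hx hb
  tauto

/-- A factor that does not begin by closing a bracket of the second kind closes none. -/
theorem no_dip (h : IsFishWord w) {u x v : List Side} (hw : w = u ++ (x ++ v))
    (hx : x.head? ≠ some UL) (hA : Stays wA 0 x) : Stays wB 0 x := by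
  by_contra hB
  obtain ⟨y, z, rfl, hy, hy0⟩ := exists_dip_wB hB
  have hyA := (stays_append.1 hA).1
  -- `y` is balanced for the second kind and is followed by an unmatched `UL`. If a bracket of the
  -- first kind is open at that point, `cross` applied after it is violated. Otherwise `y` is
  -- balanced for both kinds, and it is nonempty because `x` does not begin with `UL`.
  by_cases hpos : 0 < ht wA y
  · obtain ⟨d, e, rfl, hd, he⟩ := exists_open hpos
    have h1 := h.cross (u ++ d) (e ++ [UL]) (z ++ v) (by simp [hw])
      (by rw [stays_append]; exact ⟨he, by simpa using he.ht_nonneg, by simpa using he.ht_nonneg⟩)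
    have h2 := (stays_append.1 hy).1.ht_nonneg
    simp at h1 h2 hy0
    omega
  · have hne : y ≠ [] := by rintro rfl; simp at hx
    exact h.not_balanced (u := u) (v := UL :: z ++ v) (by simp [hw]) hne (Or.inr (by simp))
      ⟨hyA, by have := hyA.ht_nonneg; omega, hy, hy0⟩

/-- By induction on the length. If a bracket of `x` remains open, write `x = d LL e` at one of level
`0`; both `d` and `e` have nonnegative second height, so both heights vanish, `d` is balanced and
hence empty, and induction applies to `e`. If none remains open, `x` itself is balanced, hence
empty. -/
theorem eq_ll (h : IsFishWord w) {x : List Side} : ∀ {u v : List Side},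
    w = u ++ LL :: (x ++ v) → Stays wA 0 x → ht wB x = 0 → ∀ s ∈ x, s = LL := by
  induction hn : x.length using Nat.strong_induction_on generalizing x with
  | _ n ih =>
  intro u v hw hx hx0
  have hB := h.stays_wB hw hx
  by_cases hpos : 0 < ht wA x
  · obtain ⟨d, e, rfl, hd, he⟩ := exists_open hpos
    have hd1 := (stays_append.1 hx).1
    have hd2 := (stays_append.1 hB).1
    have he2 := h.cross (u ++ LL :: d) e v (by simp [hw]) he
    have := hd2.ht_nonneg
    simp at hx0
    have hd0 : d = [] := by
      by_contra hne
      exact h.not_balanced (u := u ++ [LL]) (x := d) (v := LL :: e ++ v) (by simp [hw]) hne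
        (by simp) ⟨hd1, hd, hd2, by omega⟩
    subst hd0
    have := ih e.length (by simp at hn; omega) rfl (u := u ++ [LL]) (v := v) (by simp [hw]) he
      (by simpa using hx0)
    simpa using this
  · have hx' : x = [] := by
      by_contra hne
      exact h.not_balanced (u := u ++ [LL]) (x := x) (v := v) (by simp [hw]) hne
        (by simp) ⟨hx, by have := hx.ht_nonneg; omega, hB, hx0⟩
    simp [hx']

/-- The bracket opened by a lower left edge of a fish word is closed. -/
theorem exists_closed (h : IsFishWord w) {u v : List Side} (hw : w = u ++ LL :: v) :
    ∃ x y, v = x ++ UR :: y ∧ Stays wA 0 x ∧ ht wA x = 0 := by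
  apply exists_dip_wA
  intro hv
  have h1 := h.bal.1
  have h2 := h.bal.2.1
  rw [hw] at h1 h2
  have := (stays_append.1 h1).1.ht_nonneg
  have := hv.ht_nonneg
  simp at h2 this
  omega

end IsFishWord

theorem exists_run (s : Side) (v : List Side) :
    ∃ r y, v = List.replicate r s ++ y ∧ y.head? ≠ some s := by
  induction v with
  | nil => exact ⟨0, [], rfl, by simp⟩
  | cons t v ih =>
    by_cases hts : t = s
    · obtain ⟨r, y, rfl, hy⟩ := ih
      exact ⟨r + 1, y, by simp [hts, List.replicate_succ], hy⟩
    · exact ⟨0, t :: v, rfl, by simpa using hts⟩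

theorem stays_replicate_ul {k : ℤ} {r : ℕ} : Stays wA k (List.replicate r UL) ↔ 0 ≤ k := by
  induction r generalizing k with
  | zero => simp
  | succ r ih => simp [List.replicate_succ, ih]

theorem stays_wB_replicate_ul {k : ℤ} {r : ℕ} :
    Stays wB k (List.replicate r UL) ↔ (r : ℤ) ≤ k := by
  induction r generalizing k with
  | zero => simp
  | succ r ih => simp [List.replicate_succ, ih]; omega

/-- A closed bracket followed by as many `UL` as it takes to close both bracketings. -/
theorem balanced_chord {x : List Side} {r : ℕ} (hx : Stays wA 0 x) (hx0 : ht wA x = 0)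
    (hB : Stays wB 0 x) (hr : ht wB x = r) :
    IsBalanced (LL :: (x ++ UR :: List.replicate r UL)) := by
  refine ⟨?_, by simp [hx0], ?_, by simp [hr]⟩
  · simp [stays_append, hx0, stays_replicate_ul]
    exact hx.mono (by omega)
  · simp [stays_append, hr, stays_wB_replicate_ul]
    exact hB

namespace IsFishWord

variable {w : List Side}

/-- With at least `ht wB x` letters `UL` after the closing `UR`, stopping after exactly that many
would give a balanced factor, and a proper one since something precedes or follows. -/
theorem chord_lt (h : IsFishWord w) {u x v : List Side} {r : ℕ}
    (hw : w = u ++ LL :: (x ++ UR :: (List.replicate r UL ++ v))) (hx : Stays wA 0 x)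
    (hx0 : ht wA x = 0) (huv : u ≠ [] ∨ v ≠ []) : (r : ℤ) < ht wB x := by
  by_contra hr
  have hB := h.stays_wB (u := u) (v := UR :: (List.replicate r UL ++ v)) (by simp [hw]) hx
  obtain ⟨n, hn⟩ := Int.eq_ofNat_of_zero_le (by simpa using hB.ht_nonneg : (0 : ℤ) ≤ ht wB x)
  have hnr : n ≤ r := by omega
  refine h.not_balanced (u := u) (x := LL :: (x ++ UR :: List.replicate n UL))
    (v := List.replicate (r - n) UL ++ v) ?_ (by simp) ?_ (balanced_chord hx hx0 hB hn)
  · rw [hw]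
    have : List.replicate r UL = List.replicate n UL ++ List.replicate (r - n) UL := by
      rw [List.replicate_append_replicate]; congr 1; omega
    rw [this]; simp only [List.append_assoc, List.cons_append]
  · rcases huv with h | h
    · exact Or.inl h
    · exact Or.inr (by simp [h])

/-- After the bracket opened by the first letter is closed, there are only `UL`s. -/
theorem shape (h : IsFishWord w) {x v : List Side} (hw : w = LL :: (x ++ UR :: v))
    (hx : Stays wA 0 x) (hx0 : ht wA x = 0) :
    ∃ r : ℕ, v = List.replicate r UL ∧ ht wB x = r := by
  obtain ⟨r, y, rfl, hy⟩ := exists_run UL v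
  have hb := h.bal
  rw [hw] at hb
  -- If a nonempty `y` followed the run of `UL`, the second height would be positive after the run
  -- by `chord_lt` and could not decrease along `y` by `no_dip`, so the word would not end at `0`.
  have hy0 : y = [] := by
    by_contra hne
    have h1 := h.chord_lt (u := []) (by simpa using hw) hx hx0 (Or.inr hne)
    have h2 := hb.2.2.2
    have hA : Stays wA 0 y := by
      have := hb.1
      simp [stays_append, hx0] at this
      exact this.2.2
    have := (h.no_dip (u := LL :: (x ++ UR :: List.replicate r UL)) (v := []) (by simp [hw])
      hy hA).ht_nonneg
    simp at h2
    omega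
  subst hy0
  refine ⟨r, by simp, ?_⟩
  have := hb.2.2.2
  simp at this
  omega

end IsFishWord

/-! ### Stability of fish words under the growth moves -/

theorem split_two {α : Type*} {a b : α} {l₁ l₂ u v : List α} (h : l₁ ++ a :: b :: l₂ = u ++ v) :
    (∃ t, l₁ = u ++ t ∧ v = t ++ a :: b :: l₂) ∨ (u = l₁ ++ [a] ∧ v = b :: l₂) ∨
      (∃ t, u = l₁ ++ a :: b :: t ∧ l₂ = t ++ v) := by
  rcases List.append_eq_append_iff.1 h with ⟨t, rfl, ht⟩ | ⟨t, rfl, ht⟩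
  · rcases t with _ | ⟨x, _ | ⟨y, t⟩⟩ <;> simp at ht <;> simp [ht]
  · exact Or.inl ⟨t, rfl, ht⟩

/-- Locates one end of a factor relative to the block written by a growth move. Ends outside the
block carry over to the old word; ends inside it are treated separately. -/
theorem split_three {α : Type*} {a b c : α} {l₁ l₂ u v : List α}
    (h : l₁ ++ a :: b :: c :: l₂ = u ++ v) :
    (∃ t, l₁ = u ++ t ∧ v = t ++ a :: b :: c :: l₂) ∨ (u = l₁ ++ [a] ∧ v = b :: c :: l₂) ∨
      (u = l₁ ++ [a, b] ∧ v = c :: l₂) ∨ (∃ t, u = l₁ ++ a :: b :: c :: t ∧ l₂ = t ++ v) := by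
  rcases List.append_eq_append_iff.1 h with ⟨t, rfl, ht⟩ | ⟨t, rfl, ht⟩
  · rcases t with _ | ⟨x, _ | ⟨y, _ | ⟨z, t⟩⟩⟩ <;> simp at ht <;> simp [ht]
  · exact Or.inl ⟨t, rfl, ht⟩

theorem IsBalanced.ht_nonneg {x y : List Side} (h : IsBalanced (x ++ y)) :
    0 ≤ ht wA x ∧ 0 ≤ ht wB x := by
  have h1 := (stays_append.1 h.1).1.ht_nonneg
  have h2 := (stays_append.1 h.2.2.1).1.ht_nonneg
  omega

theorem IsBalanced.ht_nonpos {x y : List Side} (h : IsBalanced (x ++ y)) :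
    ht wA y ≤ 0 ∧ ht wB y ≤ 0 := by
  have h1 := h.ht_nonneg
  have h2 := h.2.1
  have h3 := h.2.2.2
  simp at h2 h3
  omega

/-- Balancedness depends on a factor only through its effect on the heights. -/
theorem isBalanced_congr {l₁ m m' l₂ : List Side} (hA : ∀ k, Stays wA k m ↔ Stays wA k m')
    (hB : ∀ k, Stays wB k m ↔ Stays wB k m') (hA' : ht wA m = ht wA m')
    (hB' : ht wB m = ht wB m') : IsBalanced (l₁ ++ (m ++ l₂)) ↔ IsBalanced (l₁ ++ (m' ++ l₂)) := by
  simp [IsBalanced, stays_append, hA, hB, hA', hB']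

/-- The three growth moves rewrite `UR` as `LR UR UL`, `LR` as `LL LR UR`, and `UR LR` as `LR UR`.
Each time the inserted pair cancels, or letters of different kinds commute, so neither bracketing
notices the change. -/
theorem isBalanced_upper {l₁ l₂ : List Side} :
    IsBalanced (l₁ ++ LR :: UR :: UL :: l₂) ↔ IsBalanced (l₁ ++ UR :: l₂) :=
  isBalanced_congr (m := [LR, UR, UL]) (m' := [UR]) (by simp) (by simp; omega) (by simp)
    (by simp)

theorem isBalanced_lower {l₁ l₂ : List Side} :
    IsBalanced (l₁ ++ LL :: LR :: UR :: l₂) ↔ IsBalanced (l₁ ++ LR :: l₂) :=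
  isBalanced_congr (m := [LL, LR, UR]) (m' := [LR]) (by simp; omega) (by simp) (by simp)
    (by simp)

theorem isBalanced_double {l₁ l₂ : List Side} :
    IsBalanced (l₁ ++ LR :: UR :: l₂) ↔ IsBalanced (l₁ ++ UR :: LR :: l₂) :=
  isBalanced_congr (m := [LR, UR]) (m' := [UR, LR]) (by simp) (by simp) (by simp)
    (by simp)

theorem start_append {l₁ l₂ l₂' : List Side} (h : ∃ u, l₁ ++ l₂ = LL :: u)
    (h' : ∀ u, l₂ = LL :: u → ∃ u, l₂' = LL :: u) : ∃ u, l₁ ++ l₂' = LL :: u := by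
  obtain ⟨u, hu⟩ := h
  cases l₁ with
  | nil => exact h' u hu
  | cons a l₁ => simp at hu; exact ⟨l₁ ++ l₂', by simp [hu.1]⟩

namespace IsFishWord

variable {l₁ l₂ : List Side}

/-- A balanced factor cannot cut the new block: it would begin with `UR` or `UL`, or end with `LR`
or `LR UR`. So it contains the whole block or avoids it, and comes from the old word. For `cross`, a
factor ending inside the block has only gained an `LR`. -/
theorem upper (h : IsFishWord (l₁ ++ UR :: l₂)) : IsFishWord (l₁ ++ LR :: UR :: UL :: l₂) := by
  refine ⟨start_append h.start (by simp), isBalanced_upper.2 h.bal, ?_, ?_⟩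
  · intro u x v hw hx hb
    rcases split_three hw with ⟨t, rfl, ht⟩ | ⟨rfl, ht⟩ | ⟨rfl, ht⟩ | ⟨t, rfl, rfl⟩
    · rcases split_three ht.symm with ⟨t', rfl, rfl⟩ | ⟨rfl, rfl⟩ | ⟨rfl, rfl⟩ | ⟨t', rfl, rfl⟩
      · simpa using h.conn u x (t' ++ UR :: l₂) (by simp) hx hb
      · have := IsBalanced.ht_nonpos hb; simp at this
      · have := IsBalanced.ht_nonpos hb; simp at this
      · exact h.conn u (t ++ UR :: t') v (by simp) (by simp) (isBalanced_upper.1 hb)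
    · cases x with
      | nil => simp at hx
      | cons s x => simp at ht; obtain ⟨rfl, -⟩ := ht; have := hb.1.2.nonneg; simp at this
    · cases x with
      | nil => simp at hx
      | cons s x => simp at ht; obtain ⟨rfl, -⟩ := ht; have := hb.2.2.1.2.nonneg; simp at this
    · have := h.conn (l₁ ++ UR :: t) x v (by simp) hx hb; simp at this
  · intro u x v hw hx
    rw [show u ++ LL :: (x ++ v) = (u ++ [LL]) ++ (x ++ v) by simp] at hw
    rcases split_three hw with ⟨t, rfl, ht⟩ | ⟨h', -⟩ | ⟨h', -⟩ | ⟨t, h', rfl⟩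
    · rcases split_three ht.symm with ⟨t', rfl, rfl⟩ | ⟨rfl, rfl⟩ | ⟨rfl, rfl⟩ | ⟨t', rfl, rfl⟩
      · exact h.cross u x (t' ++ UR :: l₂) (by simp) hx
      · have := h.cross u t (UR :: l₂) (by simp) (stays_append.1 hx).1
        simp; omega
      · have := h.cross u t (UR :: l₂) (by simp) (stays_append.1 hx).1
        simp; omega
      · have := h.cross u (t ++ UR :: t') v (by simp) (by simp [stays_append] at hx ⊢; tauto)
        simpa using this
    · exact absurd (congrArg List.getLast? h') (by simp)
    · exact absurd (congrArg List.getLast? h') (by simp)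
    · obtain rfl | ⟨t, s, rfl⟩ := t.eq_nil_or_concat
      · exact absurd (congrArg List.getLast? h') (by simp)
      · have hs : s = LL := by
          rw [List.concat_eq_append, show l₁ ++ LR :: UR :: UL :: (t ++ [s]) = (l₁ ++ LR :: UR :: UL :: t) ++ [s] by simp] at h'
          simpa using (List.append_inj' h' rfl).2.symm
        subst hs
        exact h.cross (l₁ ++ UR :: t) x v (by simp) hx

/-- Again no balanced factor cuts the block. A factor starting with its `LR` is either `LR` alone,
which is unbalanced, or closes with `UR` a bracket it did not open. The new `LL` satisfies `cross`,
because what follows it is `LR` and then its own closing letter. -/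
theorem lower (h : IsFishWord (l₁ ++ LR :: l₂)) : IsFishWord (l₁ ++ LL :: LR :: UR :: l₂) := by
  refine ⟨start_append h.start (by simp), isBalanced_lower.2 h.bal, ?_, ?_⟩
  · intro u x v hw hx hb
    rcases split_three hw with ⟨t, rfl, ht⟩ | ⟨rfl, ht⟩ | ⟨rfl, ht⟩ | ⟨t, rfl, rfl⟩
    · rcases split_three ht.symm with ⟨t', rfl, rfl⟩ | ⟨rfl, rfl⟩ | ⟨rfl, rfl⟩ | ⟨t', rfl, rfl⟩
      · simpa using h.conn u x (t' ++ LR :: l₂) (by simp) hx hb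
      · have := IsBalanced.ht_nonpos hb; simp at this
      · have := IsBalanced.ht_nonpos hb; simp at this
      · exact h.conn u (t ++ LR :: t') v (by simp) (by simp) (isBalanced_lower.1 hb)
    · rcases x with _ | ⟨s, _ | ⟨s', x⟩⟩
      · simp at hx
      · simp at ht; obtain ⟨rfl, -⟩ := ht; have := hb.2.2.2; simp at this
      · simp at ht; obtain ⟨rfl, rfl, -⟩ := ht; have := hb.1.2.2.nonneg; simp at this
    · cases x with
      | nil => simp at hx
      | cons s x => simp at ht; obtain ⟨rfl, -⟩ := ht; have := hb.1.2.nonneg; simp at this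
    · have := h.conn (l₁ ++ LR :: t) x v (by simp) hx hb; simp at this
  · intro u x v hw hx
    rw [show u ++ LL :: (x ++ v) = (u ++ [LL]) ++ (x ++ v) by simp] at hw
    rcases split_three hw with ⟨t, rfl, ht⟩ | ⟨h', ht⟩ | ⟨h', -⟩ | ⟨t, h', rfl⟩
    · rcases split_three ht.symm with ⟨t', rfl, rfl⟩ | ⟨rfl, rfl⟩ | ⟨rfl, rfl⟩ | ⟨t', rfl, rfl⟩
      · exact h.cross u x (t' ++ LR :: l₂) (by simp) hx
      · have := h.cross u t (LR :: l₂) (by simp) (stays_append.1 hx).1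
        simp; omega
      · have := h.cross u t (LR :: l₂) (by simp) (stays_append.1 hx).1
        simp; omega
      · have := h.cross u (t ++ LR :: t') v (by simp) (by
          simp [stays_append] at hx ⊢; tauto)
        simpa using this
    · rcases x with _ | ⟨s, _ | ⟨s', x⟩⟩
      · simp
      · simp at ht; obtain ⟨rfl, -⟩ := ht; simp
      · simp at ht; obtain ⟨rfl, rfl, -⟩ := ht; have := hx.2.2.nonneg; simp at this
    · exact absurd (congrArg List.getLast? h') (by simp)
    · obtain rfl | ⟨t, s, rfl⟩ := t.eq_nil_or_concat
      · exact absurd (congrArg List.getLast? h') (by simp)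
      · have hs : s = LL := by
          rw [List.concat_eq_append, show l₁ ++ LL :: LR :: UR :: (t ++ [s]) = (l₁ ++ LL :: LR :: UR :: t) ++ [s] by simp] at h'
          simpa using (List.append_inj' h' rfl).2.symm
        subst hs
        exact h.cross (l₁ ++ LR :: t) x v (by simp) hx

theorem double (h : IsFishWord (l₁ ++ UR :: LR :: l₂)) : IsFishWord (l₁ ++ LR :: UR :: l₂) := by
  refine ⟨start_append h.start (by simp), isBalanced_double.2 h.bal, ?_, ?_⟩
  · intro u x v hw hx hb
    rcases split_two hw with ⟨t, rfl, ht⟩ | ⟨rfl, ht⟩ | ⟨t, rfl, rfl⟩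
    · rcases split_two ht.symm with ⟨t', rfl, rfl⟩ | ⟨rfl, rfl⟩ | ⟨t', rfl, rfl⟩
      · simpa using h.conn u x (t' ++ UR :: LR :: l₂) (by simp) hx hb
      · have := IsBalanced.ht_nonpos hb; simp at this
      · exact h.conn u (t ++ UR :: LR :: t') v (by simp) (by simp) (isBalanced_double.1 hb)
    · cases x with
      | nil => simp at hx
      | cons s x => simp at ht; obtain ⟨rfl, -⟩ := ht; have := hb.1.2.nonneg; simp at this
    · have := h.conn (l₁ ++ UR :: LR :: t) x v (by simp) hx hb; simp at this
  · intro u x v hw hx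
    rw [show u ++ LL :: (x ++ v) = (u ++ [LL]) ++ (x ++ v) by simp] at hw
    rcases split_two hw with ⟨t, rfl, ht⟩ | ⟨h', -⟩ | ⟨t, h', rfl⟩
    · rcases split_two ht.symm with ⟨t', rfl, rfl⟩ | ⟨rfl, rfl⟩ | ⟨t', rfl, rfl⟩
      · exact h.cross u x (t' ++ UR :: LR :: l₂) (by simp) hx
      · have := h.cross u t (UR :: LR :: l₂) (by simp) (stays_append.1 hx).1
        simp; omega
      · have := h.cross u (t ++ UR :: LR :: t') v (by simp) (by
          simp [stays_append] at hx ⊢; exact ⟨hx.1, by omega, by have := hx.2.2.nonneg; omega, hx.2.2⟩)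
        simpa using this
    · exact absurd (congrArg List.getLast? h') (by simp)
    · obtain rfl | ⟨t, s, rfl⟩ := t.eq_nil_or_concat
      · exact absurd (congrArg List.getLast? h') (by simp)
      · have hs : s = LL := by
          rw [List.concat_eq_append, show l₁ ++ LR :: UR :: (t ++ [s]) = (l₁ ++ LR :: UR :: t) ++ [s] by simp] at h'
          simpa using (List.append_inj' h' rfl).2.symm
        subst hs
        exact h.cross (l₁ ++ UR :: LR :: t) x v (by simp) hx

/-- The boundary word of a single cell. -/
theorem single : IsFishWord [LL, LR, UR, UL] := by
  refine ⟨⟨_, rfl⟩, by simp [IsBalanced], ?_, ?_⟩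
  · intro u x v hw hx hb
    rcases u with _ | ⟨u₁, _ | ⟨u₂, _ | ⟨u₃, _ | ⟨u₄, u⟩⟩⟩⟩ <;>
    rcases x with _ | ⟨x₁, _ | ⟨x₂, _ | ⟨x₃, _ | ⟨x₄, x⟩⟩⟩⟩ <;>
    simp at hw hx <;> simp [IsBalanced, ← hw] at hb ⊢ <;>
    simp_all
  · intro u x v hw hx
    rcases u with _ | ⟨u₁, _ | ⟨u₂, _ | ⟨u₃, _ | ⟨u₄, u⟩⟩⟩⟩ <;>
    rcases x with _ | ⟨x₁, _ | ⟨x₂, _ | ⟨x₃, _ | ⟨x₄, x⟩⟩⟩⟩ <;>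
    simp at hw <;> simp [← hw] at hx ⊢

/-- The word that stands for the empty fish. -/
theorem empty : IsFishWord [LL, UR] := by
  refine ⟨⟨_, rfl⟩, by simp [IsBalanced], ?_, ?_⟩
  · intro u x v hw hx hb
    rcases u with _ | ⟨u₁, _ | ⟨u₂, u⟩⟩ <;>
    rcases x with _ | ⟨x₁, _ | ⟨x₂, x⟩⟩ <;>
    simp at hw hx <;> simp [IsBalanced, ← hw] at hb ⊢ <;>
    simp_all
  · intro u x v hw hx
    rcases u with _ | ⟨u₁, _ | ⟨u₂, u⟩⟩ <;>
    rcases x with _ | ⟨x₁, _ | ⟨x₂, x⟩⟩ <;>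
    simp at hw <;> simp [← hw] at hx ⊢ <;> simp_all

end IsFishWord

/-- All edges of the word are lower edges. -/
def IsLower (w : List Side) : Prop := ∀ s ∈ w, s = LL ∨ s = LR

theorem isLower_append {u v : List Side} : IsLower (u ++ v) ↔ IsLower u ∧ IsLower v := by
  simp [IsLower, or_imp, forall_and]

theorem isLower_cons {s : Side} {v : List Side} :
    IsLower (s :: v) ↔ (s = LL ∨ s = LR) ∧ IsLower v := by
  simp [IsLower]

theorem IsLower.stays {w : List Side} (h : IsLower w) {k : ℤ} (hk : 0 ≤ k) :
    Stays wA k w ∧ Stays wB k w := by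
  induction w generalizing k with
  | nil => exact ⟨hk, hk⟩
  | cons s w ih =>
    rw [isLower_cons] at h
    rcases h.1 with rfl | rfl
    · exact ⟨⟨hk, (ih h.2 (by simp; omega)).1⟩, ⟨hk, (ih h.2 (by simp; omega)).2⟩⟩
    · exact ⟨⟨hk, (ih h.2 (by simp; omega)).1⟩, ⟨hk, (ih h.2 (by simp; omega)).2⟩⟩

theorem IsLower.ht_nonneg {w : List Side} (h : IsLower w) : 0 ≤ ht wA w ∧ 0 ≤ ht wB w := by
  have := h.stays le_rfl
  have h1 := this.1.ht_nonneg
  have h2 := this.2.ht_nonneg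
  omega

theorem ht_wB_eq_zero {w : List Side} (h : ∀ s ∈ w, s = LL) : ht wB w = 0 := by
  rw [List.eq_replicate_of_mem h]; simp

theorem ht_of_eq_lr {w : List Side} (h : ∀ s ∈ w, s = LR) : ht wA w = 0 ∧ ht wB w = w.length := by
  rw [List.eq_replicate_of_mem h]; simp

theorem IsLower.append_cons_ur {f y b z : List Side} (hf : IsLower f)
    (h : f ++ y = b ++ UR :: z) : ∃ c, b = f ++ c ∧ y = c ++ UR :: z := by
  rcases List.append_eq_append_iff.1 h with ⟨c, rfl, hc⟩ | ⟨c, rfl, hc⟩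
  · exact ⟨c, rfl, hc⟩
  · rcases c with _ | ⟨s, c⟩
    · exact ⟨[], by simp, by simpa using hc.symm⟩
    · simp at hc
      have := hf s (by simp)
      rw [← hc.1] at this
      simp at this

theorem exists_lower_append (w : List Side) :
    ∃ f t, w = f ++ t ∧ IsLower f ∧ (∀ s ∈ t.head?, s = UR ∨ s = UL) := by
  induction w with
  | nil => exact ⟨[], [], rfl, by simp [IsLower], by simp⟩
  | cons s w ih =>
    by_cases hs : s = LL ∨ s = LR
    · obtain ⟨f, t, rfl, hf, ht⟩ := ih
      exact ⟨s :: f, t, rfl, isLower_cons.2 ⟨hs, hf⟩, ht⟩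
    · refine ⟨[], s :: w, rfl, by simp [IsLower], ?_⟩
      cases s <;> simp at hs ⊢

/-! ### The fin of a word, and taking out a factor -/

namespace IsFishWord

variable {w : List Side}

/-- The first upper letter cannot be `UL`: after `LL` this contradicts `cross`, and after `LR` it
creates the proper balanced factor `LR UL`. A word of lower letters only would not close its first
bracket. -/
theorem exists_fin (h : IsFishWord w) : ∃ f t, w = f ++ UR :: t ∧ IsLower f := by
  obtain ⟨f, t, rfl, hf, ht⟩ := exists_lower_append w
  obtain ⟨u, hu⟩ := h.start
  have hb := h.bal
  have hf0 : f ≠ [] := by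
    rintro rfl
    simp at hu
    simp [hu] at ht
  rcases t with _ | ⟨s, t⟩
  · rw [List.append_nil] at hu hb
    have h1 := hb.2.1
    subst hu
    have := (isLower_cons.1 hf).2.ht_nonneg
    simp at h1
    omega
  · rcases ht s (by simp) with rfl | rfl
    · exact ⟨f, t, rfl, hf⟩
    · exfalso
      obtain ⟨f', s, rfl⟩ := List.eq_nil_or_concat' f |>.resolve_left hf0
      rcases (isLower_append.1 hf).2 s (by simp) with rfl | rfl
      · have := h.cross f' [UL] t (by simp) (by simp)
        simp at this
      · have := h.conn f' [LR, UL] t (by simp) (by simp) (by simp [IsBalanced])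
        simp [this.1] at hu

theorem head_of_lower {f t : List Side} (h : IsFishWord (f ++ t)) (hf : IsLower f) :
    t ≠ [] ∧ t.head? ≠ some UL := by
  obtain ⟨g, z, hg, hlow⟩ := h.exists_fin
  obtain ⟨c, rfl, rfl⟩ := hf.append_cons_ur hg
  refine ⟨by simp, ?_⟩
  rcases c with _ | ⟨s, c⟩
  · simp
  · rcases (isLower_append.1 hlow).2 s (by simp) with rfl | rfl <;> simp

/-- A fish word ends with an upper left edge. -/
theorem exists_append_ul (h : IsFishWord w) (hne : w ≠ [LL, UR]) :
    ∃ v, w = v ++ [UL] := by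
  obtain ⟨u, rfl⟩ := h.start
  obtain ⟨x, y, rfl, hx, hx0⟩ := h.exists_closed (u := []) rfl
  obtain ⟨r, rfl, hr⟩ := h.shape rfl hx hx0
  rcases r with _ | r
  · exfalso
    have hB := h.stays_wB (u := []) (x := x) (v := [UR]) (by simp) hx
    by_cases hxe : x = []
    · subst hxe; simp at hne
    · have := h.conn [LL] x [UR] (by simp) hxe ⟨hx, hx0, hB, by simpa using hr⟩
      simp at this
  · exact ⟨LL :: (x ++ UR :: List.replicate r UL), by simp [List.replicate_succ']⟩

/-- Taking out a factor `v` together with the last letter. -/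
theorem remove {f v t : List Side} (h : IsFishWord (f ++ (v ++ (t ++ [UL])))) (hf0 : f ≠ [])
    (hf : IsLower f) (ht0 : t ≠ []) (ht1 : t.head? ≠ some UL) (hvA : Stays wA 0 v)
    (hvA0 : ht wA v = 0) (hvB : ht wB v = 1)
    (hf' : ∀ f₁ f₂ b z r, f = f₁ ++ LL :: f₂ → f₁ ≠ [] →
      f₂ ++ (v ++ (t ++ [UL])) = b ++ UR :: (List.replicate r UL ++ z) → Stays wA 0 b →
      ht wA b = 0 → z.head? ≠ some UL → ht wB b - r ≠ 1) : IsFishWord (f ++ t) := by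
  obtain ⟨f₀, rfl⟩ : ∃ f₀, f = LL :: f₀ := by
    obtain ⟨u, hu⟩ := h.start
    cases f with
    | nil => simp at hf0
    | cons a f => simp at hu; exact ⟨f, by simp [hu.1]⟩
  have hvne : ¬ ∀ s ∈ v, s = LL := fun hv => by rw [ht_wB_eq_zero hv] at hvB; simp at hvB
  -- After the first letter, the second height stays at least `1` once `v` has been read, so
  -- removing `v` keeps it nonnegative. While the first bracket is open, `cross` gives `0 ≤`, and
  -- equality would make `v` consist of `LL`s by `eq_ll`. Once it is closed, only `UL`s remain by
  -- `shape`, and the last of them lies outside `y`.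
  have hpos : ∀ y z, t = y ++ z → 1 ≤ ht wB (f₀ ++ (v ++ y)) := by
    rintro y z rfl
    by_cases hA : Stays wA 0 (f₀ ++ (v ++ y))
    · have h1 := h.cross [] (f₀ ++ (v ++ y)) (z ++ [UL]) (by simp) hA
      rcases h1.lt_or_eq with h1 | h1
      · exact h1
      · refine absurd (fun s hs => ?_) hvne
        exact h.eq_ll (u := []) (x := f₀ ++ (v ++ y)) (v := z ++ [UL]) (by simp) hA h1.symm s
          (by simp [hs])
    · obtain ⟨x, z', hx, hxA, hx0⟩ := exists_dip_wA hA
      obtain ⟨r, hr, hxr⟩ := h.shape (x := x) (v := z' ++ (z ++ [UL])) (by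
        rw [show LL :: f₀ ++ (v ++ (y ++ z ++ [UL])) = LL :: ((f₀ ++ (v ++ y)) ++ (z ++ [UL])) by
          simp, hx]
        simp) hxA hx0
      rw [hx]
      obtain ⟨hl, h1, -⟩ := List.append_eq_replicate_iff.1 hr
      rw [h1]
      simp at hl
      simp [hxr]
      omega
  have hfl := (isLower_cons.1 hf).2
  refine ⟨⟨f₀ ++ t, rfl⟩, ⟨?_, ?_, ?_, ?_⟩, ?_, ?_⟩
  · have := h.bal.1
    simp only [stays_append, hvA0, add_zero] at this ⊢
    exact ⟨this.1, this.2.2.1⟩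
  · have := h.bal.2.1
    simp [hvA0] at this ⊢
    omega
  · rw [stays_append]
    refine ⟨(hf.stays le_rfl).2, stays_iff.2 fun y z hy => ?_⟩
    have := hpos y z hy
    simp [hvB] at this ⊢
    omega
  · have := h.bal.2.2.2
    simp [hvB] at this ⊢
    omega
  · intro u x z hw hx hb
    rcases List.append_eq_append_iff.1 hw with ⟨c, rfl, rfl⟩ | ⟨c, hc, hw'⟩
    · have := h.conn (LL :: f₀ ++ (v ++ c)) x (z ++ [UL]) (by simp) hx hb
      simp at this
    rcases List.append_eq_append_iff.1 hw' with ⟨y, rfl, rfl⟩ | ⟨y, rfl, rfl⟩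
    · have := h.conn u x (y ++ (v ++ (t ++ [UL]))) (by rw [hc]; simp) hx hb
      simp at this
    -- The balanced factor now straddles the cut: it is `c y`, with `c` a suffix of `f` and `y` a
    -- prefix of `t`.
    by_cases hy0 : y = []
    · subst hy0
      have := h.conn u (c ++ []) (v ++ (z ++ [UL])) (by rw [hc]; simp) hx hb
      simp at this
    have hyh : y.head? ≠ some UL := by
      cases y with
      | nil => simp
      | cons s y => simpa using ht1
    rw [hc] at hf hf'
    have hcl := (isLower_append.1 hf).2
    -- Take the first `LL` of `c`. Its closing `UR` lies in `y`, so putting `v` back turns `t₂ y₁`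
    -- into the inside `t₂ v y₁` of a bracket of the original word, with second height larger by
    -- one.
    by_cases hLL : LL ∈ c
    · obtain ⟨t₁, t₂, rfl, ht₁⟩ := List.eq_append_cons_of_mem hLL
      have ht₁R : ∀ s ∈ t₁, s = LR := fun s hs =>
        ((isLower_append.1 hcl).1 s hs).resolve_left (by rintro rfl; exact ht₁ hs)
      have ht₂ := (isLower_cons.1 (isLower_append.1 hcl).2).2
      have e1 := ht_of_eq_lr ht₁R
      have hdip : ¬ Stays wA 0 (t₂ ++ y) := fun hs => by
        have h1 := hs.ht_nonneg
        have h2 := hb.2.1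
        simp at h1 h2
        omega
      obtain ⟨b, y₂, hby, hbA, hb0⟩ := exists_dip_wA hdip
      obtain ⟨y₁, rfl, rfl⟩ := ht₂.append_cons_ur hby
      have hb'A : Stays wA 0 (t₂ ++ (v ++ y₁)) := by
        simp only [stays_append, hvA0, add_zero] at hbA ⊢
        exact ⟨hbA.1, hvA.mono hbA.1.ht_nonneg, hbA.2⟩
      have hb'0 : ht wA (t₂ ++ (v ++ y₁)) = 0 := by
        simp [hvA0] at hb0 ⊢; exact hb0
      have e2 := hb.2.2.2
      simp [e1.2] at e2
      -- If this is the first letter of the word, `shape` shows that the factor is everything.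
      -- Otherwise the surplus of the bracket over the following run of `UL` is positive by
      -- `chord_lt` and not `1` by `hf'`. It is thus at least `2`, so it remains positive without
      -- `v`, and the factor cannot return to height `0`.
      by_cases hut : u ++ t₁ = []
      · simp at hut
        obtain ⟨rfl, rfl⟩ := hut
        obtain ⟨r, hr, hxr⟩ := h.shape (x := t₂ ++ (v ++ y₁)) (v := y₂ ++ (z ++ [UL])) (by
          simp at hc; simp [hc]) hb'A hb'0
        obtain ⟨hl, h1, -⟩ := List.append_eq_replicate_iff.1 hr
        have e3 : ht wB y₂ = - y₂.length := by rw [h1]; simp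
        simp [hvB] at hl hxr e2
        refine ⟨rfl, List.length_eq_zero_iff.1 ?_⟩
        omega
      · exfalso
        obtain ⟨s, y₃, rfl, hy₃⟩ := exists_run UL y₂
        by_cases hy₃0 : y₃ = []
        · subst hy₃0
          obtain ⟨q, z', hz, hz'⟩ := exists_run UL (z ++ [UL])
          have hrep : List.replicate (s + q) UL ++ z' = List.replicate s UL ++ (z ++ [UL]) := by
            rw [hz, ← List.replicate_append_replicate]; simp only [List.append_assoc]
          have c1 := hf' (u ++ t₁) t₂ (t₂ ++ (v ++ y₁)) z' (s + q) (by simp) hut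
            (by rw [hrep]; simp) hb'A hb'0 hz'
          have c2 := h.chord_lt (u := u ++ t₁) (x := t₂ ++ (v ++ y₁)) (v := z') (r := s + q)
            (by rw [hrep, hc]; simp) hb'A hb'0 (Or.inl hut)
          simp [hvB] at c1 c2 e2
          omega
        · have hz' : (y₃ ++ (z ++ [UL])).head? ≠ some UL := by
            cases y₃ with
            | nil => simp at hy₃0
            | cons a y₃ => simpa using hy₃
          have c1 := hf' (u ++ t₁) t₂ (t₂ ++ (v ++ y₁)) (y₃ ++ (z ++ [UL])) s (by simp) hut
            (by simp) hb'A hb'0 hz'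
          have c2 := h.chord_lt (u := u ++ t₁) (x := t₂ ++ (v ++ y₁)) (v := y₃ ++ (z ++ [UL]))
            (r := s) (by rw [hc]; simp) hb'A hb'0 (Or.inl hut)
          have c3 := h.no_dip (u := u ++ (t₁ ++ LL :: (t₂ ++ (v ++ (y₁ ++ UR ::
            List.replicate s UL))))) (x := y₃) (v := z ++ [UL]) (by rw [hc]; simp) hy₃ (by
              have := hb.1
              simp [stays_append] at this
              exact this.2.2.2.2.2.2.mono (by simp at hb0; omega))
          have := c3.ht_nonneg
          simp [hvB] at c1 c2 e2
          omega
    -- Here `c` consists of `LR`s, and `y` does not lower the second height by `no_dip`; hence `c`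
    -- is empty and `y` is a balanced factor of the original word.
    · have hR : ∀ s ∈ c, s = LR := fun s hs =>
        (hcl s hs).resolve_left (by rintro rfl; exact hLL hs)
      have e := ht_of_eq_lr hR
      have hbA := hb.1
      rw [stays_append, e.1] at hbA
      have h1 := h.no_dip (u := LL :: f₀ ++ v) (x := y) (v := z ++ [UL]) (by simp) hyh
        (by simpa using hbA.2)
      have h2 := hb.2.2.2
      have h3 := h1.ht_nonneg
      simp [e.2] at h2
      have hc0 : c = [] := List.length_eq_zero_iff.1 (by omega)
      subst hc0
      have := h.conn (LL :: f₀ ++ v) y (z ++ [UL]) (by simp) hy0 hb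
      simp at this
  · intro u x z hw hx
    rcases List.append_eq_append_iff.1 hw with ⟨c, rfl, rfl⟩ | ⟨c, hc, hw'⟩
    · exact h.cross (LL :: f₀ ++ (v ++ c)) x (z ++ [UL]) (by simp) hx
    rcases c with _ | ⟨s, c⟩
    · simp at hw' hc
      exact h.cross (LL :: f₀ ++ v) x (z ++ [UL]) (by simp [← hw']) hx
    simp at hw'
    obtain ⟨rfl, hw'⟩ := hw'
    rw [hc, isLower_append, isLower_cons] at hf
    rcases List.append_eq_append_iff.1 hw' with ⟨y, rfl, rfl⟩ | ⟨y, rfl, rfl⟩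
    · exact (isLower_append.1 hf.2.2).1.ht_nonneg.2
    -- Reinsert `v`: the height is then nonnegative, and nonzero because `eq_ll` would make `v`
    -- consist of `LL`s. So it is at least `1`, and stays nonnegative when `v` is taken out.
    · have hA : Stays wA 0 (c ++ (v ++ y)) := by
        simp only [stays_append, hvA0, add_zero] at hx ⊢
        exact ⟨hx.1, hvA.mono hx.1.ht_nonneg, hx.2⟩
      have h1 := h.cross u (c ++ (v ++ y)) (z ++ [UL]) (by rw [hc]; simp) hA
      rcases h1.lt_or_eq with h1 | h1
      · simp [hvB] at h1 ⊢
        omega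
      · refine absurd (fun s hs => ?_) hvne
        exact h.eq_ll (u := u) (x := c ++ (v ++ y)) (v := z ++ [UL]) (by rw [hc]; simp) hA h1.symm
          s (by simp [hs])

end IsFishWord

/-- A factor that can be taken out: a single edge, or a fish word without its last letter. -/
def IsPiece (v t : List Side) : Prop :=
  (v = [LR] ∧ t.head? = some UR) ∨ IsFishWord (v ++ [UL])

theorem IsFishWord.exists_chord {v : List Side} (h : IsFishWord (v ++ [UL])) :
    ∃ (b : List Side) (r : ℕ), v = LL :: (b ++ UR :: List.replicate r UL) ∧ Stays wA 0 b ∧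
      ht wA b = 0 ∧ ht wB b = r + 1 := by
  obtain ⟨u, hu⟩ := h.start
  obtain ⟨x, y, rfl, hx, hx0⟩ := h.exists_closed (u := []) hu
  obtain ⟨r, rfl, hr⟩ := h.shape hu hx hx0
  rcases r with _ | r
  · rw [show LL :: (x ++ UR :: List.replicate 0 UL) = (LL :: x) ++ [UR] by simp] at hu
    simpa using (List.append_inj' hu rfl).2
  · refine ⟨x, r, ?_, hx, hx0, by simpa using hr⟩
    rw [List.replicate_succ', ← List.cons_append, ← List.cons_append, ← List.append_assoc] at hu
    simpa using (List.append_inj' hu rfl).1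

/-- Both `UR`s are the first letter at which the first height becomes negative. -/
theorem dip_unique {b b' z z' : List Side} (h : b ++ UR :: z = b' ++ UR :: z')
    (hb : Stays wA 0 b) (hb0 : ht wA b = 0) (hb' : Stays wA 0 b') (hb'0 : ht wA b' = 0) :
    b = b' ∧ z = z' := by
  rcases List.append_eq_append_iff.1 h with ⟨c, rfl, hc⟩ | ⟨c, rfl, hc⟩
  · rcases c with _ | ⟨s, c⟩
    · simpa using hc
    · simp at hc
      rw [← hc.1, stays_append, hb0] at hb'
      have := hb'.2.2.nonneg
      simp at this
  · rcases c with _ | ⟨s, c⟩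
    · simpa using hc.symm
    · simp at hc
      rw [← hc.1, stays_append, hb'0] at hb
      have := hb.2.2.nonneg
      simp at this

theorem run_unique {s : Side} : ∀ {r r' : ℕ} {z z' : List Side},
    List.replicate r s ++ z = List.replicate r' s ++ z' → z.head? ≠ some s → z'.head? ≠ some s →
    r = r' ∧ z = z'
  | 0, 0, z, z', h, _, _ => ⟨rfl, by simpa using h⟩
  | 0, r' + 1, z, z', h, hz, _ => by
    simp [List.replicate_succ] at h; simp [h] at hz
  | r + 1, 0, z, z', h, _, hz' => by
    simp [List.replicate_succ] at h; simp [← h] at hz'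
  | r + 1, r' + 1, z, z', h, hz, hz' => by
    simp [List.replicate_succ] at h
    have := run_unique h hz hz'
    exact ⟨by rw [this.1], this.2⟩

/-! ### Existence and uniqueness of the decomposition of a fish word -/

namespace IsFishWord

variable {w : List Side}

/-- A fish word decomposes into smaller ones. -/
theorem exists_decomposition (h : IsFishWord w) (hne : w ≠ [LL, UR]) :
    ∃ f v t, w = f ++ (v ++ (t ++ [UL])) ∧ f ≠ [] ∧ IsLower f ∧ IsPiece v t ∧
      IsFishWord (f ++ t) := by
  have hend := h.exists_append_ul hne
  -- `P n`: a bracket opened in the fin at position `n > 0` exceeds the maximal run of `UL` after it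
  -- by exactly one. The last `UL` of the word is kept apart.
  let P : ℕ → Prop := fun n => ∃ f b r t, w = f ++ (LL :: (b ++ UR :: List.replicate r UL) ++
    (t ++ [UL])) ∧ f.length = n ∧ f ≠ [] ∧ IsLower f ∧ Stays wA 0 b ∧ ht wA b = 0 ∧
    ht wB b = r + 1 ∧ (t ++ [UL]).head? ≠ some UL
  have hP : ∀ f₁ f₂ b z r, w = f₁ ++ LL :: f₂ → f₁ ≠ [] → IsLower f₁ →
      f₂ = b ++ UR :: (List.replicate r UL ++ z) → Stays wA 0 b →
      ht wA b = 0 → z.head? ≠ some UL → ht wB b - r = 1 → P f₁.length := by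
    intro f₁ f₂ b z r hw hf₁ hlow hf₂ hb hb0 hz hr
    obtain ⟨v, hv⟩ := hend
    obtain rfl | ⟨t, s, rfl⟩ := List.eq_nil_or_concat' z
    -- Something follows the run: otherwise the word would end at second height at least `1`.
    · have h1 := h.bal.2.2.2
      rw [hw, hf₂] at h1
      have := hlow.ht_nonneg
      simp at h1
      omega
    · have hs : s = UL := by
        rw [hv, hf₂] at hw
        have := congrArg List.getLast? hw
        simp [List.getLast?_append, List.getLast?_cons] at this
        exact this.symm
      subst hs
      exact ⟨f₁, b, r, t, by rw [hw, hf₂]; simp, rfl, hf₁, hlow, hb, hb0, by omega, hz⟩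
  classical
  -- The leftmost such bracket is removed. Minimality says that no earlier `LL` of the fin, except
  -- possibly the first letter, has surplus `1`, which is the last hypothesis of `remove`.
  by_cases hex : ∃ n, P n
  · obtain ⟨f, b, r, t, hw, hn, hf0, hf, hb, hb0, hbr, ht⟩ := Nat.find_spec hex
    have hmin := fun m hm => Nat.find_min hex (m := m) hm
    rw [← hn] at hmin
    have hB : Stays wB 0 b := h.stays_wB (u := f) (x := b) (v := UR :: List.replicate r UL ++
      (t ++ [UL])) (by simp [hw]) hb
    have ht0 : t ≠ [] := by rintro rfl; simp at ht
    have ht1 : t.head? ≠ some UL := by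
      cases t with
      | nil => simp
      | cons s t => simpa using ht
    refine ⟨f, _, t, hw, hf0, hf, Or.inr ?_, ?_⟩
    · have hbal : IsBalanced ((LL :: (b ++ UR :: List.replicate r UL)) ++ [UL]) := by
        have := balanced_chord (r := r + 1) hb hb0 hB (by simpa using hbr)
        simpa [List.replicate_succ'] using this
      refine ⟨⟨_, rfl⟩, hbal, ?_, ?_⟩
      · intro u x z hx hx0 hxb
        -- A factor that misses the appended `UL` is a factor of `w`. One that reaches the end but
        -- not the start either consists of `UL`s, or begins with the closing `UR`, or begins inside
        -- `b` and closes the outer bracket without opening it.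
        obtain rfl | ⟨z, s, rfl⟩ := List.eq_nil_or_concat' z
        · refine ⟨?_, rfl⟩
          rw [List.append_nil] at hx
          rcases u with _ | ⟨s, u⟩
          · rfl
          exfalso
          simp at hx
          obtain ⟨-, hx⟩ := hx
          rw [show b ++ UR :: (List.replicate r UL ++ [UL]) = b ++ ([UR] ++
            List.replicate (r + 1) UL) by simp [List.replicate_succ']] at hx
          rcases List.append_eq_append_iff.1 hx with ⟨c, rfl, hc⟩ | ⟨c, rfl, rfl⟩
          · rcases c with _ | ⟨s, c⟩
            · rw [List.nil_append] at hc
              rw [← hc] at hxb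
              have := hxb.1.2.nonneg
              simp at this
            · simp at hc
              obtain ⟨-, hc⟩ := hc
              have := (List.append_eq_replicate_iff.1 hc.symm).2.2
              rw [this] at hxb
              have h1 := hxb.2.2.2
              simp at h1
              exact hx0 h1
          · have h1 := (stays_append.1 hb).1.ht_nonneg
            have h2 := hxb.2.1
            simp at h2 hb0
            omega
        · exfalso
          rw [← List.append_assoc, ← List.append_assoc] at hx
          have hx' := (List.append_inj' hx rfl).1
          have := h.conn (f ++ u) x (z ++ (t ++ [UL])) (by
            rw [hw, hx']; simp) hx0 hxb
          simp at this
      · intro u x z hx hxA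
        obtain rfl | ⟨z, s, rfl⟩ := List.eq_nil_or_concat' z
        · have h1 := hbal.2.2.2
          rw [hx] at h1
          rw [List.append_nil] at hx
          have h2 := hbal.1
          have h3 := hbal.2.1
          rw [hx, stays_append] at h2
          rw [hx] at h3
          have h4 := h2.1.ht_nonneg
          have h5 := hxA.ht_nonneg
          simp at h3
          omega
        · have hx' : LL :: (b ++ UR :: List.replicate r UL) = u ++ LL :: (x ++ z) :=
            (List.append_inj' (hx.trans (by simp) : _ = (u ++ LL :: (x ++ z)) ++ [s]) rfl).1
          exact h.cross (f ++ u) x (z ++ (t ++ [UL])) (by rw [hw, hx']; simp) hxA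
    · have h' := h
      rw [hw] at h'
      refine h'.remove hf0 hf ht0 ht1 ?_ (by simp [hb0]) (by simp [hbr]) ?_
      · have := (balanced_chord (r := r + 1) hb hb0 hB (by simpa using hbr)).1
        rw [show LL :: (b ++ UR :: List.replicate (r + 1) UL) =
          LL :: (b ++ UR :: List.replicate r UL) ++ [UL] by simp [List.replicate_succ'],
          stays_append] at this
        exact this.1
      · intro f₁ f₂ b' z r' hf₁₂ hf₁ heq hb' hb'0 hz hr'
        refine hmin f₁.length (by rw [hf₁₂]; simp) (hP f₁ _ b' z r' ?_ hf₁ ?_ heq hb' hb'0 hz hr')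
        · rw [hw, hf₁₂]; simp
        · rw [hf₁₂, isLower_append] at hf; exact hf.1
  -- No bracket qualifies, so the piece is the last letter of the fin. It is `LR`, since `LL UR`
  -- would be a balanced factor and thus the whole word.
  · obtain ⟨g, t, hg, hlow⟩ := h.exists_fin
    obtain ⟨f, s, rfl⟩ := List.eq_nil_or_concat' g |>.resolve_left (by
      rintro rfl
      obtain ⟨u, hu⟩ := h.start
      rw [hu] at hg
      simp at hg)
    have hf := (isLower_append.1 hlow).1
    have hs : s = LR := by
      refine ((isLower_append.1 hlow).2 s (by simp)).resolve_left ?_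
      rintro rfl
      have := h.conn f [LL, UR] t (by simp [hg]) (by simp) (by simp [IsBalanced])
      rw [this.1, this.2] at hg
      exact hne hg
    subst hs
    obtain ⟨t', ht'⟩ : ∃ t', UR :: t = t' ++ [UL] := by
      obtain ⟨v, hv⟩ := hend
      obtain rfl | ⟨t, s, rfl⟩ := List.eq_nil_or_concat' t
      · rw [hv] at hg
        simpa using (List.append_inj' hg rfl).2
      · rw [hv, ← List.cons_append, ← List.append_assoc] at hg
        have := (List.append_inj' hg rfl).2
        simp at this
        exact ⟨UR :: t, by simp [this]⟩
    have hw : w = f ++ ([LR] ++ (t' ++ [UL])) := by rw [← ht', hg]; simp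
    have ht0 : t' ≠ [] := by rintro rfl; simp at ht'
    have ht1 : t'.head? = some UR := by
      cases t' with
      | nil => simp at ht0
      | cons s t' => simp at ht'; simp [ht'.1]
    have hf0 : f ≠ [] := by
      rintro rfl
      obtain ⟨u, hu⟩ := h.start
      rw [hu] at hw
      simp at hw
    refine ⟨f, _, t', hw, hf0, hf, Or.inl ⟨rfl, ht1⟩, ?_⟩
    have h' := h
    rw [hw] at h'
    refine h'.remove hf0 hf ht0 (by simp [ht1]) (by simp) (by simp) (by simp) ?_
    intro f₁ f₂ b' z r' hf₁₂ hf₁ heq hb' hb'0 hz hr'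
    refine hex ⟨_, hP f₁ _ b' z r' ?_ hf₁ ?_ heq hb' hb'0 hz hr'⟩
    · rw [hw, hf₁₂]; simp
    · rw [hf₁₂, isLower_append] at hf; exact hf.1

end IsFishWord

/-- Compare two decompositions whose first parts are `f` and `f g`. If `v = LR`, then `f v` is the
whole fin and `g` is empty. If `v` is a bracket with its run and `g` is nonempty, the bracket opens
in `g`; in the word `f g t'`, from which `v'` has been removed, its surplus drops from one to zero.
It then forms with its run a balanced factor, proper because `f` is nonempty. Once `g` is empty, the
closing letter and the run determine `v`. -/
theorem decomposition_unique_aux {f g v t v' t' : List Side} (hf0 : f ≠ []) (hf : IsLower f)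
    (hg : IsLower g) (hv : IsPiece v t) (hv' : IsPiece v' t') (h : IsFishWord (f ++ t))
    (h' : IsFishWord (f ++ g ++ t')) (heq : v ++ (t ++ [UL]) = g ++ (v' ++ (t' ++ [UL]))) :
    g = [] ∧ v = v' ∧ t = t' := by
  have hth := (h.head_of_lower hf).2
  have ht0 := (h.head_of_lower hf).1
  have hth' := (h'.head_of_lower (isLower_append.2 ⟨hf, hg⟩)).2
  have ht'0 := (h'.head_of_lower (isLower_append.2 ⟨hf, hg⟩)).1
  have htu : (t ++ [UL]).head? ≠ some UL := by
    cases t with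
    | nil => simp at ht0
    | cons s t => simpa using hth
  have htu' : (t' ++ [UL]).head? ≠ some UL := by
    cases t' with
    | nil => simp at ht'0
    | cons s t => simpa using hth'
  have hv'h : ∃ u, v' = LL :: u ∨ v' = LR :: u := by
    rcases hv' with ⟨rfl, -⟩ | hv'
    · exact ⟨[], Or.inr rfl⟩
    · obtain ⟨b, r, rfl, -⟩ := hv'.exists_chord
      exact ⟨_, Or.inl rfl⟩
  have hv'A : Stays wA 0 v' ∧ ht wA v' = 0 ∧ ht wB v' = 1 := by
    rcases hv' with ⟨rfl, -⟩ | hv'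
    · simp
    · obtain ⟨h1, h2, h3, h4⟩ := hv'.bal
      simp [stays_append] at h1 h2 h3 h4
      exact ⟨h1.1, h2, by omega⟩
  rcases hv with ⟨rfl, hvt⟩ | hv
  · cases t with
    | nil => simp at hvt
    | cons s t =>
      simp at hvt
      subst hvt
      obtain ⟨u, hu⟩ := hv'h
      rcases g with _ | ⟨s, _ | ⟨s', g⟩⟩
      · rcases hv' with ⟨rfl, -⟩ | hv'
        · exact ⟨rfl, rfl, (List.append_inj' (List.append_cancel_left heq) rfl).1⟩
        · obtain ⟨b, r, rfl, -⟩ := hv'.exists_chord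
          simp at heq
      · exfalso
        rcases hu with rfl | rfl <;> simp at heq
      · exfalso
        simp at heq
        have := hg s' (by simp)
        rw [← heq.2.1] at this
        simp at this
  · obtain ⟨b, r, rfl, hb, hb0, hbr⟩ := hv.exists_chord
    have heq' : LL :: (b ++ UR :: (List.replicate r UL ++ (t ++ [UL]))) =
      g ++ (v' ++ (t' ++ [UL])) := by rw [← heq]; simp
    rcases g with _ | ⟨s, g⟩
    · rcases hv' with ⟨rfl, -⟩ | hv'
      · simp at heq
      · obtain ⟨b', r', rfl, hb', hb'0, hb'r⟩ := hv'.exists_chord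
        simp at heq
        obtain ⟨rfl, h1⟩ := dip_unique heq hb hb0 hb' hb'0
        obtain ⟨rfl, h2⟩ := run_unique h1 htu htu'
        simpa using h2
    · exfalso
      simp at heq'
      obtain ⟨rfl, heq'⟩ := heq'
      have hgl := (isLower_cons.1 hg).2
      have hgv : Stays wA 0 (g ++ v') := by
        rw [stays_append]
        exact ⟨(hgl.stays le_rfl).1, hv'A.1.mono (by simpa using hgl.ht_nonneg.1)⟩
      rw [← List.append_assoc g v'] at heq'
      -- The bracket cannot close inside `g v'`; it closes right after `v'`, or later.
      rcases List.append_eq_append_iff.1 heq' with ⟨c, hc, hc'⟩ | ⟨c, rfl, hc'⟩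
      · rcases c with _ | ⟨s, c⟩
        · rw [List.nil_append] at hc'
          rw [← hc'] at htu'
          cases t' with
          | nil => simp at hc'
          | cons s t' =>
            simp at hc'
            obtain ⟨rfl, hc'⟩ := hc'
            rw [List.append_nil] at hc
            rw [← hc] at hb0 hbr
            have e1 := h'.cross f g (UR :: t') (by simp) (hgl.stays le_rfl).1
            have hB := (hgl.stays le_rfl).2
            have hA := (hgl.stays le_rfl).1
            simp [hv'A] at hb0 hbr
            have ht'' : t' = List.replicate r UL ++ t := by
              refine (List.append_inj' (s₁ := t') (t₁ := [UL]) (t₂ := [UL]) ?_ rfl).1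
              rw [← hc']; simp
            have := h'.conn f (LL :: (g ++ UR :: List.replicate r UL)) t (by
              rw [ht'']; simp) (by simp) (balanced_chord hA hb0 hB hbr)
            exact hf0 this.1
        · simp at hc'
          rw [hc, ← hc'.1, stays_append, hb0] at hgv
          have := hgv.2.2.nonneg
          simp at this
      · have hA : Stays wA 0 (g ++ c) := by
          simp only [stays_append, ht_append, hv'A.2.1, add_zero] at hb ⊢
          exact ⟨hb.1.1, hb.2⟩
        have ht'' : t' = c ++ (UR :: (List.replicate r UL ++ t)) := by
          refine (List.append_inj' (s₁ := t') (t₁ := [UL]) (t₂ := [UL]) ?_ rfl).1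
          rw [hc']; simp
        have hB := h'.stays_wB (u := f) (x := g ++ c) (v := UR :: (List.replicate r UL ++ t))
          (by rw [ht'']; simp) hA
        simp [hv'A] at hb0 hbr
        have := h'.conn f (LL :: ((g ++ c) ++ UR :: List.replicate r UL)) t (by
          rw [ht'']; simp) (by simp) (balanced_chord hA (by simpa using hb0) hB (by
            simp; omega))
        exact hf0 this.1

/-- The decomposition of a fish word is unique. -/
theorem decomposition_unique {f v t f' v' t' : List Side} (hf0 : f ≠ []) (hf : IsLower f)
    (hf'0 : f' ≠ []) (hf' : IsLower f') (hv : IsPiece v t) (hv' : IsPiece v' t')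
    (h : IsFishWord (f ++ t)) (h' : IsFishWord (f' ++ t'))
    (heq : f ++ (v ++ (t ++ [UL])) = f' ++ (v' ++ (t' ++ [UL]))) :
    f = f' ∧ v = v' ∧ t = t' := by
  rcases List.append_eq_append_iff.1 heq with ⟨g, rfl, hg⟩ | ⟨g, rfl, hg⟩
  · obtain ⟨rfl, h1, h2⟩ := decomposition_unique_aux hf0 hf (isLower_append.1 hf').2 hv hv' h h' hg
    simp [h1, h2]
  · obtain ⟨rfl, h1, h2⟩ := decomposition_unique_aux hf'0 hf' (isLower_append.1 hf).2 hv' hv h' h hg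
    simp [h1, h2]

/-! ### Stack sorting -/

theorem le_listMax {x : ℕ} {l : List ℕ} (h : x ∈ l) : x ≤ listMax l := by
  induction l with
  | nil => simp at h
  | cons a l ih =>
    change x ≤ max a (listMax l)
    rcases List.mem_cons.1 h with rfl | h
    · exact le_max_left _ _
    · exact (ih h).trans (le_max_right _ _)

theorem stackSort_mid {A B : List ℕ} {m : ℕ} (hA : ∀ x ∈ A, x < m) (hB : ∀ x ∈ B, x < m) :
    stackSort (A ++ m :: B) = stackSort A ++ stackSort B ++ [m] := by
  obtain ⟨a, l, hl⟩ : ∃ a l, A ++ m :: B = a :: l := by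
    cases A <;> simp
  have hmax : listMax (A ++ m :: B) = m := by
    refine le_antisymm ?_ (le_listMax (by simp))
    have := listMax_mem a l
    rw [← hl] at this
    rcases List.mem_append.1 this with h | h
    · exact (hA _ h).le
    · rcases List.mem_cons.1 h with h | h
      · exact h.le
      · exact (hB _ h).le
  have hbef : partBefore m (A ++ m :: B) = A := by
    rw [partBefore, List.takeWhile_append_of_pos (by
      intro x hx; simpa using (hA x hx).ne)]
    simp
  have haft : partAfter m (A ++ m :: B) = B := by
    rw [partAfter, List.dropWhile_append_of_pos (by
      intro x hx; simpa using (hA x hx).ne)]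
    simp
  rw [hl, stackSort, ← hl, hmax, hbef, haft]

/-- Induction along the position of the largest entry. -/
theorem max_induction {P : (L : List ℕ) → L.Nodup → Prop} (nil : P [] List.nodup_nil)
    (mid : ∀ A m B, (∀ x ∈ A, x < m) → (∀ x ∈ B, x < m) → (h : (A ++ m :: B).Nodup) →
      P A h.of_append_left → P B h.of_append_right.of_cons → P (A ++ m :: B) h) :
    ∀ (L : List ℕ) (hL : L.Nodup), P L hL := by
  intro L
  induction hn : L.length using Nat.strong_induction_on generalizing L with
  | _ n ih =>
  intro hL
  rcases L with _ | ⟨a, l⟩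
  · exact nil
  have hmem := listMax_mem a l
  obtain ⟨A, B, hAB⟩ := List.append_of_mem hmem
  set m := listMax (a :: l)
  have hlt : ∀ x, x ∈ A ∨ x ∈ B → x < m := by
    intro x hx
    refine lt_of_le_of_ne (le_listMax (by rw [hAB]; simp; tauto)) ?_
    rintro rfl
    rw [hAB, List.nodup_append] at hL
    rcases hx with hx | hx
    · exact hL.2.2 _ hx _ (by simp) rfl
    · exact (List.nodup_cons.1 hL.2.1).1 hx
  have hlen := congrArg List.length hAB
  simp at hlen hn
  have hL' := hL
  rw [hAB] at hL'
  have := mid A m B (fun x hx => hlt x (Or.inl hx)) (fun x hx => hlt x (Or.inr hx)) hL'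
    (ih _ (by omega) A rfl _) (ih _ (by omega) B rfl _)
  convert this

theorem stackSort_nil : stackSort [] = [] := by rw [stackSort]

theorem stackSort_perm {L : List ℕ} (hL : L.Nodup) : (stackSort L).Perm L := by
  induction L, hL using max_induction with
  | nil => rw [stackSort_nil]
  | mid A m B hA hB _ ihA ihB =>
    rw [stackSort_mid hA hB, List.append_assoc]
    refine ihA.append ?_
    exact (List.perm_append_comm).trans (ihB.cons m)

theorem mem_stackSort {L : List ℕ} (hL : L.Nodup) {x : ℕ} : x ∈ stackSort L ↔ x ∈ L :=
  (stackSort_perm hL).mem_iff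

theorem stackSort_map {f : ℕ → ℕ} (hf : StrictMono f) {L : List ℕ} (hL : L.Nodup) :
    stackSort (L.map f) = (stackSort L).map f := by
  induction L, hL using max_induction with
  | nil => simp [stackSort_nil]
  | mid A m B hA hB _ ihA ihB =>
    rw [stackSort_mid hA hB, List.map_append, List.map_cons, stackSort_mid, ihA, ihB]
    · simp
    · simpa using fun x hx => hf (hA x hx)
    · simpa using fun x hx => hf (hB x hx)

/-- The largest entry comes last after stack sorting. -/
theorem stackSort_eq_append {L : List ℕ} (hL : L.Nodup) (hne : L ≠ []) :
    ∃ σ m, stackSort L = σ ++ [m] ∧ m ∈ L ∧ ∀ x ∈ L, x ≤ m := by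
  induction L, hL using max_induction with
  | nil => simp at hne
  | mid A m B hA hB _ _ _ =>
    refine ⟨_, m, stackSort_mid hA hB, by simp, fun x hx => ?_⟩
    simp at hx
    rcases hx with hx | rfl | hx
    · exact (hA x hx).le
    · exact le_rfl
    · exact (hB x hx).le

/-- The sequence has no subsequence `b, c, a` with `a < b < c`. -/
def Avoids231 (σ : List ℕ) : Prop := ∀ a b c, a < b → b < c → ¬ [b, c, a].Sublist σ

theorem Avoids231.sublist {σ τ : List ℕ} (h : Avoids231 τ) (hs : σ.Sublist τ) : Avoids231 σ :=
  fun a b c hab hbc h' => h a b c hab hbc (h'.trans hs)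

theorem pair_sublist_append {α : Type*} {x y : α} {u v : List α} : [x, y].Sublist (u ++ v) ↔
    [x, y].Sublist u ∨ (x ∈ u ∧ y ∈ v) ∨ [x, y].Sublist v := by
  rw [List.sublist_append_iff]
  constructor
  · rintro ⟨l₁, l₂, h, h₁, h₂⟩
    rcases l₁ with _ | ⟨a, _ | ⟨b, l₁⟩⟩
    · simp at h; subst h; tauto
    · simp at h; obtain ⟨rfl, rfl⟩ := h; simp at h₁ h₂; tauto
    · simp at h; obtain ⟨rfl, rfl, rfl, rfl⟩ := h; tauto
  · rintro (h | ⟨h₁, h₂⟩ | h)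
    · exact ⟨_, [], by simp, h, by simp⟩
    · exact ⟨[x], [y], rfl, by simpa, by simpa⟩
    · exact ⟨[], _, rfl, by simp, h⟩

theorem triple_sublist_append {α : Type*} {x y z : α} {u v : List α} :
    [x, y, z].Sublist (u ++ v) ↔ [x, y, z].Sublist u ∨ ([x, y].Sublist u ∧ z ∈ v) ∨
      (x ∈ u ∧ [y, z].Sublist v) ∨ [x, y, z].Sublist v := by
  rw [List.sublist_append_iff]
  constructor
  · rintro ⟨l₁, l₂, h, h₁, h₂⟩
    rcases l₁ with _ | ⟨a, _ | ⟨b, _ | ⟨c, l₁⟩⟩⟩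
    · simp at h; subst h; tauto
    · simp at h; obtain ⟨rfl, rfl⟩ := h; simp at h₁; tauto
    · simp at h; obtain ⟨rfl, rfl, rfl⟩ := h; simp at h₂; tauto
    · simp at h; obtain ⟨rfl, rfl, rfl, rfl, rfl⟩ := h; tauto
  · rintro (h | ⟨h₁, h₂⟩ | ⟨h₁, h₂⟩ | h)
    · exact ⟨_, [], by simp, h, by simp⟩
    · exact ⟨[x, y], [z], rfl, h₁, by simpa⟩
    · exact ⟨[x], [y, z], rfl, by simpa, h₂⟩
    · exact ⟨[], _, rfl, by simp, h⟩

theorem mem_of_pair_sublist {α : Type*} {x y : α} {u : List α} (h : [x, y].Sublist u) :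
    x ∈ u ∧ y ∈ u := ⟨h.subset (by simp), h.subset (by simp)⟩

theorem avoids231_map {f : ℕ → ℕ} (hf : StrictMono f) {σ : List ℕ} :
    Avoids231 (σ.map f) ↔ Avoids231 σ := by
  constructor
  · intro h a b c hab hbc hs
    exact h _ _ _ (hf hab) (hf hbc) (hs.map f)
  · intro h a b c hab hbc hs
    obtain ⟨l, hl, he⟩ := List.sublist_map_iff.1 hs
    rcases l with _ | ⟨x, _ | ⟨y, _ | ⟨z, l⟩⟩⟩ <;> simp at he
    obtain ⟨rfl, rfl, rfl, rfl⟩ := he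
    exact h _ _ _ (hf.lt_iff_lt.1 hab) (hf.lt_iff_lt.1 hbc) hl

/-- Knuth: one pass through a stack sorts exactly the sequences avoiding the pattern `231`. -/
theorem pairwise_stackSort_iff {σ : List ℕ} (hσ : σ.Nodup) :
    (stackSort σ).Pairwise (· < ·) ↔ Avoids231 σ := by
  induction σ, hσ using max_induction with
  | nil => simp [stackSort_nil, Avoids231]
  | mid A m B hA hB hnd ihA ihB =>
    have hndA := hnd.of_append_left
    have hndB := hnd.of_append_right.of_cons
    rw [stackSort_mid hA hB, List.pairwise_append, List.pairwise_append, ihA, ihB]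
    simp only [mem_stackSort hndA, mem_stackSort hndB, List.mem_append, List.mem_singleton]
    constructor
    · rintro ⟨⟨h1, h2, h3⟩, -, -⟩ a b c hab hbc hs
      rw [triple_sublist_append] at hs
      have key : ∀ {x y}, [x, y].Sublist (m :: B) → y ∈ B ∧ (x = m ∨ [x, y].Sublist B) := by
        intro x y h
        rw [show m :: B = [m] ++ B from rfl, pair_sublist_append] at h
        rcases h with h | ⟨h, h'⟩ | h
        · simpa using h.length_le
        · simp at h; exact ⟨h', Or.inl h⟩
        · exact ⟨(mem_of_pair_sublist h).2, Or.inr h⟩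
      rcases hs with hs | ⟨hs, ha⟩ | ⟨hb, hs⟩ | hs
      · exact h1 _ _ _ hab hbc hs
      · rcases List.mem_cons.1 ha with rfl | ha
        · have := hA _ (mem_of_pair_sublist hs).1; omega
        · have := h3 _ (mem_of_pair_sublist hs).1 _ ha; omega
      · have := h3 _ hb _ (key hs).1; omega
      · rcases List.sublist_cons_iff.1 hs with hs | ⟨l, hl, hs⟩
        · exact h2 _ _ _ hab hbc hs
        · simp at hl
          obtain ⟨rfl, rfl⟩ := hl
          have := hB _ (mem_of_pair_sublist hs).1
          omega
    · intro h
      -- An entry `x` before `m` and a smaller `y` after it would form the pattern `x, m, y`.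
      refine ⟨⟨h.sublist (by simp), h.sublist (by simp), fun x hx y hy => ?_⟩, by simp, ?_⟩
      · by_contra hxy
        have hne : x ≠ y := (List.nodup_append.1 hnd).2.2 _ hx _ (by simp [hy])
        refine h y x m (by omega) (hA x hx) ?_
        rw [triple_sublist_append]
        refine Or.inr (Or.inr (Or.inl ⟨hx, ?_⟩))
        simpa using hy
      · rintro x (hx | hx) y rfl
        · exact hA x hx
        · exact hB x hx

/-- Two-stack sortable permutations, the empty one included. -/
structure IsTwoStack (π : List ℕ) : Prop where
  nodup : π.Nodup
  range : ∀ x ∈ π, 1 ≤ x ∧ x ≤ π.length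
  avoids : Avoids231 (stackSort π)

theorem perm_idSeq_iff {π : List ℕ} : π.Perm (idSeq π.length) ↔
    π.Nodup ∧ ∀ x ∈ π, 1 ≤ x ∧ x ≤ π.length := by
  constructor
  · intro h
    refine ⟨h.nodup_iff.2 (List.nodup_range' ..), fun x hx => ?_⟩
    have := h.mem_iff.1 hx
    simp [idSeq, List.mem_range'_1] at this
    omega
  · rintro ⟨h1, h2⟩
    refine (List.subperm_of_subset h1 fun x hx => ?_).perm_of_length_le (by simp [idSeq])
    have := h2 x hx
    simp [idSeq, List.mem_range'_1]
    omega

/-- `S(S(π))` is a permutation of `1, …, n`, so it is the identity as soon as it is increasing; by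
Knuth's criterion this means that `S(π)` avoids 231. -/
theorem isTwoStackSortable_iff {π : List ℕ} : IsTwoStackSortable π ↔ π ≠ [] ∧ IsTwoStack π := by
  have key : π.Perm (idSeq π.length) →
      (stackSort (stackSort π) = idSeq π.length ↔ Avoids231 (stackSort π)) := by
    intro h
    have hnd := (perm_idSeq_iff.1 h).1
    have hp := stackSort_perm hnd
    have hnd' := hp.nodup_iff.2 hnd
    rw [← pairwise_stackSort_iff hnd']
    have hid : (idSeq π.length).Pairwise (· < ·) := List.pairwise_lt_range' ..
    constructor
    · intro h'; rw [h']; exact hid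
    · intro h'
      exact List.Perm.eq_of_pairwise (fun a b _ _ h1 h2 => absurd h1 h2.asymm) h' hid
        (((stackSort_perm hnd').trans hp).trans h)
  constructor
  · rintro ⟨h1, h2, h3⟩
    exact ⟨h1, (perm_idSeq_iff.1 h2).1, (perm_idSeq_iff.1 h2).2, (key h2).1 h3⟩
  · rintro ⟨h1, h2, h3, h4⟩
    have := perm_idSeq_iff.2 ⟨h2, h3⟩
    exact ⟨h1, this, (key this).2 h4⟩

/-! ### Left-to-right maxima -/

/-- Replaces the definition by positions with a recursion on the last entry, on which the following
inductions rest. -/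
theorem lrMaxima_append_singleton (σ : List ℕ) (x : ℕ) :
    lrMaxima (σ ++ [x]) = lrMaxima σ ++ if ∀ y ∈ σ, y < x then [x] else [] := by
  have hget : ∀ i, i < σ.length → (σ ++ [x]).getD i 0 = σ.getD i 0 := by
    intro i hi
    simp [List.getD_eq_getElem?_getD, List.getElem?_append_left hi]
  have hx : (σ ++ [x]).getD σ.length 0 = x := by simp [List.getD_eq_getElem?_getD]
  unfold lrMaxima
  rw [List.length_append, List.length_singleton, List.range_succ, List.filter_append,
    List.map_append]
  congr 1
  · rw [List.map_congr_left (f := fun i => (σ ++ [x]).getD i 0) (g := fun i => σ.getD i 0)]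
    · congr 1
      refine List.filter_congr fun i hi => ?_
      rw [List.mem_range] at hi
      rw [hget i hi]
      congr 1
      refine propext (forall₂_congr fun j hj => ?_)
      rw [hget j (hj.trans hi)]
    · intro i hi
      exact hget i (List.mem_range.1 (List.mem_filter.1 hi).1)
  · have : (∀ j < σ.length, (σ ++ [x]).getD j 0 < (σ ++ [x]).getD σ.length 0) ↔
        ∀ y ∈ σ, y < x := by
      rw [hx]
      constructor
      · intro h y hy
        obtain ⟨j, hj, rfl⟩ := List.mem_iff_getElem.1 hy
        have := h j hj
        rw [hget j hj] at this
        simpa [List.getD_eq_getElem?_getD, hj] using this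
      · intro h j hj
        rw [hget j hj]
        refine h _ ?_
        simp [List.getD_eq_getElem?_getD, hj]
    rw [List.filter_singleton]
    simp only [this]
    by_cases h : ∀ y ∈ σ, y < x
    · rw [if_pos h]; simp only [decide_eq_true h]; simp
    · rw [if_neg h]; simp only [decide_eq_false h]; simp

theorem mem_lrMaxima {a : ℕ} {σ : List ℕ} :
    a ∈ lrMaxima σ ↔ ∃ u v, σ = u ++ a :: v ∧ ∀ y ∈ u, y < a := by
  induction σ using List.reverseRecOn with
  | nil => simp [lrMaxima]
  | append_singleton σ x ih =>
    rw [lrMaxima_append_singleton, List.mem_append, ih]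
    constructor
    · rintro (⟨u, v, rfl, h⟩ | h)
      · exact ⟨u, v ++ [x], by simp, h⟩
      · split_ifs at h with hx
        · simp at h; subst h; exact ⟨σ, [], rfl, hx⟩
        · simp at h
    · rintro ⟨u, v, h, hu⟩
      obtain rfl | ⟨v, y, rfl⟩ := List.eq_nil_or_concat' v
      · obtain ⟨rfl, h2⟩ := List.append_inj' h rfl
        simp at h2
        subst h2
        right; rw [if_pos hu]; simp
      · rw [← List.cons_append, ← List.append_assoc] at h
        obtain ⟨rfl, h2⟩ := List.append_inj' h rfl
        exact Or.inl ⟨u, v, rfl, hu⟩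

theorem mem_of_mem_lrMaxima {a : ℕ} {σ : List ℕ} (h : a ∈ lrMaxima σ) : a ∈ σ := by
  obtain ⟨u, v, rfl, -⟩ := mem_lrMaxima.1 h
  simp

theorem lrMaxima_pairwise (σ : List ℕ) : (lrMaxima σ).Pairwise (· < ·) := by
  induction σ using List.reverseRecOn with
  | nil => simp [lrMaxima]
  | append_singleton σ x ih =>
    rw [lrMaxima_append_singleton]
    split_ifs with h
    · rw [List.pairwise_append]
      exact ⟨ih, by simp, fun a ha b hb => by
        simp at hb; subst hb; exact h a (mem_of_mem_lrMaxima ha)⟩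
    · simpa using ih

theorem lrMaxima_append (u v : List ℕ) : lrMaxima (u ++ v) =
    lrMaxima u ++ (lrMaxima v).filter (fun x => decide (∀ y ∈ u, y < x)) := by
  induction v using List.reverseRecOn with
  | nil => simp [lrMaxima]
  | append_singleton v x ih =>
    rw [← List.append_assoc, lrMaxima_append_singleton, ih, lrMaxima_append_singleton,
      List.filter_append, List.append_assoc]
    congr 2
    by_cases hv : ∀ y ∈ v, y < x
    · rw [if_pos hv]
      by_cases hu : ∀ y ∈ u, y < x
      · rw [if_pos (by simpa [or_imp, forall_and] using ⟨hu, hv⟩)]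
        simp only [List.filter_singleton, decide_eq_true hu]
        simp
      · rw [if_neg (fun h => hu fun y hy => h y (by simp [hy]))]
        simp only [List.filter_singleton, decide_eq_false hu]
        simp
    · rw [if_neg hv, if_neg (fun h => hv fun y hy => h y (by simp [hy]))]
      simp

theorem lrMaxima_map {f : ℕ → ℕ} (hf : StrictMono f) (σ : List ℕ) :
    lrMaxima (σ.map f) = (lrMaxima σ).map f := by
  induction σ using List.reverseRecOn with
  | nil => simp [lrMaxima]
  | append_singleton σ x ih =>
    rw [List.map_append, List.map_singleton, lrMaxima_append_singleton, ih,
      lrMaxima_append_singleton, List.map_append]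
    congr 1
    have : (∀ y ∈ σ.map f, y < f x) ↔ ∀ y ∈ σ, y < x := by simp [hf.lt_iff_lt]
    by_cases h : ∀ y ∈ σ, y < x
    · rw [if_pos h, if_pos (this.2 h)]; simp
    · rw [if_neg h, if_neg (mt this.1 h)]; simp

theorem filter_lt_of_pairwise {a : ℕ} : ∀ {L : List ℕ} {i : ℕ}, L.Pairwise (· < ·) →
    L[i]? = some a → L.filter (fun x => decide (a < x)) = L.drop (i + 1)
  | [], i, _, h => by simp at h
  | b :: L, 0, hL, h => by
    simp at h
    subst h
    rw [List.pairwise_cons] at hL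
    simpa using hL.1
  | b :: L, i + 1, hL, h => by
    simp at h
    rw [List.pairwise_cons] at hL
    have := hL.1 a (List.mem_of_getElem? h)
    rw [List.filter_cons_of_neg (by simp; omega), filter_lt_of_pairwise hL.2 h]
    simp

/-! ### The decomposition of two-stack sortable permutations -/

theorem shift_strictMono {k₁ m k₂ : ℕ} (h : k₁ ≤ k₂) : StrictMono (shift k₁ m k₂) := by
  intro x y hxy
  unfold shift
  split_ifs <;> omega

theorem length_permC2 (π₁ π₂ : List ℕ) (a : ℕ) :
    (permC2 π₁ π₂ a).length = π₁.length + π₂.length + 1 := by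
  simp [permC2]; omega

theorem isTwoStack_nil : IsTwoStack [] := by
  refine ⟨List.nodup_nil, by simp, ?_⟩
  rw [stackSort_nil]
  intro a b c _ _ h
  simp at h

/-- Entries of `π₂` are positive, so with `a = 0` all of them are shifted by `k`. The two rules thus
become one, indexed by `0 :: lrMaxima (stackSort π₂)`, with index `0` for C₁. -/
theorem permC1_eq_permC2 {π₁ π₂ : List ℕ} (h₂ : IsTwoStack π₂) :
    permC1 π₁ π₂ = permC2 π₁ π₂ 0 := by
  unfold permC1 permC2
  congr 1
  · conv_lhs => rw [← List.map_id π₁]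
    refine List.map_congr_left fun x hx => ?_
    simp [shift]
  · congr 1
    refine List.map_congr_left fun x hx => ?_
    have := (h₂.range x hx).1
    unfold shift
    rw [if_neg (by omega)]

/-- The data of a decomposition: two permutations and a value that is `0` or a left-to-right
maximum of `S(π₂)`, and `0` if `π₁` is empty. -/
structure IsPermDatum (π₁ π₂ : List ℕ) (a : ℕ) : Prop where
  left : IsTwoStack π₁
  right : IsTwoStack π₂
  mem : a ∈ 0 :: lrMaxima (stackSort π₂)
  eq_zero : π₁ = [] → a = 0

namespace IsPermDatum

variable {π₁ π₂ : List ℕ} {a : ℕ}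

theorem mem_of_ne_zero (h : IsPermDatum π₁ π₂ a) (ha : a ≠ 0) : a ∈ π₂ := by
  have := mem_of_mem_lrMaxima ((List.mem_cons.1 h.mem).resolve_left ha)
  rwa [mem_stackSort h.right.nodup] at this

theorem le_length (h : IsPermDatum π₁ π₂ a) : a ≤ π₂.length := by
  by_cases ha : a = 0
  · omega
  · exact (h.right.range a (h.mem_of_ne_zero ha)).2

/-- Only the largest entry of `π₁` moves, from `k` to `k + a`. The entries of `π₂` fill the other
values from `k` on, around the gap at `k + a`; the next lemma gives that half. -/
theorem left_lt (h : IsPermDatum π₁ π₂ a) {x : ℕ} (hx : x ∈ π₁.map (shift 0 π₁.length a)) :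
    1 ≤ x ∧ (x < π₁.length ∨ x = π₁.length + a) := by
  obtain ⟨y, hy, rfl⟩ := List.mem_map.1 hx
  have := h.left.range y hy
  unfold shift
  split_ifs <;> omega

theorem right_lt (h : IsPermDatum π₁ π₂ a) {x : ℕ}
    (hx : x ∈ π₂.map (shift (π₁.length - 1) (a + 1) π₁.length)) :
    π₁.length ≤ x ∧ 1 ≤ x ∧ x ≠ π₁.length + a ∧ x ≤ π₁.length + π₂.length := by
  obtain ⟨y, hy, rfl⟩ := List.mem_map.1 hx
  have := h.right.range y hy
  have h0 := h.eq_zero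
  have h1 : π₁ = [] ∨ 0 < π₁.length := by
    rcases π₁ with _ | ⟨b, l⟩ <;> simp
  unfold shift
  rcases h1 with h1 | h1
  -- For empty `π₁` the subtraction `k - 1` is truncated to `0`; this is harmless, since then `a =
  -- 0` and nothing is shifted.
  · have := h0 h1
    subst this
    subst h1
    simp
    omega
  · split_ifs <;> omega

theorem nodup_left (h : IsPermDatum π₁ π₂ a) : (π₁.map (shift 0 π₁.length a)).Nodup :=
  h.left.nodup.map (shift_strictMono (by simp)).injective

theorem nodup_right (h : IsPermDatum π₁ π₂ a) :
    (π₂.map (shift (π₁.length - 1) (a + 1) π₁.length)).Nodup :=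
  h.right.nodup.map (shift_strictMono (by simp)).injective

theorem left_lt_max (h : IsPermDatum π₁ π₂ a) :
    ∀ x ∈ π₁.map (shift 0 π₁.length a), x < π₁.length + π₂.length + 1 := by
  intro x hx
  have := h.left_lt hx
  have := h.le_length
  omega

theorem right_lt_max (h : IsPermDatum π₁ π₂ a) :
    ∀ x ∈ π₂.map (shift (π₁.length - 1) (a + 1) π₁.length), x < π₁.length + π₂.length + 1 := by
  intro x hx
  have := h.right_lt hx
  omega

theorem left_ne_right (h : IsPermDatum π₁ π₂ a) {x y : ℕ}
    (hx : x ∈ π₁.map (shift 0 π₁.length a))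
    (hy : y ∈ π₂.map (shift (π₁.length - 1) (a + 1) π₁.length)) : x ≠ y := by
  have := h.left_lt hx
  have := h.right_lt hy
  omega

theorem nodup (h : IsPermDatum π₁ π₂ a) : (permC2 π₁ π₂ a).Nodup := by
  unfold permC2
  rw [List.nodup_append, List.nodup_cons]
  refine ⟨h.nodup_left, ⟨fun hm => (h.right_lt_max _ hm).ne rfl, h.nodup_right⟩, ?_⟩
  intro x hx y hy
  rcases List.mem_cons.1 hy with rfl | hy
  · exact (h.left_lt_max _ hx).ne
  · exact h.left_ne_right hx hy

theorem stackSort_permC2 (h : IsPermDatum π₁ π₂ a) : stackSort (permC2 π₁ π₂ a) =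
    (stackSort π₁).map (shift 0 π₁.length a) ++
      (stackSort π₂).map (shift (π₁.length - 1) (a + 1) π₁.length) ++
      [π₁.length + π₂.length + 1] := by
  unfold permC2
  rw [stackSort_mid h.left_lt_max h.right_lt_max,
    stackSort_map (shift_strictMono (by simp)) h.left.nodup,
    stackSort_map (shift_strictMono (by simp)) h.right.nodup]

theorem mem_left (h : IsPermDatum π₁ π₂ a) {x : ℕ} :
    x ∈ (stackSort π₁).map (shift 0 π₁.length a) ↔ x ∈ π₁.map (shift 0 π₁.length a) :=
  ((stackSort_perm h.left.nodup).map _).mem_iff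

theorem mem_right (h : IsPermDatum π₁ π₂ a) {x : ℕ} :
    x ∈ (stackSort π₂).map (shift (π₁.length - 1) (a + 1) π₁.length) ↔
      x ∈ π₂.map (shift (π₁.length - 1) (a + 1) π₁.length) :=
  ((stackSort_perm h.right.nodup).map _).mem_iff

/-- The largest entry `k` of `π₁` becomes `k + a`, and comes last in `S(π₁)`. -/
theorem exists_last (h : IsPermDatum π₁ π₂ a) (hne : π₁ ≠ []) :
    ∃ σ, stackSort π₁ = σ ++ [π₁.length] ∧ ∀ x ∈ σ, x < π₁.length := by
  obtain ⟨σ, m, hσ, hm, hmax⟩ := stackSort_eq_append h.left.nodup hne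
  have hmem : π₁.length ∈ π₁ := by
    refine (perm_idSeq_iff.2 ⟨h.left.nodup, h.left.range⟩).mem_iff.2 ?_
    have := List.length_pos_iff.2 hne
    simp [idSeq, List.mem_range'_1]
    omega
  have : m = π₁.length := le_antisymm (h.left.range m hm).2 (hmax _ hmem)
  subst this
  refine ⟨σ, hσ, fun x hx => ?_⟩
  have hnd := (stackSort_perm h.left.nodup).nodup_iff.2 h.left.nodup
  rw [hσ, List.nodup_append] at hnd
  have h1 := hnd.2.2 x hx _ (by simp : π₁.length ∈ [π₁.length])
  have h2 := (h.left.range x ((mem_stackSort h.left.nodup).1 (by simp [hσ, hx]))).2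
  omega

/-- Nothing above `a` precedes `a` in `S(π₂)`; hence entries up to `a` come first. -/
theorem lt_of_pair (h : IsPermDatum π₁ π₂ a) {x : ℕ}
    (hs : [x, a].Sublist (stackSort π₂)) : x < a := by
  have hnd := (stackSort_perm h.right.nodup).nodup_iff.2 h.right.nodup
  rcases List.mem_cons.1 h.mem with rfl | ha
  · have := (mem_stackSort h.right.nodup).1 (mem_of_pair_sublist hs).2
    have := h.right.range _ this
    omega
  obtain ⟨u, v, hσ, hu⟩ := mem_lrMaxima.1 ha
  rw [hσ] at hnd hs
  rw [List.nodup_append] at hnd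
  rw [pair_sublist_append] at hs
  rcases hs with hs | ⟨hx, -⟩ | hs
  · exact absurd rfl (hnd.2.2 a (mem_of_pair_sublist hs).2 a (by simp))
  · exact hu x hx
  · have hav := (List.nodup_cons.1 hnd.2.1).1
    rcases List.sublist_cons_iff.1 hs with hs | ⟨l, hl, hs⟩
    · exact absurd (mem_of_pair_sublist hs).2 hav
    · simp at hl
      obtain ⟨rfl, rfl⟩ := hl
      simp at hs
      exact absurd hs hav

/-- If `x > a` preceded `y < a`, then `x` would come after the left-to-right maximum `a`, and `a, x,
y` would be a pattern 231. -/
theorem lt_of_pair_of_le (h : IsPermDatum π₁ π₂ a) {x y : ℕ} (hy : y ≤ a)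
    (hs : [x, y].Sublist (stackSort π₂)) : x ≤ a := by
  by_contra hx
  rw [not_le] at hx
  obtain ⟨hxm, hym⟩ := mem_of_pair_sublist hs
  rcases hy.eq_or_lt with rfl | hya
  · have := h.lt_of_pair hs; omega
  rcases List.mem_cons.1 h.mem with rfl | ha
  · omega
  obtain ⟨u, v, hσ, hu⟩ := mem_lrMaxima.1 ha
  have hav : [a, x, y].Sublist (stackSort π₂) := by
    rw [hσ] at hs ⊢
    rw [pair_sublist_append] at hs
    rcases hs with hs | ⟨hs, -⟩ | hs
    · have := hu x (mem_of_pair_sublist hs).1; omega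
    · have := hu x hs; omega
    · rcases List.sublist_cons_iff.1 hs with hs | ⟨l, hl, hs⟩
      · exact ((List.cons_sublist_cons).2 hs).trans (List.sublist_append_right _ _)
      · simp at hl; omega
  exact h.right.avoids _ _ _ hya hx hav

theorem isTwoStack (h : IsPermDatum π₁ π₂ a) : IsTwoStack (permC2 π₁ π₂ a) := by
  refine ⟨h.nodup, ?_, ?_⟩
  · intro x hx
    rw [length_permC2]
    unfold permC2 at hx
    rcases List.mem_append.1 hx with hx | hx
    · exact ⟨(h.left_lt hx).1, (h.left_lt_max x hx).le⟩
    rcases List.mem_cons.1 hx with rfl | hx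
    · omega
    · exact ⟨(h.right_lt hx).2.1, (h.right_lt_max x hx).le⟩
  · rw [h.stackSort_permC2]
    have hf : StrictMono (shift 0 π₁.length a) := shift_strictMono (by simp)
    have hg : StrictMono (shift (π₁.length - 1) (a + 1) π₁.length) := shift_strictMono (by simp)
    intro x y z hxy hyz hs
    rw [triple_sublist_append] at hs
    rcases hs with hs | ⟨hs, hx⟩ | ⟨-, hs⟩ | hs
    · rw [triple_sublist_append] at hs
      rcases hs with hs | ⟨hs, hx⟩ | ⟨hy, hs⟩ | hs
      · exact (avoids231_map hf).2 h.left.avoids _ _ _ hxy hyz hs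
      · obtain ⟨l, hl, he⟩ := List.sublist_map_iff.1 hs
        have h1 := h.left_lt (h.mem_left.1 (mem_of_pair_sublist hs).1)
        have h2 := h.left_lt (h.mem_left.1 (mem_of_pair_sublist hs).2)
        have h3 := h.right_lt (h.mem_right.1 hx)
        omega
      -- The dangerous pattern has its first entry on the left and the others on the right. The
      -- first entry must be `k + a`, and the last comes from an entry at most `a`; then so does the
      -- middle one by `lt_of_pair_of_le`, and it is too small.
      · obtain ⟨l, hl, he⟩ := List.sublist_map_iff.1 hs
        rcases l with _ | ⟨z', _ | ⟨x', l⟩⟩ <;> simp at he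
        obtain ⟨rfl, rfl, rfl⟩ := he
        have h1 := h.left_lt (h.mem_left.1 hy)
        have h2 := h.right_lt (h.mem_right.1 (mem_of_pair_sublist hs).2)
        have hy' : y = π₁.length + a := by omega
        have hx' : x' ≤ a := by
          by_contra hcon
          unfold shift at hxy
          rw [if_neg (by omega)] at hxy
          omega
        have hz' := h.lt_of_pair_of_le hx' hl
        unfold shift at hyz
        rw [if_pos (by omega)] at hyz
        omega
      · exact (avoids231_map hg).2 h.right.avoids _ _ _ hxy hyz hs
    · simp at hx
      have := (mem_of_pair_sublist hs).1
      rw [List.mem_append, h.mem_left, h.mem_right] at this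
      rcases this with h1 | h1
      · have := h.left_lt_max _ h1; omega
      · have := h.right_lt_max _ h1; omega
    · have := hs.length_le; simp at this
    · have := hs.length_le; simp at this

end IsPermDatum

/-- Write `π = A n B`, and let `M` be the largest entry of `A`; it comes last in `S(A)`. Any other
`x` in `A` is below all of `B`, since a smaller `y` in `B` would give the pattern `x, M, y`. So `A`
has the values `1, …, k-1` and `M = k + a`. If `a > 0`, an entry above `M` preceding `k + a - 1` in
`S(B)` would give a pattern with `M`, so `a` is a left-to-right maximum after standardising. -/
theorem IsTwoStack.exists_datum {π : List ℕ} (h : IsTwoStack π) (hne : π ≠ []) :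
    ∃ π₁ π₂ a, IsPermDatum π₁ π₂ a ∧ π = permC2 π₁ π₂ a := by
  have hperm := perm_idSeq_iff.2 ⟨h.nodup, h.range⟩
  have hpos := List.length_pos_iff.2 hne
  have hmem : ∀ x, 1 ≤ x → x ≤ π.length → x ∈ π := fun x h1 h2 => hperm.mem_iff.2 (by
    simp [idSeq, List.mem_range'_1]; omega)
  obtain ⟨A, B, hAB⟩ := List.append_of_mem (hmem π.length hpos le_rfl)
  have hlen := congrArg List.length hAB
  simp at hlen
  have hnd := h.nodup
  have hrange := h.range
  have hav := h.avoids
  set n := π.length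
  have hndA : A.Nodup := by rw [hAB] at hnd; exact hnd.of_append_left
  have hndB : B.Nodup := by rw [hAB] at hnd; exact hnd.of_append_right.of_cons
  have hdisj : ∀ x ∈ A, ∀ y ∈ B, x ≠ y := fun x hx y hy => by
    rw [hAB, List.nodup_append] at hnd
    exact hnd.2.2 x hx y (by simp [hy])
  have hA : ∀ x ∈ A, 1 ≤ x ∧ x < n := fun x hx => by
    have h1 := hrange x (by rw [hAB]; simp [hx])
    rw [hAB, List.nodup_append] at hnd
    have h2 := hnd.2.2 x hx n (by simp)
    omega
  have hB : ∀ x ∈ B, 1 ≤ x ∧ x < n := fun x hx => by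
    have h1 := hrange x (by rw [hAB]; simp [hx])
    rw [hAB, List.nodup_append, List.nodup_cons] at hnd
    have h2 : x ≠ n := by rintro rfl; exact hnd.2.1.1 hx
    omega
  have hmem' : ∀ x, 1 ≤ x → x < n → x ∈ A ∨ x ∈ B := fun x h1 h2 => by
    have := hmem x h1 h2.le
    rw [hAB] at this
    simp at this
    rcases this with h | h | h
    · exact Or.inl h
    · omega
    · exact Or.inr h
  rw [hAB, stackSort_mid (fun x hx => (hA x hx).2) (fun x hx => (hB x hx).2)] at hav
  have havA : Avoids231 (stackSort A) := hav.sublist (by simp)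
  have havB : Avoids231 (stackSort B) :=
    hav.sublist ((List.sublist_append_right _ _).trans (List.sublist_append_left _ _))
  have havAB : Avoids231 (stackSort A ++ stackSort B) := hav.sublist (by simp)
  by_cases hA0 : A = []
  · subst hA0
    simp at hlen
    refine ⟨[], B, 0, ⟨isTwoStack_nil, ⟨hndB, fun x hx => ?_, havB⟩, by simp, fun _ => rfl⟩, ?_⟩
    · have := hB x hx; omega
    · rw [hAB]
      unfold permC2
      simp
      refine ⟨hlen, ?_⟩
      conv_lhs => rw [← List.map_id B]
      refine List.map_congr_left fun x hx => ?_
      simp [shift]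
  obtain ⟨σ, M, hσ, hM, hmax⟩ := stackSort_eq_append hndA hA0
  have hlt : ∀ x ∈ A, x ≠ M → ∀ y ∈ B, x < y := by
    intro x hx hxM y hy
    by_contra hcon
    have hxσ : x ∈ σ := by
      have := (mem_stackSort hndA).2 hx
      rw [hσ] at this
      simp at this
      tauto
    have := hdisj x hx y hy
    have := hmax x hx
    refine havAB y x M (by omega) (by omega) ?_
    rw [triple_sublist_append, hσ]
    refine Or.inr (Or.inl ⟨?_, (mem_stackSort hndB).2 hy⟩)
    rw [pair_sublist_append]
    exact Or.inr (Or.inl ⟨hxσ, by simp⟩)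
  have hcard : (A.toFinset.erase M).card = A.length - 1 := by
    rw [Finset.card_erase_of_mem (by simpa using hM), List.toFinset_card_of_nodup hndA]
  have hApos := List.length_pos_iff.2 hA0
  -- Counting turns the order relation into values: below an `x ≠ M` of `A` there are only entries
  -- of `A` other than `M`, while below a `y` of `B` there are all `k - 1` of them.
  have c1 : ∀ x ∈ A, x ≠ M → x < A.length := by
    intro x hx hxM
    have : Finset.Icc 1 x ⊆ A.toFinset.erase M := by
      intro z hz
      rw [Finset.mem_Icc] at hz
      have h1 := hmax x hx
      have h2 := hA x hx
      rw [Finset.mem_erase, List.mem_toFinset]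
      refine ⟨by omega, (hmem' z hz.1 (by omega)).resolve_right fun hzB => ?_⟩
      have := hlt x hx hxM z hzB
      omega
    have := Finset.card_le_card this
    rw [hcard, Nat.card_Icc] at this
    omega
  have c2 : ∀ y ∈ B, A.length ≤ y := by
    intro y hy
    have hyA : y ∉ A := fun hy' => hdisj y hy' y hy rfl
    have : insert y (A.toFinset.erase M) ⊆ Finset.Icc 1 y := by
      intro z hz
      rw [Finset.mem_insert, Finset.mem_erase, List.mem_toFinset] at hz
      rw [Finset.mem_Icc]
      rcases hz with rfl | ⟨h1, h2⟩
      · exact ⟨(hB _ hy).1, le_rfl⟩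
      · exact ⟨(hA _ h2).1, (hlt z h2 h1 y hy).le⟩
    have := Finset.card_le_card this
    rw [Finset.card_insert_of_notMem (by simp [hyA]), hcard, Nat.card_Icc] at this
    omega
  have c3 : A.length ≤ M := by
    have : A.toFinset ⊆ Finset.Icc 1 M := by
      intro z hz
      rw [List.mem_toFinset] at hz
      rw [Finset.mem_Icc]
      exact ⟨(hA z hz).1, hmax z hz⟩
    have := Finset.card_le_card this
    rw [List.toFinset_card_of_nodup hndA, Nat.card_Icc] at this
    omega
  have hMn := (hA M hM).2
  set k := A.length with hk
  obtain ⟨a, rfl⟩ : ∃ a, M = k + a := ⟨M - k, by omega⟩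
  -- Inverses of the two shifts: `M` goes back to `k`, and the gap at `k + a` is closed.
  set π₁ := A.map (fun x => if x < k then x else k) with hπ₁
  set π₂ := B.map (fun y => if y < k + a then y - (k - 1) else y - k) with hπ₂
  have l1 : π₁.length = k := by simp [hπ₁, hk]
  have l2 : π₂.length = B.length := by simp [hπ₂]
  have e1 : π₁.map (shift 0 π₁.length a) = A := by
    rw [l1, hπ₁, List.map_map]
    conv_rhs => rw [← List.map_id A]
    refine List.map_congr_left fun x hx => ?_
    by_cases hxM : x = k + a
    · subst hxM
      by_cases ha : a = 0
      · simp [shift, ha]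
      · simp [shift]
    · have := c1 x hx hxM
      simp [shift, this]
  have e2 : π₂.map (shift (π₁.length - 1) (a + 1) π₁.length) = B := by
    rw [l1, hπ₂, List.map_map]
    conv_rhs => rw [← List.map_id B]
    refine List.map_congr_left fun y hy => ?_
    have h1 := c2 y hy
    have h2 := hdisj _ hM y hy
    simp only [Function.comp, shift, id]
    by_cases h3 : y < k + a
    · rw [if_pos h3, if_pos (by omega)]; omega
    · rw [if_neg h3, if_neg (by omega)]; omega
  have hf : StrictMono (shift 0 π₁.length a) := shift_strictMono (by simp)
  have hg : StrictMono (shift (π₁.length - 1) (a + 1) π₁.length) := shift_strictMono (by simp)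
  have nd1 : π₁.Nodup := by rw [← e1] at hndA; exact hndA.of_map _
  have nd2 : π₂.Nodup := by rw [← e2] at hndB; exact hndB.of_map _
  refine ⟨π₁, π₂, a, ⟨⟨nd1, ?_, ?_⟩, ⟨nd2, ?_, ?_⟩, ?_, ?_⟩, ?_⟩
  · intro x hx
    rw [l1]
    rw [hπ₁] at hx
    obtain ⟨z, hz, rfl⟩ := List.mem_map.1 hx
    have := hA z hz
    split_ifs <;> omega
  · rw [← avoids231_map hf, ← stackSort_map hf nd1, e1]
    exact havA
  · intro x hx
    rw [l2]
    rw [hπ₂] at hx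
    obtain ⟨z, hz, rfl⟩ := List.mem_map.1 hx
    have h1 := hB z hz
    have h2 := c2 z hz
    have h3 := hdisj _ hM z hz
    split_ifs <;> omega
  · rw [← avoids231_map hg, ← stackSort_map hg nd2, e2]
    exact havB
  · by_cases ha : a = 0
    · simp [ha]
    · have hBmem : k + a - 1 ∈ B := by
        refine (hmem' _ (by omega) (by omega)).resolve_left fun hcon => ?_
        have := c1 _ hcon (by omega)
        omega
      have ha2 : a ∈ π₂ := by
        rw [hπ₂, List.mem_map]
        exact ⟨_, hBmem, by rw [if_pos (by omega)]; omega⟩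
      obtain ⟨u, v, huv⟩ := List.append_of_mem ((mem_stackSort nd2).2 ha2)
      refine List.mem_cons_of_mem _ (mem_lrMaxima.2 ⟨u, v, huv, fun c hc => ?_⟩)
      by_contra hcon
      have hca : c ≠ a := by
        have := (stackSort_perm nd2).nodup_iff.2 nd2
        rw [huv, List.nodup_append] at this
        exact this.2.2 c hc a (by simp)
      refine havAB (shift (π₁.length - 1) (a + 1) π₁.length a) (k + a)
        (shift (π₁.length - 1) (a + 1) π₁.length c) ?_ ?_ ?_
      · rw [l1]; unfold shift; rw [if_pos (by omega)]; omega
      · rw [l1]; unfold shift; rw [if_neg (by omega)]; omega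
      · rw [triple_sublist_append]
        refine Or.inr (Or.inr (Or.inl ⟨by simp [hσ], ?_⟩))
        rw [← e2, stackSort_map hg nd2, huv]
        have : [c, a].Sublist (u ++ a :: v) := by
          rw [pair_sublist_append]; exact Or.inr (Or.inl ⟨hc, by simp⟩)
        exact this.map _
  · intro h0
    rw [h0] at l1
    simp at l1
    omega
  · unfold permC2
    rw [e1, e2, l1, l2, hAB]
    congr 2

/-- The largest entry separates the two parts, and `k + a` is recovered as the only entry of the
left part that is at least `k`. -/
theorem IsPermDatum.unique {π₁ π₂ π₁' π₂' : List ℕ} {a a' : ℕ} (h : IsPermDatum π₁ π₂ a)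
    (h' : IsPermDatum π₁' π₂' a') (heq : permC2 π₁ π₂ a = permC2 π₁' π₂' a') :
    π₁ = π₁' ∧ π₂ = π₂' ∧ a = a' := by
  have hlen := congrArg List.length heq
  rw [length_permC2, length_permC2] at hlen
  have hsplit : ∀ {A A' B B' : List ℕ} {n : ℕ}, (∀ x ∈ A, x < n) → (∀ x ∈ A', x < n) →
      A ++ n :: B = A' ++ n :: B' → A = A' ∧ B = B' := by
    intro A A' B B' n hA hA' hAB
    rcases List.append_eq_append_iff.1 hAB with ⟨c, rfl, hc⟩ | ⟨c, rfl, hc⟩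
    · rcases c with _ | ⟨s, c⟩
      · simpa using hc
      · simp at hc; have := hA' n (by simp [hc.1]); omega
    · rcases c with _ | ⟨s, c⟩
      · simpa using hc.symm
      · simp at hc; have := hA n (by simp [hc.1]); omega
  have hl := h.left_lt_max
  have hl' := h'.left_lt_max
  unfold permC2 at heq
  rw [hlen] at heq hl
  obtain ⟨h1, h2⟩ := hsplit hl hl' heq
  have hk : π₁.length = π₁'.length := by simpa using congrArg List.length h1
  have haa : a = a' := by
    by_cases h0 : π₁ = []
    · have h0' : π₁' = [] := by rw [← List.length_eq_zero_iff, ← hk, h0]; rfl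
      rw [h.eq_zero h0, h'.eq_zero h0']
    · have key : ∀ {ρ₁ ρ₂ : List ℕ} {b : ℕ}, IsPermDatum ρ₁ ρ₂ b → ρ₁ ≠ [] →
          ρ₁.length + b ∈ ρ₁.map (shift 0 ρ₁.length b) := by
        intro ρ₁ ρ₂ b hd hne
        obtain ⟨σ, hσ, -⟩ := hd.exists_last hne
        rw [← hd.mem_left, hσ]
        simp [shift]
      have h0' : π₁' ≠ [] := by
        rw [← List.length_pos_iff, ← hk, List.length_pos_iff]; exact h0
      have k1 := key h h0
      have k2 := key h' h0'
      rw [h1] at k1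
      rw [← h1] at k2
      have := h'.left_lt k1
      have := h.left_lt k2
      omega
  subst haa
  rw [hk] at h1 h2
  exact ⟨List.map_injective_iff.2 (shift_strictMono (by simp)).injective h1,
    List.map_injective_iff.2 (shift_strictMono (by simp)).injective h2, rfl⟩

/-! ### Statistics of permutations -/

theorem ascents_cons_cons (x y : ℕ) (l : List ℕ) :
    ascents (x :: y :: l) = ascents (y :: l) + if x < y then 1 else 0 := by
  simp [ascents, List.countP_cons]

theorem descents_cons_cons (x y : ℕ) (l : List ℕ) :
    descents (x :: y :: l) = descents (y :: l) + if y < x then 1 else 0 := by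
  simp [descents, List.countP_cons]

theorem ascents_mid {A B : List ℕ} {m : ℕ} (hA : ∀ x ∈ A, x < m) (hB : ∀ x ∈ B, x < m) :
    ascents (A ++ m :: B) = ascents A + ascents B + if A = [] then 0 else 1 := by
  induction A with
  | nil =>
    rcases B with _ | ⟨b, B⟩
    · simp [ascents]
    · have := hB b (by simp)
      rw [List.nil_append, ascents_cons_cons, if_neg (by omega)]
      simp [ascents]
  | cons x A ih =>
    have ih := ih fun y hy => hA y (by simp [hy])
    have hx := hA x (by simp)
    rcases A with _ | ⟨y, A⟩
    · rw [List.nil_append] at ih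
      rw [List.cons_append, List.nil_append, ascents_cons_cons, ih, if_pos hx]
      simp [ascents]
    · simp only [List.cons_append] at ih ⊢
      rw [ascents_cons_cons, ih, ascents_cons_cons]
      simp
      omega

theorem descents_mid {A B : List ℕ} {m : ℕ} (hA : ∀ x ∈ A, x < m) (hB : ∀ x ∈ B, x < m) :
    descents (A ++ m :: B) = descents A + descents B + if B = [] then 0 else 1 := by
  induction A with
  | nil =>
    rcases B with _ | ⟨b, B⟩
    · simp [descents]
    · have := hB b (by simp)
      rw [List.nil_append, descents_cons_cons, if_pos (by omega)]
      simp [descents]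
  | cons x A ih =>
    have ih := ih fun y hy => hA y (by simp [hy])
    have hx := hA x (by simp)
    rcases A with _ | ⟨y, A⟩
    · rw [List.nil_append] at ih
      rw [List.cons_append, List.nil_append, descents_cons_cons, ih,
        if_neg (show ¬ m < x by omega)]
      simp [descents]
    · simp only [List.cons_append] at ih ⊢
      rw [descents_cons_cons, ih, descents_cons_cons]
      omega

theorem ascents_map {f : ℕ → ℕ} (hf : StrictMono f) (A : List ℕ) :
    ascents (A.map f) = ascents A := by
  induction A with
  | nil => rfl
  | cons x A ih =>
    rcases A with _ | ⟨y, A⟩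
    · simp [ascents]
    · simp only [List.map_cons] at ih ⊢
      rw [ascents_cons_cons, ih, ascents_cons_cons]
      simp [hf.lt_iff_lt]

theorem descents_map {f : ℕ → ℕ} (hf : StrictMono f) (A : List ℕ) :
    descents (A.map f) = descents A := by
  induction A with
  | nil => rfl
  | cons x A ih =>
    rcases A with _ | ⟨y, A⟩
    · simp [descents]
    · simp only [List.map_cons] at ih ⊢
      rw [descents_cons_cons, ih, descents_cons_cons]
      simp [hf.lt_iff_lt]

theorem pair_sublist_map {f : ℕ → ℕ} (hf : Function.Injective f) {x y : ℕ} {σ : List ℕ} :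
    [f x, f y].Sublist (σ.map f) ↔ [x, y].Sublist σ := by
  constructor
  · intro hs
    obtain ⟨l, hl, he⟩ := List.sublist_map_iff.1 hs
    rcases l with _ | ⟨x', _ | ⟨y', l⟩⟩ <;> simp at he
    obtain ⟨h1, h2, rfl⟩ := he
    rwa [hf h1, hf h2]
  · intro h; exact h.map f

/-- The last entry of a sequence without repetitions precedes nothing. -/
theorem not_pair_sublist_last {x y : ℕ} {σ : List ℕ} (h : (σ ++ [x]).Nodup) :
    ¬ [x, y].Sublist (σ ++ [x]) := by
  intro hs
  rw [List.nodup_append] at h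
  rw [pair_sublist_append] at hs
  rcases hs with hs | ⟨hx, -⟩ | hs
  · exact h.2.2 x (mem_of_pair_sublist hs).1 x (by simp) rfl
  · exact h.2.2 x hx x (by simp) rfl
  · simpa using hs.length_le

namespace IsPermDatum

variable {π₁ π₂ : List ℕ} {a : ℕ}

theorem ascents_permC2 (h : IsPermDatum π₁ π₂ a) : ascents (permC2 π₁ π₂ a) =
    ascents π₁ + ascents π₂ + if π₁ = [] then 0 else 1 := by
  unfold permC2
  rw [ascents_mid h.left_lt_max h.right_lt_max, ascents_map (shift_strictMono (by simp)),
    ascents_map (shift_strictMono (by simp))]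
  simp

theorem descents_permC2 (h : IsPermDatum π₁ π₂ a) : descents (permC2 π₁ π₂ a) =
    descents π₁ + descents π₂ + if π₂ = [] then 0 else 1 := by
  unfold permC2
  rw [descents_mid h.left_lt_max h.right_lt_max, descents_map (shift_strictMono (by simp)),
    descents_map (shift_strictMono (by simp))]
  simp

/-- The list of possible values in a decomposition increases. -/
theorem pairwise_values (h : IsTwoStack π₂) : (0 :: lrMaxima (stackSort π₂)).Pairwise (· < ·) := by
  rw [List.pairwise_cons]
  refine ⟨fun x hx => ?_, lrMaxima_pairwise _⟩
  exact (h.range x ((mem_stackSort h.nodup).1 (mem_of_mem_lrMaxima hx))).1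

/-- All maxima of `S(π₁)` survive. One of `S(π₂)` survives when its image exceeds `k + a`, that is,
when it exceeds `a`; this discards exactly the first `i`. The final largest entry adds one. -/
theorem lrMaxima_permC2 (h : IsPermDatum π₁ π₂ a) {i : ℕ}
    (hi : (0 :: lrMaxima (stackSort π₂))[i]? = some a) :
    (lrMaxima (stackSort (permC2 π₁ π₂ a))).length + i =
      (lrMaxima (stackSort π₁)).length + (lrMaxima (stackSort π₂)).length + 1 := by
  have hf : StrictMono (shift 0 π₁.length a) := shift_strictMono (by simp)
  have hg : StrictMono (shift (π₁.length - 1) (a + 1) π₁.length) := shift_strictMono (by simp)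
  have hlt : i < (0 :: lrMaxima (stackSort π₂)).length := (List.getElem?_eq_some_iff.1 hi).1
  have key : (lrMaxima (stackSort π₂)).filter ((fun x => decide (∀ y ∈ (stackSort π₁).map
      (shift 0 π₁.length a), y < x)) ∘ shift (π₁.length - 1) (a + 1) π₁.length) =
      (lrMaxima (stackSort π₂)).drop i := by
    have := filter_lt_of_pairwise (pairwise_values h.right) hi
    rw [List.filter_cons_of_neg (by simp), List.drop_succ_cons] at this
    rw [← this]
    refine List.filter_congr fun x hx => ?_
    have hx1 := (mem_stackSort h.right.nodup).1 (mem_of_mem_lrMaxima hx)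
    have hx2 := (h.right.range x hx1).1
    simp only [Function.comp, decide_eq_decide]
    by_cases h0 : π₁ = []
    · have := h.eq_zero h0
      subst h0
      subst this
      simp [stackSort_nil]
      omega
    · constructor
      · intro h'
        obtain ⟨σ, hσ, -⟩ := h.exists_last h0
        have h2 := h' (shift 0 π₁.length a π₁.length) (by rw [hσ]; simp)
        by_contra hcon
        unfold shift at h2
        rw [if_neg (by omega), if_pos (by omega)] at h2
        omega
      · intro hax y hy
        have := h.left_lt (h.mem_left.1 hy)
        unfold shift
        rw [if_neg (by omega)]
        omega
  have hlast : (lrMaxima [π₁.length + π₂.length + 1]).filter (fun x => decide (∀ y ∈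
      (stackSort π₁).map (shift 0 π₁.length a) ++ (stackSort π₂).map
        (shift (π₁.length - 1) (a + 1) π₁.length), y < x)) = [π₁.length + π₂.length + 1] := by
    have : lrMaxima [π₁.length + π₂.length + 1] = [π₁.length + π₂.length + 1] := by
      simp [lrMaxima]
    rw [this, List.filter_cons_of_pos]
    · simp
    · rw [decide_eq_true_iff]
      intro y hy
      rw [List.mem_append, h.mem_left, h.mem_right] at hy
      rcases hy with hy | hy
      · exact h.left_lt_max y hy
      · exact h.right_lt_max y hy
  rw [h.stackSort_permC2, lrMaxima_append, lrMaxima_append, lrMaxima_map hf, lrMaxima_map hg,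
    List.filter_map, key, hlast]
  simp at hlt ⊢
  omega

/-- The only new pair is `k + a` before `k + a - 1`, present when `a ≠ 0`. No pair is lost: `k`
comes last in `S(π₁)`, and `a + 1` does not precede the left-to-right maximum `a` in `S(π₂)`. -/
theorem leftDescents_permC2 (h : IsPermDatum π₁ π₂ a) :
    leftDescents (stackSort (permC2 π₁ π₂ a)) = leftDescents (stackSort π₁) +
      leftDescents (stackSort π₂) + if a = 0 then 0 else 1 := by
  have hf : StrictMono (shift 0 π₁.length a) := shift_strictMono (by simp)
  have hg : StrictMono (shift (π₁.length - 1) (a + 1) π₁.length) := shift_strictMono (by simp)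
  have hnd := (stackSort_perm h.nodup).nodup_iff.2 h.nodup
  have hst := h.stackSort_permC2
  set k := π₁.length
  set n := π₁.length + π₂.length + 1 with hn
  set X := (stackSort π₁).map (shift 0 k a) with hX
  set Y := (stackSort π₂).map (shift (k - 1) (a + 1) k) with hY
  rw [hst] at hnd ⊢
  have hXlt : ∀ x ∈ X, 1 ≤ x ∧ (x < k ∨ x = k + a) := fun x hx => h.left_lt (h.mem_left.1 hx)
  have hYlt : ∀ x ∈ Y, k ≤ x ∧ 1 ≤ x ∧ x ≠ k + a ∧ x ≤ k + π₂.length :=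
    fun x hx => h.right_lt (h.mem_right.1 hx)
  have hkn : k + π₂.length + 1 = n := rfl
  have hal := h.le_length
  have hXY : ∀ x ∈ X, x ∉ Y := fun x hx hy => by
    have := hXlt x hx; have := hYlt x hy; omega
  have hnX : n ∉ X := fun hx => by have := hXlt n hx; omega
  have hnY : n ∉ Y := fun hx => by have := hYlt n hx; omega
  have pX : ∀ x ∈ X, ([x, x - 1].Sublist (X ++ Y ++ [n]) ↔
      [x, x - 1].Sublist X ∨ x - 1 ∈ Y) := by
    intro x hx
    have h1 := hXlt x hx
    rw [List.append_assoc, pair_sublist_append]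
    have e1 : ¬ [x, x - 1].Sublist (Y ++ [n]) := fun hs => by
      have := (mem_of_pair_sublist hs).1
      rw [List.mem_append, List.mem_singleton] at this
      rcases this with h2 | h2
      · exact hXY x hx h2
      · exact hnX (h2 ▸ hx)
    have e2 : x - 1 ≠ n := by omega
    simp [e1, e2, hx]
  have pY : ∀ y ∈ Y, ([y, y - 1].Sublist (X ++ Y ++ [n]) ↔ [y, y - 1].Sublist Y) := by
    intro y hy
    have h1 := hYlt y hy
    rw [List.append_assoc, pair_sublist_append, pair_sublist_append]
    have e1 : ¬ [y, y - 1].Sublist X := fun hs => hXY y (mem_of_pair_sublist hs).1 hy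
    have e2 : y ∉ X := fun hs => hXY y hs hy
    have e3 : y - 1 ≠ n := by omega
    have e4 : ¬ [y, y - 1].Sublist [n] := fun hs => by simpa using hs.length_le
    simp [e1, e2, e3, e4]
  have cY : Y.countP (fun x => decide ([x, x - 1].Sublist (X ++ Y ++ [n]))) =
      leftDescents (stackSort π₂) := by
    rw [List.countP_congr (q := fun x => decide ([x, x - 1].Sublist Y))
      (fun y hy => by simpa using pY y hy), hY, List.countP_map]
    refine List.countP_congr fun y hy => ?_
    simp only [Function.comp, decide_eq_true_iff]
    have hy1 := (h.right.range y ((mem_stackSort h.right.nodup).1 hy)).1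
    have hndY := (stackSort_perm h.right.nodup).nodup_iff.2 h.right.nodup
    -- The shift preserves differences of one except at the gap, where `k + a` lies on the left, and
    -- at the smallest entry, whose predecessor is not on the right.
    by_cases hya : y = a + 1
    · subst hya
      constructor
      · intro hs
        have h2 := hYlt _ (mem_of_pair_sublist hs).2
        have h3 := hYlt _ (mem_of_pair_sublist hs).1
        unfold shift at h2
        rw [if_neg (by omega)] at h2
        omega
      · intro hs
        have := h.lt_of_pair hs
        omega
    · by_cases hy0 : y = 1
      · subst hy0
        constructor
        · intro hs
          have h2 := hYlt _ (mem_of_pair_sublist hs).2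
          unfold shift at h2
          rw [if_pos (by omega)] at h2
          omega
        · intro hs
          have := (mem_stackSort h.right.nodup).1 (mem_of_pair_sublist hs).2
          have := h.right.range _ this
          omega
      · have e : shift (k - 1) (a + 1) k y - 1 = shift (k - 1) (a + 1) k (y - 1) := by
          unfold shift
          split_ifs <;> omega
        rw [e, pair_sublist_map hg.injective]
  have cn : [n].countP (fun x => decide ([x, x - 1].Sublist (X ++ Y ++ [n]))) = 0 := by
    rw [List.countP_eq_zero]
    intro x hx
    rw [List.mem_singleton] at hx
    subst hx
    rw [decide_eq_true_iff]
    exact not_pair_sublist_last hnd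
  have cX : X.countP (fun x => decide ([x, x - 1].Sublist (X ++ Y ++ [n]))) =
      leftDescents (stackSort π₁) + if a = 0 then 0 else 1 := by
    rw [List.countP_congr (q := fun x => decide ([x, x - 1].Sublist X ∨ x - 1 ∈ Y))
      (fun y hy => by simpa using pX y hy)]
    by_cases h0 : π₁ = []
    · have := h.eq_zero h0
      simp [hX, h0, this, stackSort_nil, leftDescents]
    have hkpos : 0 < k := List.length_pos_iff.2 h0
    obtain ⟨σ, hσ, hσlt⟩ : ∃ σ, stackSort π₁ = σ ++ [k] ∧ ∀ x ∈ σ, x < k := h.exists_last h0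
    have hnd1 := (stackSort_perm h.left.nodup).nodup_iff.2 h.left.nodup
    have hsmall : ∀ x ∈ σ, (([shift 0 k a x, shift 0 k a x - 1].Sublist X ∨
        shift 0 k a x - 1 ∈ Y) ↔ [x, x - 1].Sublist (stackSort π₁)) := by
      intro x hx
      have h1 := hσlt x hx
      have e1 : shift 0 k a x = x := by unfold shift; rw [if_pos h1]; rfl
      have e2 : shift 0 k a (x - 1) = x - 1 := by unfold shift; rw [if_pos (by omega)]; rfl
      have e3 : x - 1 ∉ Y := fun hy => by have := hYlt _ hy; omega
      have e4 : [shift 0 k a x, shift 0 k a (x - 1)].Sublist X ↔ _ :=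
        pair_sublist_map hf.injective
      rw [e1, e2] at e4
      rw [e1, e4]
      simp [e3]
    have hbig : ([shift 0 k a k, shift 0 k a k - 1].Sublist X ∨
        shift 0 k a k - 1 ∈ Y) ↔ a ≠ 0 := by
      have e1 : shift 0 k a k = k + a := by unfold shift; rw [if_neg (by omega)]
      have hndX := (List.nodup_append.1 (List.nodup_append.1 hnd).1).1
      have e2 : ¬ [shift 0 k a k, shift 0 k a k - 1].Sublist X := by
        rw [hX, hσ, List.map_append, List.map_singleton] at hndX ⊢
        exact not_pair_sublist_last hndX
      simp only [e2, false_or]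
      constructor
      · intro hy ha0
        have := hYlt _ hy
        omega
      · intro ha0
        rw [e1, hY, List.mem_map]
        refine ⟨a, (mem_stackSort h.right.nodup).2 (h.mem_of_ne_zero ha0), ?_⟩
        unfold shift
        rw [if_pos (by omega)]
        omega
    rw [hX, List.countP_map, ← hX]
    unfold leftDescents
    have hbig' : ¬ [k, k - 1].Sublist (stackSort π₁) := by
      rw [hσ] at hnd1 ⊢
      exact not_pair_sublist_last hnd1
    have e4 : ∀ p : ℕ → Bool, (stackSort π₁).countP p = (σ ++ [k]).countP p := fun p => by rw [hσ]
    rw [e4, e4 (fun x => decide ([x, x - 1].Sublist (stackSort π₁))), List.countP_append,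
      List.countP_append, List.countP_singleton, List.countP_singleton]
    have e5 : σ.countP ((fun x => decide ([x, x - 1].Sublist X ∨ x - 1 ∈ Y)) ∘ shift 0 k a) =
        σ.countP (fun x => decide ([x, x - 1].Sublist (stackSort π₁))) := by
      refine List.countP_congr fun x hx => ?_
      simpa using hsmall x hx
    rw [e5]
    simp only [Function.comp, hbig', decide_eq_true_iff, hbig]
    by_cases ha : a = 0 <;> simp [ha]
  conv_lhs => unfold leftDescents
  rw [List.countP_append, List.countP_append, cX, cY, cn]
  omega

end IsPermDatum

namespace GluedCells

/-! ### Free edges and turns -/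

theorem free_ur {P : GluedCells} {c : P.Cell} : P.Free (c, UR) ↔ ∀ b, ¬ P.up c b :=
  ⟨fun h b hb => h _ (.up hb), by rintro h _ ⟨hb⟩; exact h _ ‹_›⟩

theorem free_lr {P : GluedCells} {c : P.Cell} : P.Free (c, LR) ↔ ∀ b, ¬ P.low c b :=
  ⟨fun h b hb => h _ (.low hb), by rintro h _ ⟨hb⟩; exact h _ ‹_›⟩

theorem free_ll {P : GluedCells} {c : P.Cell} : P.Free (c, LL) ↔ ∀ a, ¬ P.up a c :=
  ⟨fun h b hb => h _ (.up' hb), by rintro h _ ⟨hb⟩; exact h _ ‹_›⟩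

theorem free_ul {P : GluedCells} {c : P.Cell} : P.Free (c, UL) ↔ ∀ a, ¬ P.low a c :=
  ⟨fun h b hb => h _ (.low' hb), by rintro h _ ⟨hb⟩; exact h _ ‹_›⟩

/-- The map on edges induced by a map on cells. -/
abbrev edgeMap {α β : Type} (f : α → β) : α × Side → β × Side := Prod.map f id

/-- The map `f` preserves gluings. -/
structure IsHom (P Q : GluedCells) (f : P.Cell → Q.Cell) : Prop where
  up : ∀ {a b}, P.up a b → Q.up (f a) (f b)
  low : ∀ {a b}, P.low a b → Q.low (f a) (f b)

theorem IsHom.glued {P Q : GluedCells} {f : P.Cell → Q.Cell} (hf : IsHom P Q f) {e g : P.Edge}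
    (h : P.Glued e g) : Q.Glued (edgeMap f e) (edgeMap f g) := by
  cases h with
  | up h => exact .up (hf.up h)
  | up' h => exact .up' (hf.up h)
  | low h => exact .low (hf.low h)
  | low' h => exact .low' (hf.low h)

/-- An edge that is free in `P` may be glued in `Q`, so a turn of `P` is only the beginning of a
turn of `Q`, which continues from `g`. -/
theorem IsHom.turn {P Q : GluedCells} {f : P.Cell → Q.Cell} (hf : IsHom P Q f) {e g : P.Edge}
    (h : P.Turn e g) {x : Q.Edge} (hx : Q.Turn (edgeMap f g) x) : Q.Turn (edgeMap f e) x := by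
  induction h with
  | here _ => exact hx
  | cross h _ ih => exact .cross (hf.glued h) (ih hx)

/-- The local properties shared by all systems of cells that can be grown. -/
structure Coherent (P : GluedCells) : Prop where
  up_right : ∀ {a b b'}, P.up a b → P.up a b' → b = b'
  up_left : ∀ {a a' b}, P.up a b → P.up a' b → a = a'
  low_right : ∀ {a b b'}, P.low a b → P.low a b' → b = b'
  low_left : ∀ {a a' b}, P.low a b → P.low a' b → a = a'
  square : ∀ {b c d}, P.low b d → P.up c d → ∃ a, P.up a b ∧ P.low a c

theorem Coherent.glued {P : GluedCells} (hP : P.Coherent) {e f g : P.Edge} (h : P.Glued e f)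
    (h' : P.Glued e g) : f = g := by
  cases h with
  | up h => cases h' with | up h' => rw [hP.up_right h h']
  | up' h => cases h' with | up' h' => rw [hP.up_left h h']
  | low h => cases h' with | low h' => rw [hP.low_right h h']
  | low' h => cases h' with | low' h' => rw [hP.low_left h h']

theorem Coherent.turn {P : GluedCells} (hP : P.Coherent) {e f g : P.Edge} (h : P.Turn e f)
    (h' : P.Turn e g) : f = g := by
  induction h with
  | here h =>
    cases h' with
    | here _ => rfl
    | cross h' _ => exact absurd h' (h _)
  | cross h _ ih =>
    cases h' with
    | here h' => exact absurd h (h' _)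
    | cross h' ht => rw [hP.glued h h'] at ih; exact ih ht

/-! ### The boundary -/

/-- `l` lists the free edges counter-clockwise, from the nose on. -/
structure IsBoundary (P : GluedCells) (l : List P.Edge) : Prop where
  head : l.head? = some (P.head, LL)
  last : l.getLast? = some (P.head, UL)
  nodup : l.Nodup
  mem : ∀ e, e ∈ l ↔ P.Free e
  chain : l.IsChain P.BoundaryNext

/-- Two chains of a deterministic relation with a common start differ only in length. Applied to the
boundary and to the fin, it gives their uniqueness. -/
theorem isChain_prefix {α : Type*} {R : α → α → Prop} (hR : ∀ a b c, R a b → R a c → b = c) :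
    ∀ {l l' : List α}, l.IsChain R → l'.IsChain R → l.head? = l'.head? → l <+: l' ∨ l' <+: l
  | [], l', _, _, _ => Or.inl (List.nil_prefix)
  | l, [], _, _, _ => Or.inr (List.nil_prefix)
  | [a], b :: l', _, _, h => by simp at h; subst h; left; simp
  | a :: b :: l, [a'], _, _, h => by simp at h; subst h; right; simp
  | a :: b :: l, a' :: b' :: l', h1, h2, h => by
    simp at h
    subst h
    rw [List.isChain_cons_cons] at h1 h2
    obtain rfl := hR _ _ _ h1.1 h2.1
    simpa using isChain_prefix hR h1.2 h2.2 rfl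

theorem IsBoundary.unique {P : GluedCells} (hP : P.Coherent) {l l' : List P.Edge}
    (h : P.IsBoundary l) (h' : P.IsBoundary l') : l = l' := by
  have hlen : l.length = l'.length :=
    ((List.perm_ext_iff_of_nodup h.nodup h'.nodup).2 fun e => by rw [h.mem, h'.mem]).length_eq
  rcases isChain_prefix (R := P.BoundaryNext) (fun _ _ _ h h' => hP.turn h h') h.chain h'.chain
    (by rw [h.head, h'.head]) with hp | hp
  · exact hp.eq_of_length hlen
  · exact (hp.eq_of_length hlen.symm).symm

theorem isChain_edgeMap {P Q : GluedCells} {f : P.Cell → Q.Cell} (hf : IsHom P Q f) :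
    ∀ {l : List P.Edge}, l.IsChain P.BoundaryNext → (∀ e ∈ l, Q.Free (edgeMap f e)) →
      (l.map (edgeMap f)).IsChain Q.BoundaryNext
  | [], _, _ => by simp
  | [a], _, _ => by simp
  | a :: b :: l, h, hl => by
    rw [List.isChain_cons_cons] at h
    simp only [List.map_cons, List.isChain_cons_cons]
    refine ⟨hf.turn h.1 (.here (hl b (by simp))), ?_⟩
    simpa using isChain_edgeMap hf h.2 fun e he => hl e (by simp [he])

/-- Replacing a part of the boundary. -/
theorem IsBoundary.subst {P Q : GluedCells} {f : P.Cell → Q.Cell} (hf : IsHom P Q f)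
    (hinj : Function.Injective f) (hhead : Q.head = f P.head) {l₁ m l₂ : List P.Edge}
    {m' : List Q.Edge} (h : P.IsBoundary (l₁ ++ (m ++ l₂))) (hm : m ≠ []) (hm' : m' ≠ [])
    (hm₁ : ∀ e ∈ m.head?, e.2 ≠ LL) (hm₂ : ∀ e ∈ m.getLast?, e.2 ≠ UL)
    (hc : m'.IsChain Q.BoundaryNext) (hnd : m'.Nodup)
    (hin : ∀ e ∈ m.head?, ∀ e' ∈ m'.head?, Q.Turn (edgeMap f e) e')
    (hout : ∀ e ∈ m.getLast?, ∀ e' ∈ m'.getLast?, ∀ g, Q.Turn (f e.1, e.2.next) g →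
      Q.Turn (e'.1, e'.2.next) g)
    (hfree : ∀ e, Q.Free (edgeMap f e) ↔ P.Free e ∧ e ∉ m)
    (hdis : ∀ e ∈ m', ∀ x, edgeMap f x ≠ e)
    (hnew : ∀ e, (∀ x, edgeMap f x ≠ e) → (Q.Free e ↔ e ∈ m')) :
    l₁ ≠ [] ∧ l₂ ≠ [] ∧
      Q.IsBoundary (l₁.map (edgeMap f) ++ (m' ++ l₂.map (edgeMap f))) := by
  -- The boundary starts with the `LL` and ends with the `UL` of the head; the replaced part touches
  -- neither end by `hm₁` and `hm₂`.
  have hl₁ : l₁ ≠ [] := by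
    rintro rfl
    have := h.head
    cases m with
    | nil => simp at hm
    | cons e m => simp at this hm₁; rw [this] at hm₁; simp at hm₁
  have hl₂ : l₂ ≠ [] := by
    rintro rfl
    have := h.last
    obtain ⟨m, e, rfl⟩ := List.eq_nil_or_concat' m |>.resolve_left hm
    rw [List.append_nil, ← List.append_assoc] at this
    simp at this hm₂
    rw [this] at hm₂; simp at hm₂
  have hnodup := h.nodup
  rw [List.nodup_append, List.nodup_append] at hnodup
  obtain ⟨n1, ⟨n2, n3, n4⟩, n5⟩ := hnodup
  have hmem := h.mem
  have f1 : ∀ e ∈ l₁, Q.Free (edgeMap f e) := fun e he => (hfree e).2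
    ⟨(hmem e).1 (by simp [he]), fun hem => n5 e he e (by simp [hem]) rfl⟩
  have f2 : ∀ e ∈ l₂, Q.Free (edgeMap f e) := fun e he => (hfree e).2
    ⟨(hmem e).1 (by simp [he]), fun hem => n4 e hem e he rfl⟩
  have hinj' : Function.Injective (edgeMap f) := hinj.prodMap Function.injective_id
  have hchain := h.chain
  rw [List.isChain_append, List.isChain_append] at hchain
  obtain ⟨c1, ⟨c2, c3, c4⟩, c5⟩ := hchain
  refine ⟨hl₁, hl₂, ?_, ?_, ?_, ?_, ?_⟩
  · have := h.head
    cases l₁ with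
    | nil => simp at hl₁
    | cons e l₁ => simp at this ⊢; rw [this, hhead]; rfl
  · have := h.last
    obtain ⟨l₂, e, rfl⟩ := List.eq_nil_or_concat' l₂ |>.resolve_left hl₂
    rw [← List.append_assoc, ← List.append_assoc] at this
    rw [List.map_append, ← List.append_assoc, ← List.append_assoc]
    simp at this ⊢
    rw [this, hhead]; rfl
  · rw [List.nodup_append, List.nodup_append]
    refine ⟨n1.map hinj', ⟨hnd, n3.map hinj', ?_⟩, ?_⟩
    · intro a ha b hb
      obtain ⟨x, -, rfl⟩ := List.mem_map.1 hb
      exact (hdis a ha x).symm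
    · intro a ha b hb
      obtain ⟨x, hx, rfl⟩ := List.mem_map.1 ha
      rcases List.mem_append.1 hb with hb | hb
      · exact hdis b hb x
      · obtain ⟨y, hy, rfl⟩ := List.mem_map.1 hb
        exact fun hxy => n5 x hx y (by simp [hy]) (hinj' hxy)
  · intro e
    by_cases he : ∃ x, edgeMap f x = e
    · obtain ⟨x, rfl⟩ := he
      rw [hfree, List.mem_append, List.mem_append, List.mem_map_of_injective hinj',
        List.mem_map_of_injective hinj', ← hmem]
      have : edgeMap f x ∉ m' := fun hx => hdis _ hx x rfl
      simp only [this, false_or, List.mem_append]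
      constructor
      · rintro (hx | hx)
        · exact ⟨Or.inl hx, fun hxm => n5 x hx x (by simp [hxm]) rfl⟩
        · exact ⟨Or.inr (Or.inr hx), fun hxm => n4 x hxm x hx rfl⟩
      · rintro ⟨hx, hxm⟩
        tauto
    · have he' : ∀ x, edgeMap f x ≠ e := fun x hx => he ⟨x, hx⟩
      rw [hnew e he', List.mem_append, List.mem_append]
      have k : ∀ l : List P.Edge, e ∉ l.map (edgeMap f) := fun l hl => by
        obtain ⟨x, -, hx⟩ := List.mem_map.1 hl
        exact he' x hx
      simp only [k, false_or, or_false]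
  · rw [List.isChain_append, List.isChain_append]
    refine ⟨isChain_edgeMap hf c1 f1, ⟨hc, isChain_edgeMap hf c3 f2, ?_⟩, ?_⟩
    · intro e' he' g hg
      rw [List.head?_map, Option.mem_def, Option.map_eq_some_iff] at hg
      obtain ⟨g, hg, rfl⟩ := hg
      obtain ⟨m, e, rfl⟩ := List.eq_nil_or_concat' m |>.resolve_left hm
      refine hout e (by simp) e' he' _ ?_
      exact hf.turn (c4 e (by simp) g hg) (.here (f2 g (List.mem_of_mem_head? hg)))
    · intro e he g hg
      rw [List.getLast?_map, Option.mem_def, Option.map_eq_some_iff] at he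
      obtain ⟨e, he, rfl⟩ := he
      cases m with
      | nil => simp at hm
      | cons x m =>
        cases m' with
        | nil => simp at hm'
        | cons x' m' =>
          simp at hg
          subst hg
          exact hf.turn (c5 e he x (by simp)) (hin x (by simp) _ (by simp))

/-! ### Growth -/

/-- A cell can be added to the upper right edges of the cells in `U` and the lower right edges of
the cells in `L`. -/
structure Step (P : GluedCells) (U L : P.Cell → Prop) : Prop where
  free_up : ∀ {x}, U x → P.Free (x, UR)
  free_low : ∀ {x}, L x → P.Free (x, LR)
  unique_up : ∀ {x y}, U x → U y → x = y
  unique_low : ∀ {x y}, L x → L y → x = y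
  square : ∀ {c b}, U c → L b → ∃ a, P.up a b ∧ P.low a c
  nonempty : ∃ x, U x ∨ L x

theorem IsFish.attach {P : GluedCells} {U L : P.Cell → Prop} (hP : P.IsFish) (h : P.Step U L) :
    (P.attach U L).IsFish := by
  have key : ∀ {V : P.Cell → Prop} {x}, (∀ x y, V x → V y → x = y) → V x →
      V = fun y => y = x := by
    intro V x hV hx
    funext y
    exact propext ⟨fun hy => hV _ _ hy hx, fun hy => hy ▸ hx⟩
  have key' : ∀ {V : P.Cell → Prop}, (¬ ∃ x, V x) → V = fun _ => False := by
    intro V hV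
    funext y
    exact eq_false fun hy => hV ⟨y, hy⟩
  by_cases hU : ∃ c, U c
  · obtain ⟨c, hc⟩ := hU
    by_cases hL : ∃ b, L b
    · obtain ⟨b, hb⟩ := hL
      obtain ⟨a, hab, hac⟩ := h.square hc hb
      rw [key (V := U) (fun _ _ => h.unique_up) hc, key (V := L) (fun _ _ => h.unique_low) hb]
      exact .double a b c hP hab hac (h.free_low hb) (h.free_up hc)
    · rw [key (V := U) (fun _ _ => h.unique_up) hc, key' hL]
      exact .upper c hP (h.free_up hc)
  · by_cases hL : ∃ b, L b
    · obtain ⟨b, hb⟩ := hL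
      rw [key' hU, key (V := L) (fun _ _ => h.unique_low) hb]
      exact .lower b hP (h.free_low hb)
    · obtain ⟨x, hx | hx⟩ := h.nonempty
      · exact absurd ⟨x, hx⟩ hU
      · exact absurd ⟨x, hx⟩ hL

@[elab_as_elim]
-- Merges the three ways to add a cell into one inductive step, where `U` and `L` hold for at most
-- one cell each and not both are empty.
theorem IsFish.growth {C : (P : GluedCells) → P.IsFish → Prop} (single : C single .head)
    (attach : ∀ (P : GluedCells) (U L : P.Cell → Prop) (hP : P.IsFish) (h : P.Step U L), C P hP →
      C (P.attach U L) (hP.attach h))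
    (rename : ∀ (P Q : GluedCells) (hP : P.IsFish) (e : Iso P Q), C P hP → C Q (hP.rename e))
    {P : GluedCells} (hP : P.IsFish) : C P hP := by
  induction hP with
  | head => exact single
  | upper c hP hc ih =>
    exact attach _ _ _ hP ⟨by rintro _ rfl; exact hc, by simp, by simp, by simp, by simp,
      ⟨c, by simp⟩⟩ ih
  | lower c hP hc ih =>
    exact attach _ _ _ hP ⟨by simp, by rintro _ rfl; exact hc, by simp, by simp, by simp,
      ⟨c, by simp⟩⟩ ih
  | double a b c hP hab hac hb hc ih =>
    exact attach _ _ _ hP ⟨by rintro _ rfl; exact hc, by rintro _ rfl; exact hb, by simp, by simp,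
      by rintro _ _ rfl rfl; exact ⟨a, hab, hac⟩, ⟨c, by simp⟩⟩ ih
  | rename hP e ih => exact rename _ _ hP e ih

theorem isHom_attach (P : GluedCells) (U L : P.Cell → Prop) : IsHom P (P.attach U L) some :=
  ⟨id, id⟩

theorem Coherent.attach {P : GluedCells} (hP : P.Coherent) {U L : P.Cell → Prop}
    (h : P.Step U L) : (P.attach U L).Coherent := by
  refine ⟨?_, ?_, ?_, ?_, ?_⟩
  · rintro (_ | a) (_ | b) (_ | b') h1 h2
    all_goals first | exact h1.elim | rfl | skip
    · exact absurd h2 (free_ur.1 (h.free_up h1) b')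
    · exact absurd h1 (free_ur.1 (h.free_up h2) b)
    · exact congrArg some (hP.up_right h1 h2)
  · rintro (_ | a) (_ | a') (_ | b) h1 h2
    all_goals first | exact h1.elim | exact h2.elim | skip
    · exact congrArg some (h.unique_up h1 h2)
    · exact congrArg some (hP.up_left h1 h2)
  · rintro (_ | a) (_ | b) (_ | b') h1 h2
    all_goals first | exact h1.elim | rfl | skip
    · exact absurd h2 (free_lr.1 (h.free_low h1) b')
    · exact absurd h1 (free_lr.1 (h.free_low h2) b)
    · exact congrArg some (hP.low_right h1 h2)
  · rintro (_ | a) (_ | a') (_ | b) h1 h2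
    all_goals first | exact h1.elim | exact h2.elim | skip
    · exact congrArg some (h.unique_low h1 h2)
    · exact congrArg some (hP.low_left h1 h2)
  · rintro (_ | b) (_ | c) (_ | d) h1 h2
    all_goals first | exact h1.elim | exact h2.elim | skip
    · obtain ⟨a, h3, h4⟩ := h.square h2 h1
      exact ⟨some a, h3, h4⟩
    · obtain ⟨a, h3, h4⟩ := hP.square h1 h2
      exact ⟨some a, h3, h4⟩

/-- An isomorphism. -/
structure IsIso (P Q : GluedCells) (e : P.Cell ≃ Q.Cell) : Prop where
  head : e P.head = Q.head
  up : ∀ a b, P.up a b ↔ Q.up (e a) (e b)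
  low : ∀ a b, P.low a b ↔ Q.low (e a) (e b)

theorem iso_iff {P Q : GluedCells} : Iso P Q ↔ ∃ e, IsIso P Q e :=
  ⟨fun ⟨e, h1, h2, h3⟩ => ⟨e, h1, h2, h3⟩, fun ⟨e, h1, h2, h3⟩ => ⟨e, h1, h2, h3⟩⟩

theorem IsIso.isHom {P Q : GluedCells} {e : P.Cell ≃ Q.Cell} (h : IsIso P Q e) : IsHom P Q e :=
  ⟨fun h' => (h.up _ _).1 h', fun h' => (h.low _ _).1 h'⟩

theorem IsIso.symm {P Q : GluedCells} {e : P.Cell ≃ Q.Cell} (h : IsIso P Q e) :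
    IsIso Q P e.symm :=
  ⟨by rw [← h.head]; simp, fun a b => by rw [h.up]; simp, fun a b => by rw [h.low]; simp⟩

theorem IsIso.trans {P Q R : GluedCells} {e : P.Cell ≃ Q.Cell} {f : Q.Cell ≃ R.Cell}
    (h : IsIso P Q e) (h' : IsIso Q R f) : IsIso P R (e.trans f) :=
  ⟨by simp [h.head, h'.head], fun a b => by rw [h.up, h'.up]; rfl,
    fun a b => by rw [h.low, h'.low]; rfl⟩

theorem IsIso.free {P Q : GluedCells} {e : P.Cell ≃ Q.Cell} (h : IsIso P Q e) {x : P.Edge} :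
    Q.Free (edgeMap e x) ↔ P.Free x := by
  constructor
  · intro h' f hf
    exact h' _ (h.isHom.glued hf)
  · intro h' f hf
    have := h.symm.isHom.glued hf
    have hx : edgeMap e.symm (edgeMap e x) = x := Prod.ext (e.symm_apply_apply _) rfl
    rw [hx] at this
    exact h' _ this

theorem IsIso.coherent {P Q : GluedCells} {e : P.Cell ≃ Q.Cell} (h : IsIso P Q e)
    (hP : P.Coherent) : Q.Coherent := by
  have hs := h.symm
  refine ⟨?_, ?_, ?_, ?_, ?_⟩
  · intro a b b' h1 h2
    exact e.symm.injective (hP.up_right ((hs.up _ _).1 h1) ((hs.up _ _).1 h2))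
  · intro a b b' h1 h2
    exact e.symm.injective (hP.up_left ((hs.up _ _).1 h1) ((hs.up _ _).1 h2))
  · intro a b b' h1 h2
    exact e.symm.injective (hP.low_right ((hs.low _ _).1 h1) ((hs.low _ _).1 h2))
  · intro a b b' h1 h2
    exact e.symm.injective (hP.low_left ((hs.low _ _).1 h1) ((hs.low _ _).1 h2))
  · intro b c d h1 h2
    obtain ⟨a, h3, h4⟩ := hP.square ((hs.low _ _).1 h1) ((hs.up _ _).1 h2)
    exact ⟨e a, by simpa using (h.up _ _).1 h3, by simpa using (h.low _ _).1 h4⟩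

theorem IsIso.isBoundary {P Q : GluedCells} {e : P.Cell ≃ Q.Cell} (h : IsIso P Q e)
    {l : List P.Edge} (hl : P.IsBoundary l) : Q.IsBoundary (l.map (edgeMap e)) := by
  have hinj : Function.Injective (edgeMap e) := e.injective.prodMap Function.injective_id
  refine ⟨?_, ?_, hl.nodup.map hinj, ?_, ?_⟩
  · rw [List.head?_map, hl.head, ← h.head]; rfl
  · rw [List.getLast?_map, hl.last, ← h.head]; rfl
  · intro x
    have hx : edgeMap e (edgeMap e.symm x) = x := Prod.ext (e.apply_symm_apply _) rfl
    rw [← hx, List.mem_map_of_injective hinj, hl.mem, h.free]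
  · exact isChain_edgeMap h.isHom hl.chain fun x hx => h.free.2 ((hl.mem x).1 hx)

theorem IsFish.coherent {P : GluedCells} (hP : P.IsFish) : P.Coherent := by
  induction hP using IsFish.growth with
  | single => exact ⟨fun h => h.elim, fun h => h.elim, fun h => h.elim, fun h => h.elim,
      fun h => h.elim⟩
  | attach P U L hP h ih => exact ih.attach h
  | rename P Q hP e ih =>
    obtain ⟨e, he⟩ := iso_iff.1 e
    exact he.coherent ih

end GluedCells

/-! ### Effect of growth on the boundary word -/

/-- The three ways to add a cell. -/
inductive GrowthKind
  | upper | lower | double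

namespace GrowthKind

/-- The edges that are covered by the new cell. -/
def core : GrowthKind → List Side
  | upper => [UR]
  | lower => [LR]
  | double => [UR, LR]

/-- The new free edges before the right edges of the new cell. -/
def pre : GrowthKind → List Side
  | upper => []
  | lower => [LL]
  | double => []

/-- The new free edges after the right edges of the new cell. -/
def post : GrowthKind → List Side
  | upper => [UL]
  | lower => []
  | double => []

/-- The free edges of the new cell. -/
def new (k : GrowthKind) : List Side := k.pre ++ (LR :: UR :: k.post)

theorem isFishWord {k : GrowthKind} {u v : List Side} (h : IsFishWord (u ++ (k.core ++ v))) :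
    IsFishWord (u ++ (k.new ++ v)) := by
  cases k with
  | upper => exact h.upper
  | lower => exact h.lower
  | double => exact h.double

/-- The context of the right edges of the new cell tells how it was added. -/
theorem eq_of_context {k k' : GrowthKind} {u v u' v' : List Side}
    (h : IsFishWord (u ++ (k.core ++ v))) (h' : IsFishWord (u' ++ (k'.core ++ v')))
    (hu : u ≠ []) (hu' : u' ≠ []) (h₁ : u ++ k.pre = u' ++ k'.pre)
    (h₂ : k.post ++ v = k'.post ++ v') : k = k' ∧ u = u' ∧ v = v' := by
  -- Neither `LR UL` nor `LL UR` can be a proper factor, being balanced. Assuming two different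
  -- kinds in the same context would produce one of them.
  have n13 : ∀ {a b}, a ≠ [] → ¬ IsFishWord (a ++ LR :: UL :: b) := fun {a b} ha hw =>
    ha (hw.conn a [LR, UL] b (by simp) (by simp) (by simp [IsBalanced])).1
  have n02 : ∀ {a b}, a ≠ [] → ¬ IsFishWord (a ++ LL :: UR :: b) := fun {a b} ha hw =>
    ha (hw.conn a [LL, UR] b (by simp) (by simp) (by simp [IsBalanced])).1
  have n02' : ∀ {a b}, b ≠ [] → ¬ IsFishWord (a ++ LL :: UR :: b) := fun {a b} ha hw =>
    ha (hw.conn a [LL, UR] b (by simp) (by simp) (by simp [IsBalanced])).2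
  cases k <;> cases k' <;> simp [pre, post, core] at h h' h₁ h₂
  · exact ⟨rfl, h₁, h₂⟩
  · subst h₂
    exact absurd h' (n13 hu')
  · subst h₂
    rw [show u' ++ UR :: LR :: UL :: v = (u' ++ [UR]) ++ LR :: UL :: v by simp] at h'
    exact absurd h' (n13 (by simp))
  · subst h₂
    exact absurd h (n13 hu)
  · exact ⟨rfl, h₁, h₂⟩
  · subst h₁
    rw [show u ++ [LL] ++ UR :: LR :: v' = u ++ LL :: UR :: LR :: v' by simp] at h'
    exact absurd h' (n02 hu)
  · subst h₂
    rw [show u ++ UR :: LR :: UL :: v' = (u ++ [UR]) ++ LR :: UL :: v' by simp] at h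
    exact absurd h (n13 (by simp))
  · subst h₁
    rw [show u' ++ [LL] ++ UR :: LR :: v = u' ++ LL :: UR :: LR :: v by simp] at h
    exact absurd h (n02 hu')
  · exact ⟨rfl, h₁, h₂⟩

end GrowthKind

namespace GluedCells

theorem free_attach {P : GluedCells} {U L : P.Cell → Prop} {x : P.Cell} {s : Side} :
    (P.attach U L).Free (some x, s) ↔
      P.Free (x, s) ∧ (s = UR → ¬ U x) ∧ (s = LR → ¬ L x) := by
  cases s
  · rw [free_ll, free_ll]
    simp only [reduceCtorEq, false_implies, and_true]
    exact ⟨fun h a => h (some a), fun h a => by rcases a with _ | a; exacts [id, h a]⟩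
  · rw [free_lr, free_lr]
    simp only [reduceCtorEq, false_implies, true_and, true_implies]
    exact ⟨fun h => ⟨fun a => h (some a), h none⟩,
      fun h a => by rcases a with _ | a; exacts [h.2, h.1 a]⟩
  · rw [free_ur, free_ur]
    simp only [reduceCtorEq, false_implies, and_true, true_implies]
    exact ⟨fun h => ⟨fun a => h (some a), h none⟩,
      fun h a => by rcases a with _ | a; exacts [h.2, h.1 a]⟩
  · rw [free_ul, free_ul]
    simp only [reduceCtorEq, false_implies, and_true]
    exact ⟨fun h a => h (some a), fun h a => by rcases a with _ | a; exacts [id, h a]⟩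

theorem free_attach_ur {P : GluedCells} {U L : P.Cell → Prop} :
    (P.attach U L).Free (none, UR) := free_ur.2 fun _ h => h

theorem free_attach_lr {P : GluedCells} {U L : P.Cell → Prop} :
    (P.attach U L).Free (none, LR) := free_lr.2 fun _ h => h

theorem free_attach_ll {P : GluedCells} {U L : P.Cell → Prop} :
    (P.attach U L).Free (none, LL) ↔ ∀ x, ¬ U x := by
  rw [free_ll]
  exact ⟨fun h a => h (some a), fun h a => by rcases a with _ | a; exacts [id, h a]⟩

theorem free_attach_ul {P : GluedCells} {U L : P.Cell → Prop} :
    (P.attach U L).Free (none, UL) ↔ ∀ x, ¬ L x := by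
  rw [free_ul]
  exact ⟨fun h a => h (some a), fun h a => by rcases a with _ | a; exacts [id, h a]⟩

theorem free_attach_none {P : GluedCells} {U L : P.Cell → Prop} {s : Side} :
    (P.attach U L).Free (none, s) ↔ (s = LL → ∀ x, ¬ U x) ∧ (s = UL → ∀ x, ¬ L x) := by
  cases s
  · simpa using free_attach_ll
  · simpa using free_attach_lr
  · simpa using free_attach_ur
  · simpa using free_attach_ul

theorem Glued.symm {P : GluedCells} {e f : P.Edge} (h : P.Glued e f) : P.Glued f e := by
  cases h with
  | up h => exact .up' h
  | up' h => exact .up h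
  | low h => exact .low' h
  | low' h => exact .low h

theorem glued_attach_up {P : GluedCells} {U L : P.Cell → Prop} {c : P.Cell} (hc : U c) :
    (P.attach U L).Glued (some c, UR) (none, LL) :=
  .up (P := P.attach U L) (a := some c) (b := none) hc

theorem glued_attach_low {P : GluedCells} {U L : P.Cell → Prop} {c : P.Cell} (hc : L c) :
    (P.attach U L).Glued (some c, LR) (none, UL) :=
  .low (P := P.attach U L) (a := some c) (b := none) hc

/-- The upper right edge of `c` is followed by the lower right edge of `b` if `b` and `c` are
attached to the right edges of a same cell. -/
theorem boundaryNext_of_square {P : GluedCells} {a b c : P.Cell} (hab : P.up a b)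
    (hac : P.low a c) (hb : P.Free (b, LR)) : P.BoundaryNext (c, UR) (b, LR) :=
  .cross (.low' hac) (.cross (.up hab) (.here hb))

theorem exists_edgeMap_some {α : Type} {s : Option α × Side}
    (h : ∀ x, edgeMap (some : α → Option α) x ≠ s) : s.1 = none := by
  rcases s with ⟨_ | a, s⟩
  · rfl
  · exact absurd rfl (h (a, s))

/-- How the boundary changes when a cell is added. -/
theorem IsBoundary.attach {P : GluedCells} (hP : P.Coherent) {l : List P.Edge}
    (hl : P.IsBoundary l) {U L : P.Cell → Prop} (h : P.Step U L) :
    ∃ (k : GrowthKind) (l₁ m l₂ : List P.Edge), l = l₁ ++ (m ++ l₂) ∧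
      m.map Prod.snd = k.core ∧ (∀ x, U x ↔ (x, UR) ∈ m) ∧ (∀ x, L x ↔ (x, LR) ∈ m) ∧
      l₁ ≠ [] ∧ l₂ ≠ [] ∧ (P.attach U L).IsBoundary (l₁.map (edgeMap some) ++
        (k.new.map (fun s => (none, s)) ++ l₂.map (edgeMap some))) := by
  have hdis : ∀ (l : List Side), ∀ e ∈ l.map (fun s => ((none : Option P.Cell), s)),
      ∀ x : P.Edge, edgeMap some x ≠ e := by
    intro l e he x
    obtain ⟨s, -, rfl⟩ := List.mem_map.1 he
    intro hx
    exact Option.some_ne_none _ (congrArg Prod.fst hx)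
  have hom := isHom_attach P U L
  have hinj : Function.Injective (some : P.Cell → Option P.Cell) := Option.some_injective _
  by_cases hU : ∃ c, U c
  · obtain ⟨c, hc⟩ := hU
    have hUc : ∀ x, U x ↔ x = c := fun x => ⟨fun hx => h.unique_up hx hc, fun hx => hx ▸ hc⟩
    obtain ⟨l₁, l', rfl⟩ := List.append_of_mem ((hl.mem (c, UR)).2 (h.free_up hc))
    by_cases hL : ∃ b, L b
    · obtain ⟨b, hb⟩ := hL
      have hLb : ∀ x, L x ↔ x = b := fun x => ⟨fun hx => h.unique_low hx hb, fun hx => hx ▸ hb⟩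
      obtain ⟨a, hab, hac⟩ := h.square hc hb
      obtain ⟨e, l₂, rfl⟩ : ∃ e l₂, l' = e :: l₂ := by
        cases l' with
        | nil => have := hl.last; simp at this
        | cons e l₂ => exact ⟨e, l₂, rfl⟩
      have hnext : P.BoundaryNext (c, UR) e := by
        have := hl.chain
        rw [List.isChain_append, List.isChain_cons_cons] at this
        exact this.2.1.1
      -- Turning at the end of the upper right edge of `c` leads through the common neighbour `a` to
      -- the lower right edge of `b`, so the two covered edges are consecutive.
      obtain rfl := hP.turn hnext (boundaryNext_of_square hab hac (h.free_low hb))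
      refine ⟨.double, l₁, [(c, UR), (b, LR)], l₂, by simp, rfl, ?_, ?_, ?_⟩
      · intro x; rw [hUc]; simp
      · intro x; rw [hLb]; simp
      refine IsBoundary.subst hom hinj rfl (m := [(c, UR), (b, LR)]) (by simpa using hl) (by simp)
        (by simp [GrowthKind.new]) (by simp) (by simp) ?_ ?_ ?_ ?_ ?_ (hdis _) ?_
      · simp [GrowthKind.new, GrowthKind.pre, GrowthKind.post]
        exact .here free_attach_ur
      · simp [GrowthKind.new, GrowthKind.pre, GrowthKind.post]
      · simp [GrowthKind.new, GrowthKind.pre, GrowthKind.post]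
        exact .cross (f := ((none : Option P.Cell), LL)) (glued_attach_up hc) (.here free_attach_lr)
      · simp [GrowthKind.new, GrowthKind.pre, GrowthKind.post]
        intro g s hg
        exact .cross (f := (some b, LR)) (glued_attach_low hb).symm hg
      · rintro ⟨x, s⟩
        refine free_attach.trans ?_
        simp only [hUc, hLb, List.mem_cons, Prod.mk.injEq, List.not_mem_nil, or_false]
        cases s <;> simp
      · intro e he
        obtain ⟨e, s⟩ := e
        obtain rfl : e = none := exists_edgeMap_some he
        refine free_attach_none.trans ?_
        simp only [hUc, hLb, GrowthKind.new, GrowthKind.pre, GrowthKind.post]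
        cases s <;> simp
    · have hL' : ∀ x, ¬ L x := fun x hx => hL ⟨x, hx⟩
      refine ⟨.upper, l₁, [(c, UR)], l', by simp, rfl, ?_, ?_, ?_⟩
      · intro x; rw [hUc]; simp
      · intro x; simp [hL']
      refine IsBoundary.subst hom hinj rfl (m := [(c, UR)]) (by simpa using hl) (by simp)
        (by simp [GrowthKind.new]) (by simp) (by simp) ?_ ?_ ?_ ?_ ?_ (hdis _) ?_
      · simp [GrowthKind.new, GrowthKind.pre, GrowthKind.post]
        exact ⟨.here free_attach_ur, .here (free_attach_ul.2 hL')⟩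
      · simp [GrowthKind.new, GrowthKind.pre, GrowthKind.post]
      · simp [GrowthKind.new, GrowthKind.pre, GrowthKind.post]
        exact .cross (f := ((none : Option P.Cell), LL)) (glued_attach_up hc) (.here free_attach_lr)
      · simp [GrowthKind.new, GrowthKind.pre, GrowthKind.post]
        intro g s hg
        exact .cross (f := (some c, UR)) (glued_attach_up hc).symm hg
      · rintro ⟨x, s⟩
        refine free_attach.trans ?_
        simp only [hUc, hL', List.mem_cons, Prod.mk.injEq, List.not_mem_nil, or_false]
        cases s <;> simp
      · intro e he
        obtain ⟨e, s⟩ := e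
        obtain rfl : e = none := exists_edgeMap_some he
        refine free_attach_none.trans ?_
        simp only [hUc, hL', GrowthKind.new, GrowthKind.pre, GrowthKind.post]
        cases s <;> simp
  · have hU' : ∀ x, ¬ U x := fun x hx => hU ⟨x, hx⟩
    obtain ⟨b, hb⟩ : ∃ b, L b := by
      obtain ⟨x, hx | hx⟩ := h.nonempty
      · exact absurd hx (hU' x)
      · exact ⟨x, hx⟩
    have hLb : ∀ x, L x ↔ x = b := fun x => ⟨fun hx => h.unique_low hx hb, fun hx => hx ▸ hb⟩
    obtain ⟨l₁, l₂, rfl⟩ := List.append_of_mem ((hl.mem (b, LR)).2 (h.free_low hb))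
    refine ⟨.lower, l₁, [(b, LR)], l₂, by simp, rfl, ?_, ?_, ?_⟩
    · intro x; simp [hU']
    · intro x; rw [hLb]; simp
    refine IsBoundary.subst hom hinj rfl (m := [(b, LR)]) (by simpa using hl) (by simp)
      (by simp [GrowthKind.new]) (by simp) (by simp) ?_ ?_ ?_ ?_ ?_ (hdis _) ?_
    · simp [GrowthKind.new, GrowthKind.pre, GrowthKind.post]
      exact ⟨.here free_attach_lr, .here free_attach_ur⟩
    · simp [GrowthKind.new, GrowthKind.pre, GrowthKind.post]
    · simp [GrowthKind.new, GrowthKind.pre, GrowthKind.post]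
      exact .cross (f := ((none : Option P.Cell), UL)) (glued_attach_low hb)
        (.here (free_attach_ll.2 hU'))
    · simp [GrowthKind.new, GrowthKind.pre, GrowthKind.post]
      intro g s hg
      exact .cross (f := (some b, LR)) (glued_attach_low hb).symm hg
    · rintro ⟨x, s⟩
      refine free_attach.trans ?_
      simp only [hU', hLb, List.mem_cons, Prod.mk.injEq, List.not_mem_nil, or_false]
      cases s <;> simp
    · intro e he
      obtain ⟨e, s⟩ := e
      obtain rfl : e = none := exists_edgeMap_some he
      refine free_attach_none.trans ?_
      simp only [hU', hLb, GrowthKind.new, GrowthKind.pre, GrowthKind.post]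
      cases s <;> simp

theorem map_snd_edgeMap {α β : Type} (f : α → β) (l : List (α × Side)) :
    (l.map (edgeMap f)).map Prod.snd = l.map Prod.snd := by
  simp

theorem free_single (x : single.Edge) : single.Free x := by
  rintro f (h | h | h | h) <;> exact h

theorem isBoundary_single :
    single.IsBoundary [((), LL), ((), LR), ((), UR), ((), UL)] := by
  refine ⟨rfl, rfl, by simp, ?_, ?_⟩
  · rintro ⟨-, s⟩
    simp only [free_single, iff_true]
    cases s <;> simp
  · simp
    exact ⟨.here (free_single _), .here (free_single _), .here (free_single _)⟩

/-- Every fish has a boundary, and its word is a fish word. -/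
theorem IsFish.exists_boundary {P : GluedCells} (hP : P.IsFish) :
    ∃ l, P.IsBoundary l ∧ IsFishWord (l.map Prod.snd) := by
  induction hP using IsFish.growth with
  | single => exact ⟨_, isBoundary_single, .single⟩
  | attach P U L hP h ih =>
    obtain ⟨l, hl, hw⟩ := ih
    obtain ⟨k, l₁, m, l₂, rfl, hm, -, -, -, -, hb⟩ := hl.attach hP.coherent h
    refine ⟨_, hb, ?_⟩
    simp only [List.map_append, hm] at hw
    simpa [Function.comp_def] using k.isFishWord hw
  | rename P Q hP e ih =>
    obtain ⟨e, he⟩ := iso_iff.1 e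
    obtain ⟨l, hl, hw⟩ := ih
    exact ⟨_, he.isBoundary hl, by rwa [map_snd_edgeMap]⟩

/-- A fish with its boundary word. -/
def HasWord (P : GluedCells) (w : List Side) : Prop :=
  P.IsFish ∧ ∃ l, P.IsBoundary l ∧ l.map Prod.snd = w

theorem IsBoundary.isFishWord {P : GluedCells} (hP : P.IsFish) {l : List P.Edge}
    (hl : P.IsBoundary l) : IsFishWord (l.map Prod.snd) := by
  obtain ⟨l', hl', hw⟩ := hP.exists_boundary
  rwa [hl.unique hP.coherent hl']

/-! ### Removing a tail -/

/-- Exchanging two cells that were added one after the other. -/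
def swapCells (α : Type) : Option (Option α) ≃ Option (Option α) where
  toFun
    | none => some none
    | some none => none
    | some (some a) => some (some a)
  invFun
    | none => some none
    | some none => none
    | some (some a) => some (some a)
  left_inv := by rintro (_ | _ | a) <;> rfl
  right_inv := by rintro (_ | _ | a) <;> rfl

/-- A tail other than the head can be added last. -/
theorem IsFish.exists_attach {Q : GluedCells} (hQ : Q.IsFish) : ∀ y, y ≠ Q.head →
    Q.Free (y, UR) → Q.Free (y, LR) → ∃ (P : GluedCells) (U L : P.Cell → Prop) (e : _),
      P.IsFish ∧ P.Step U L ∧ IsIso (P.attach U L) Q e ∧ e none = y := by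
  induction hQ using IsFish.growth with
  | single => intro y hy; exact absurd rfl hy
  | rename Q Q' hQ f ih =>
    obtain ⟨f, hf⟩ := iso_iff.1 f
    intro y hy hu hl
    obtain ⟨P, U, L, e, hP, hs, he, hy'⟩ := ih (f.symm y)
      (fun h => hy (by rw [← hf.head, ← h]; simp)) (by rw [← hf.free]; simpa using hu)
      (by rw [← hf.free]; simpa using hl)
    exact ⟨P, U, L, e.trans f, hP, hs, he.trans hf, (congrArg f hy').trans (f.apply_symm_apply y)⟩
  | attach Q U L hQ h ih =>
    rintro (_ | y) hy hu hl
    · exact ⟨Q, U, L, Equiv.refl _, hQ, h, ⟨rfl, fun _ _ => Iff.rfl, fun _ _ => Iff.rfl⟩, rfl⟩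
    rw [free_attach] at hu hl
    -- The last cell is not glued to the tail `y`. So `y` is first peeled off the smaller fish by
    -- induction, the last cell is attached without it, and the two additions are exchanged.
    have hUy : ¬ U y := hu.2.1 rfl
    have hLy : ¬ L y := hl.2.2 rfl
    obtain ⟨P, U₀, L₀, e, hP, hs, he, rfl⟩ := ih y (fun h => hy (congrArg some h)) hu.1 hl.1
    have hU₀ : ∀ {x}, U₀ x → ¬ U (e (some x)) := fun {x} hx hx' =>
      free_ur.1 (h.free_up hx') _ ((he.up (some x) none).1 hx)
    have hL₀ : ∀ {x}, L₀ x → ¬ L (e (some x)) := fun {x} hx hx' =>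
      free_lr.1 (h.free_low hx') _ ((he.low (some x) none).1 hx)
    have hs' : P.Step (fun x => U (e (some x))) (fun x => L (e (some x))) := by
      refine ⟨?_, ?_, ?_, ?_, ?_, ?_⟩
      · intro x hx
        have : Q.Free (edgeMap e (some x, UR)) := h.free_up hx
        rw [he.free, free_attach] at this
        exact this.1
      · intro x hx
        have : Q.Free (edgeMap e (some x, LR)) := h.free_low hx
        rw [he.free, free_attach] at this
        exact this.1
      · intro x y hx hy
        exact Option.some_injective _ (e.injective (h.unique_up hx hy))
      · intro x y hx hy
        exact Option.some_injective _ (e.injective (h.unique_low hx hy))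
      · intro c b hc hb
        obtain ⟨a, h1, h2⟩ := h.square hc hb
        obtain ⟨a, rfl⟩ := e.surjective a
        replace h1 := (he.up _ (some b)).2 h1
        replace h2 := (he.low _ (some c)).2 h2
        rcases a with _ | a
        · exact h1.elim
        · exact ⟨a, h1, h2⟩
      · obtain ⟨x, hx⟩ := h.nonempty
        obtain ⟨x, rfl⟩ := e.surjective x
        rcases x with _ | x
        · tauto
        · exact ⟨x, hx⟩
    refine ⟨P.attach (fun x => U (e (some x))) (fun x => L (e (some x))),
      fun x => ∃ y, x = some y ∧ U₀ y, fun x => ∃ y, x = some y ∧ L₀ y,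
      (swapCells P.Cell).trans (Equiv.optionCongr e), hP.attach hs', ?_, ?_, rfl⟩
    · refine ⟨?_, ?_, ?_, ?_, ?_, ?_⟩
      · rintro _ ⟨x, rfl, hx⟩
        exact free_attach.2 ⟨hs.free_up hx, fun _ => hU₀ hx, by simp⟩
      · rintro _ ⟨x, rfl, hx⟩
        exact free_attach.2 ⟨hs.free_low hx, by simp, fun _ => hL₀ hx⟩
      · rintro _ _ ⟨x, rfl, hx⟩ ⟨y, rfl, hy⟩
        rw [hs.unique_up hx hy]
      · rintro _ _ ⟨x, rfl, hx⟩ ⟨y, rfl, hy⟩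
        rw [hs.unique_low hx hy]
      · rintro _ _ ⟨x, rfl, hx⟩ ⟨y, rfl, hy⟩
        obtain ⟨a, h1, h2⟩ := hs.square hx hy
        exact ⟨some a, h1, h2⟩
      · obtain ⟨x, hx | hx⟩ := hs.nonempty
        · exact ⟨some x, Or.inl ⟨x, rfl, hx⟩⟩
        · exact ⟨some x, Or.inr ⟨x, rfl, hx⟩⟩
    · refine ⟨congrArg some he.head, ?_, ?_⟩
      · have key : ∀ x, Q.up (e x) (e none) ↔ ∃ y, x = some y ∧ U₀ y := by
          rintro (_ | x)
          · exact ⟨fun h => ((he.up none none).2 h).elim, fun ⟨y, hy, _⟩ => nomatch hy⟩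
          · exact ⟨fun h => ⟨x, rfl, (he.up (some x) none).2 h⟩, fun ⟨y, hy, hu⟩ =>
              (he.up (some x) none).1 (Option.some_injective _ hy ▸ hu)⟩
        rintro (_ | _ | x) (_ | _ | y)
        · exact (he.up none none)
        · exact (iff_false_intro id).trans (iff_false_intro hUy).symm
        · exact (he.up none (some y))
        · exact ⟨fun ⟨y, hy, _⟩ => (nomatch hy), False.elim⟩
        · exact Iff.rfl
        · exact Iff.rfl
        · exact (key (some x)).symm.trans Iff.rfl
        · exact Iff.rfl
        · exact he.up (some x) (some y)
      · have key : ∀ x, Q.low (e x) (e none) ↔ ∃ y, x = some y ∧ L₀ y := by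
          rintro (_ | x)
          · exact ⟨fun h => ((he.low none none).2 h).elim, fun ⟨y, hy, _⟩ => nomatch hy⟩
          · exact ⟨fun h => ⟨x, rfl, (he.low (some x) none).2 h⟩, fun ⟨y, hy, hu⟩ =>
              (he.low (some x) none).1 (Option.some_injective _ hy ▸ hu)⟩
        rintro (_ | _ | x) (_ | _ | y)
        · exact (he.low none none)
        · exact (iff_false_intro id).trans (iff_false_intro hLy).symm
        · exact (he.low none (some y))
        · exact ⟨fun ⟨y, hy, _⟩ => (nomatch hy), False.elim⟩
        · exact Iff.rfl
        · exact Iff.rfl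
        · exact (key (some x)).symm.trans Iff.rfl
        · exact Iff.rfl
        · exact he.low (some x) (some y)

end GluedCells

theorem List.append_cons_inj_of_nodup {α : Type*} {a b c d : List α} {x : α}
    (h : a ++ x :: b = c ++ x :: d) (hn : (a ++ x :: b).Nodup) : a = c ∧ b = d := by
  have hn' := hn
  rw [h] at hn'
  rw [List.nodup_append] at hn hn'
  rcases List.append_eq_append_iff.1 h with ⟨t, rfl, ht⟩ | ⟨t, rfl, ht⟩
  · cases t with
    | nil => simp at ht; simp [ht]
    | cons y t =>
      simp at ht
      rw [← ht.1] at hn'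
      exact absurd rfl (hn'.2.2 x (by simp) x (by simp))
  · cases t with
    | nil => simp at ht; simp [ht]
    | cons y t =>
      simp at ht
      rw [← ht.1] at hn
      exact absurd rfl (hn.2.2 x (by simp) x (by simp))

namespace GrowthKind

/-- The kinds `upper` and `lower` give at least five letters. The kind `double` would come from `LL
UR LR UL`, whose proper factor `LL UR` is balanced. -/
theorem not_single {k : GrowthKind} {u v : List Side} (h : IsFishWord (u ++ (k.core ++ v)))
    (hu : u ≠ []) (hv : v ≠ []) (h' : u ++ (k.new ++ v) = [LL, LR, UR, UL]) : False := by
  obtain ⟨a, u, rfl⟩ := List.exists_cons_of_ne_nil hu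
  obtain ⟨b, v, rfl⟩ := List.exists_cons_of_ne_nil hv
  have hlen := congrArg List.length h'
  cases k <;> simp only [new, pre, post, List.nil_append, List.cons_append, List.length_append,
    List.length_cons, List.length_nil] at hlen
  · omega
  · omega
  · obtain rfl : u = [] := List.length_eq_zero_iff.1 (by omega)
    obtain rfl : v = [] := List.length_eq_zero_iff.1 (by omega)
    simp [new, pre, post] at h'
    obtain ⟨rfl, rfl⟩ := h'
    have := (h.conn [] [LL, UR] [LR, UL] rfl (by simp) (by simp [IsBalanced])).2
    simp at this

end GrowthKind

/-! ### A fish is determined by its boundary word -/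

namespace GluedCells

/-- Two consecutive edges, lower right and upper right, belong to the same cell. -/
theorem Coherent.eq_of_boundaryNext {P : GluedCells} (hP : P.Coherent) {x y : P.Cell}
    (hx : P.Free (x, LR)) (h : P.BoundaryNext (x, LR) (y, UR)) : x = y := by
  -- If the upper right edge of `x` were glued, the turn would cross three glued edges around the
  -- vertex. The `square` property would then close the circle at the lower right edge of `x`, which
  -- is free.
  rcases h with _ | ⟨h1, h⟩
  · rfl
  cases h1 with | up h1 =>
  rcases h with _ | ⟨h2, h⟩
  cases h2 with | low h2 =>
  rcases h with _ | ⟨h3, h⟩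
  cases h3 with | up' h3 =>
  obtain ⟨a, h4, h5⟩ := hP.square h2 h3
  obtain rfl := hP.up_left h4 h1
  exact absurd h5 (free_lr.1 hx _)

/-- If the head is a tail, there is no other cell on the boundary. -/
theorem IsBoundary.eq_of_head {P : GluedCells} (hP : P.Coherent) {l₁ l₂ : List P.Edge}
    (h : P.IsBoundary (l₁ ++ (P.head, LR) :: (P.head, UR) :: l₂)) :
    l₁ = [(P.head, LL)] ∧ l₂ = [(P.head, UL)] := by
  have hlr : P.Free (P.head, LR) := (h.mem _).1 (by simp)
  have hul : P.Free (P.head, UL) := (h.mem _).1 (List.mem_of_getLast? h.last)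
  have hn := h.nodup
  have hc := h.chain
  constructor
  · have hh := h.head
    match l₁, hh with
    | [e], hh => simp at hh; rw [hh]
    | e :: g :: l₁, hh =>
      simp at hh hc
      obtain rfl := hh
      obtain rfl := hP.turn hc.1 (.here hlr)
      simp [Side.next] at hn
  · have hh := h.last
    rw [List.getLast?_append] at hh
    match l₂, hh with
    | [], hh => simp at hh
    | [e], hh => simp at hh; rw [hh]
    | e :: g :: l₂, hh =>
      rw [List.isChain_append, List.isChain_cons_cons, List.isChain_cons_cons] at hc
      obtain rfl := hP.turn hc.2.1.2.1 (.here hul)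
      simp at hh
      have := List.mem_of_getLast? (l := g :: l₂) (by simpa [List.getLast?_cons] using hh)
      rw [List.nodup_append, List.nodup_cons, List.nodup_cons, List.nodup_cons] at hn
      exact absurd this hn.2.1.2.2.1

theorem IsFish.single_or_attach {Q : GluedCells} (hQ : Q.IsFish) : Iso single Q ∨
    ∃ (P : GluedCells) (U L : P.Cell → Prop), P.IsFish ∧ P.Step U L ∧ Iso (P.attach U L) Q := by
  induction hQ using IsFish.growth with
  | single => exact Or.inl (Iso.refl _)
  | attach P U L hP h ih => exact Or.inr ⟨P, U, L, hP, h, Iso.refl _⟩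
  | rename P Q hP e ih =>
    rcases ih with ih | ⟨P', U, L, h1, h2, h3⟩
    · exact Or.inl (ih.trans e)
    · exact Or.inr ⟨P', U, L, h1, h2, h3.trans e⟩

/-- A fish is determined by its boundary word. -/
theorem IsFish.exists_isIso {P : GluedCells} (hP : P.IsFish) : ∀ {Q : GluedCells}, Q.IsFish →
    ∀ {l : List P.Edge} {l' : List Q.Edge}, P.IsBoundary l → Q.IsBoundary l' →
    l.map Prod.snd = l'.map Prod.snd → ∃ e, IsIso P Q e := by
  induction hP using IsFish.growth with
  | single =>
    intro Q hQ l l' hl hl' hw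
    obtain rfl := hl.unique IsFish.head.coherent isBoundary_single
    rcases hQ.single_or_attach with h | ⟨P, U, L, hP, h, e⟩
    · exact iso_iff.1 h
    · obtain ⟨e, he⟩ := iso_iff.1 e
      obtain ⟨l₀, hl₀, -⟩ := hP.exists_boundary
      have hw₀ := hl₀.isFishWord hP
      obtain ⟨k, l₁, m, l₂, rfl, hm, -, -, h1, h2, hb⟩ := hl₀.attach hP.coherent h
      obtain rfl := (he.isBoundary hb).unique hQ.coherent hl'
      rw [List.map_append, List.map_append, hm] at hw₀
      rw [map_snd_edgeMap] at hw
      exact absurd (by simpa [Function.comp_def] using hw.symm)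
        (GrowthKind.not_single hw₀ (by simpa using h1) (by simpa using h2))
  | rename P P' hP f ih =>
    obtain ⟨f, hf⟩ := iso_iff.1 f
    intro Q hQ l l' hl hl' hw
    obtain ⟨e, he⟩ := ih hQ (hf.symm.isBoundary hl) hl' (by rw [map_snd_edgeMap, hw])
    exact ⟨_, hf.symm.trans he⟩
  | attach P U L hP h ih =>
    intro Q hQ l l' hl hl' hw
    obtain ⟨lP, hlP, -⟩ := hP.exists_boundary
    have hwP := hlP.isFishWord hP
    obtain ⟨k, l₁, m, l₂, rfl, hm, hU, hL, n1, n2, hb⟩ := hlP.attach hP.coherent h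
    obtain rfl := hl.unique (hP.attach h).coherent hb
    rw [List.map_append, List.map_append, hm] at hwP
    -- The right edges of the last cell show up as `LR UR` in the common word. In `Q` these two
    -- letters belong to one cell `x`, a tail, and `x` is not the head since otherwise `Q` would
    -- have the word of a single cell.
    have hw' : (l₁.map Prod.snd ++ k.pre) ++ LR :: UR :: (k.post ++ l₂.map Prod.snd) =
        l'.map Prod.snd := by
      rw [← hw]; simp [Function.comp_def, GrowthKind.new]
    obtain ⟨a₁, b, rfl, ha₁, hb'⟩ := List.map_eq_append_iff.1 hw'.symm
    obtain ⟨⟨x, s⟩, b, rfl, hx, hb'⟩ := List.map_eq_cons_iff.1 hb'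
    obtain ⟨⟨y, s'⟩, a₂, rfl, hy, ha₂⟩ := List.map_eq_cons_iff.1 hb'
    obtain rfl : s = LR := hx
    obtain rfl : s' = UR := hy
    have hxf : Q.Free (x, LR) := (hl'.mem _).1 (by simp)
    have hyf : Q.Free (y, UR) := (hl'.mem _).1 (by simp)
    obtain rfl : x = y := by
      have := hl'.chain
      rw [List.isChain_append, List.isChain_cons_cons] at this
      exact hQ.coherent.eq_of_boundaryNext hxf this.2.1.1
    have hne : x ≠ Q.head := by
      rintro rfl
      obtain ⟨rfl, rfl⟩ := hl'.eq_of_head hQ.coherent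
      refine GrowthKind.not_single hwP (by simpa using n1) (by simpa using n2) ?_
      simpa [GrowthKind.new] using hw'
    obtain ⟨P', U', L', e, hP', h', he, hex⟩ := hQ.exists_attach x hne hyf hxf
    obtain ⟨lP', hlP', -⟩ := hP'.exists_boundary
    have hwP' := hlP'.isFishWord hP'
    obtain ⟨k', l₁', m', l₂', rfl, hm', hU', hL', n1', n2', hb'⟩ := hlP'.attach hP'.coherent h'
    have hbe := he.isBoundary hb'
    have heq := hbe.unique hQ.coherent hl'
    rw [List.map_append, List.map_append, hm'] at hwP'
    -- The edge `(x, LR)` occurs once on the boundary of `Q`, so the two descriptions of this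
    -- boundary can be cut there and compared.
    obtain ⟨e1, e2⟩ := List.append_cons_inj_of_nodup (x := (x, LR))
      (a := (l₁'.map (edgeMap some)).map (edgeMap e) ++ k'.pre.map (fun s => (x, s)))
      (b := (x, UR) :: (k'.post.map (fun s => (x, s)) ++ (l₂'.map (edgeMap some)).map (edgeMap e)))
      (c := a₁) (d := (x, UR) :: a₂)
      (by rw [← heq]; simp [GrowthKind.new, hex, Function.comp_def])
      (by convert hl'.nodup using 1; rw [← heq]; simp [GrowthKind.new, hex, Function.comp_def])
    rw [List.cons_inj_right] at e2
    subst e1 e2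
    -- Equal contexts force equal kinds and equal words of the smaller fish; the isomorphism given
    -- by induction matches the covered edges `m` and `m'`, so it extends to the last cells.
    obtain ⟨rfl, w1, w2⟩ := GrowthKind.eq_of_context hwP hwP' (by simpa using n1) (by simpa using n1')
      (by rw [← ha₁]; simp [Function.comp_def])
      (by rw [← ha₂]; simp [Function.comp_def])
    obtain ⟨f, hf⟩ := ih hP' hlP hlP' (by simp only [List.map_append, hm, hm', w1, w2])
    have hlf := (hf.isBoundary hlP).unique hP'.coherent hlP'
    rw [List.map_append, List.map_append] at hlf
    obtain ⟨-, hlf⟩ := List.append_inj hlf (by simpa using congrArg List.length w1)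
    obtain ⟨hmf, -⟩ := List.append_inj hlf
      (by simpa using congrArg List.length (hm.trans hm'.symm))
    have hmem : ∀ z s, (f z, s) ∈ m' ↔ (z, s) ∈ m := by
      intro z s
      rw [← hmf]
      exact List.mem_map_of_injective (f.injective.prodMap Function.injective_id) (a := (z, s))
    have hfa : IsIso (P.attach U L) (P'.attach U' L') (Equiv.optionCongr f) := by
      refine ⟨congrArg some hf.head, ?_, ?_⟩
      · rintro (_ | a) (_ | b)
        · exact Iff.rfl
        · exact Iff.rfl
        · exact (hU a).trans ((hmem a UR).symm.trans (hU' (f a)).symm)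
        · exact hf.up a b
      · rintro (_ | a) (_ | b)
        · exact Iff.rfl
        · exact Iff.rfl
        · exact (hL a).trans ((hmem a LR).symm.trans (hL' (f a)).symm)
        · exact hf.low a b
    exact ⟨_, hfa.trans he⟩

theorem HasWord.iso {P Q : GluedCells} {w : List Side} (hP : P.HasWord w) (hQ : Q.HasWord w) :
    Iso P Q := by
  obtain ⟨hP, l, hl, rfl⟩ := hP
  obtain ⟨hQ, l', hl', hw⟩ := hQ
  exact iso_iff.2 (hP.exists_isIso hQ hl hl' hw.symm)

theorem HasWord.of_iso {P Q : GluedCells} {w : List Side} (hP : P.HasWord w) (h : Iso P Q) :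
    Q.HasWord w := by
  obtain ⟨hP, l, hl, rfl⟩ := hP
  obtain ⟨e, he⟩ := iso_iff.1 h
  exact ⟨hP.rename h, _, he.isBoundary hl, map_snd_edgeMap _ _⟩

theorem HasWord.unique {P : GluedCells} {w w' : List Side} (h : P.HasWord w)
    (h' : P.HasWord w') : w = w' := by
  obtain ⟨hP, l, hl, rfl⟩ := h
  obtain ⟨-, l', hl', rfl⟩ := h'
  rw [hl.unique hP.coherent hl']

theorem IsFish.exists_hasWord {P : GluedCells} (hP : P.IsFish) : ∃ w, P.HasWord w :=
  let ⟨l, hl, _⟩ := hP.exists_boundary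
  ⟨_, hP, l, hl, rfl⟩

theorem HasWord.isFishWord {P : GluedCells} {w : List Side} (h : P.HasWord w) : IsFishWord w := by
  obtain ⟨hP, l, hl, rfl⟩ := h
  exact hl.isFishWord hP

end GluedCells

namespace GluedCells

/-! ### Adding a cell from below -/

/-- Add a new cell (`none`), glued along its upper right edge to the lower left edge of `y` and
along its upper left edge to the lower right edges of the cells in `X`. -/
@[reducible]
def underAttach (P : GluedCells) (h : Option P.Cell) (X : P.Cell → Prop) (y : P.Cell) :
    GluedCells where
  Cell := Option P.Cell
  finite := haveI := P.finite; inferInstance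
  head := h
  up := fun x z => match x, z with
    | some a, some b => P.up a b
    | none, some b => b = y
    | _, none => False
  low := fun x z => match x, z with
    | some a, some b => P.low a b
    | some a, none => X a
    | none, _ => False

theorem isHom_underAttach (P : GluedCells) (h : Option P.Cell) (X : P.Cell → Prop) (y : P.Cell) :
    IsHom P (P.underAttach h X y) some :=
  ⟨id, id⟩

theorem free_underAttach {P : GluedCells} {h : Option P.Cell} {X : P.Cell → Prop} {y x : P.Cell}
    {s : Side} : (P.underAttach h X y).Free (some x, s) ↔
      P.Free (x, s) ∧ (s = LL → x ≠ y) ∧ (s = LR → ¬ X x) := by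
  cases s
  · rw [free_ll, free_ll]
    simp only [reduceCtorEq, false_implies, and_true, true_implies]
    exact ⟨fun h => ⟨fun a => h (some a), h none⟩,
      fun h a => by rcases a with _ | a; exacts [h.2, h.1 a]⟩
  · rw [free_lr, free_lr]
    simp only [reduceCtorEq, false_implies, true_and, true_implies]
    exact ⟨fun h => ⟨fun a => h (some a), h none⟩,
      fun h a => by rcases a with _ | a; exacts [h.2, h.1 a]⟩
  · rw [free_ur, free_ur]
    simp only [reduceCtorEq, false_implies, and_true]
    exact ⟨fun h a => h (some a), fun h a => by rcases a with _ | a; exacts [id, h a]⟩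
  · rw [free_ul, free_ul]
    simp only [reduceCtorEq, false_implies, and_true]
    exact ⟨fun h a => h (some a), fun h a => by rcases a with _ | a; exacts [id, h a]⟩

theorem free_underAttach_none {P : GluedCells} {h : Option P.Cell} {X : P.Cell → Prop}
    {y : P.Cell} {s : Side} : (P.underAttach h X y).Free (none, s) ↔
      s ≠ UR ∧ (s = UL → ∀ x, ¬ X x) := by
  cases s
  · rw [free_ll]
    simp only [ne_eq, reduceCtorEq, not_false_eq_true, false_implies, and_true, iff_true]
    rintro (_ | a) <;> simp
  · rw [free_lr]
    simp only [ne_eq, reduceCtorEq, not_false_eq_true, false_implies, and_true, iff_true]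
    simp
  · rw [free_ur]
    simp only [ne_eq, not_true_eq_false, false_and, iff_false]
    exact fun h => h (some y) rfl
  · rw [free_ul]
    simp only [ne_eq, reduceCtorEq, not_false_eq_true, true_implies, true_and]
    exact ⟨fun h a => h (some a), fun h a => by rcases a with _ | a; exacts [id, h a]⟩

theorem glued_underAttach {P : GluedCells} {h : Option P.Cell} {X : P.Cell → Prop}
    {y : P.Cell} : (P.underAttach h X y).Glued (none, UR) (some y, LL) :=
  .up (P := P.underAttach h X y) (a := none) (b := some y) rfl

theorem glued_underAttach_low {P : GluedCells} {h : Option P.Cell} {X : P.Cell → Prop}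
    {x y : P.Cell} (hx : X x) : (P.underAttach h X y).Glued (some x, LR) (none, UL) :=
  .low (P := P.underAttach h X y) (a := some x) (b := none) hx

theorem IsIso.underAttach {P Q : GluedCells} {e : P.Cell ≃ Q.Cell} (he : IsIso P Q e)
    {h : Option P.Cell} {X : P.Cell → Prop} {X' : Q.Cell → Prop} {y : P.Cell}
    (hX : ∀ x, X x ↔ X' (e x)) :
    Iso (P.underAttach h X y) (Q.underAttach (h.map e) X' (e y)) := by
  refine ⟨Equiv.optionCongr e, by simp, ?_, ?_⟩
  · rintro (_ | a) (_ | b)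
    · exact Iff.rfl
    · exact e.injective.eq_iff.symm
    · exact Iff.rfl
    · exact he.up a b
  · rintro (_ | a) (_ | b)
    · exact Iff.rfl
    · exact Iff.rfl
    · exact hX a
    · exact he.low a b

/-- A cell added on the right and one added from below commute. This transports additions from below
through the growth of the fish. -/
theorem attach_underAttach {P : GluedCells} {h : Option P.Cell} {X : P.Cell → Prop} {y : P.Cell}
    {U L : P.Cell → Prop} {X' : Option P.Cell → Prop} (hX : ∀ x, X x ↔ X' (some x))
    (hX' : ¬ X' none) :
    Iso ((P.underAttach h X y).attach (fun z => ∃ w, z = some w ∧ U w)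
      (fun z => ∃ w, z = some w ∧ L w)) ((P.attach U L).underAttach (h.map some) X' (some y)) := by
  have key : ∀ {V : P.Cell → Prop} {a}, (∃ w, some a = some w ∧ V w) ↔ V a := by
    intro V a
    simp
  have key' : ∀ {V : P.Cell → Prop}, (∃ w, none = some w ∧ V w) ↔ False := by
    simp
  refine ⟨swapCells P.Cell, by cases h <;> rfl, ?_, ?_⟩
  · rintro (_ | _ | a) (_ | _ | b)
    · exact Iff.rfl
    · exact Iff.rfl
    · exact Iff.rfl
    · exact key'.trans (iff_false_intro (fun h => nomatch h)).symm
    · exact Iff.rfl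
    · exact (Option.some_injective _).eq_iff.symm
    · exact key
    · exact Iff.rfl
    · exact Iff.rfl
  · rintro (_ | _ | a) (_ | _ | b)
    · exact Iff.rfl
    · exact (iff_false_intro hX').symm
    · exact Iff.rfl
    · exact key'
    · exact Iff.rfl
    · exact Iff.rfl
    · exact key
    · exact hX a
    · exact Iff.rfl

theorem Step.underAttach {P : GluedCells} {U L : P.Cell → Prop} (hs : P.Step U L)
    {h : Option P.Cell} {X : P.Cell → Prop} {y : P.Cell} (hX : ∀ x, X x → ¬ L x) :
    (P.underAttach h X y).Step (fun z => ∃ w, z = some w ∧ U w)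
      (fun z => ∃ w, z = some w ∧ L w) := by
  refine ⟨?_, ?_, ?_, ?_, ?_, ?_⟩
  · rintro _ ⟨x, rfl, hx⟩
    exact free_underAttach.2 ⟨hs.free_up hx, by simp, by simp⟩
  · rintro _ ⟨x, rfl, hx⟩
    exact free_underAttach.2 ⟨hs.free_low hx, by simp, fun _ h => hX x h hx⟩
  · rintro _ _ ⟨x, rfl, hx⟩ ⟨y, rfl, hy⟩
    rw [hs.unique_up hx hy]
  · rintro _ _ ⟨x, rfl, hx⟩ ⟨y, rfl, hy⟩
    rw [hs.unique_low hx hy]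
  · rintro _ _ ⟨x, rfl, hx⟩ ⟨y, rfl, hy⟩
    obtain ⟨a, h1, h2⟩ := hs.square hx hy
    exact ⟨some a, h1, h2⟩
  · obtain ⟨x, hx | hx⟩ := hs.nonempty
    · exact ⟨some x, Or.inl ⟨x, rfl, hx⟩⟩
    · exact ⟨some x, Or.inr ⟨x, rfl, hx⟩⟩

/-- A new head can be added below the old one. -/
theorem IsFish.precede {P : GluedCells} (hP : P.IsFish) :
    (P.underAttach none (fun _ => False) P.head).IsFish := by
  induction hP using IsFish.growth with
  | single =>
    have h : single.Step (fun _ => True) (fun _ => False) :=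
      ⟨fun _ => free_single _, fun h => h.elim, fun _ _ => rfl, fun h => h.elim,
        fun _ h => h.elim, ⟨(), Or.inl trivial⟩⟩
    refine (IsFish.head.attach h).rename ⟨Equiv.swap none (some ()), Equiv.swap_apply_right _ _,
      ?_, ?_⟩
    · rintro (_ | a) (_ | b)
      · simp
      · simp
      · simp
      · simp
    · rintro (_ | a) (_ | b)
      · simp
      · simp
      · simp
      · simp
  | attach P U L hP h ih =>
    exact (ih.attach (h.underAttach (by simp))).rename (attach_underAttach (by simp) id)
  | rename P Q hP e ih =>
    obtain ⟨e, he⟩ := iso_iff.1 e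
    have := ih.rename (he.underAttach (X' := fun _ => False) (by simp))
    rwa [he.head] at this

/-- A new cell can be added in a dent of the lower boundary. -/
theorem IsFish.underAttach {P : GluedCells} (hP : P.IsFish) : ∀ {x b y : P.Cell}, P.up x b →
    P.low b y → P.Free (x, LR) → P.Free (y, LL) →
    (P.underAttach (some P.head) (fun z => z = x) y).IsFish := by
  induction hP using IsFish.growth with
  | single => intro x b y h; exact h.elim
  | attach P U L hP h ih =>
    rintro (_ | x) (_ | b) (_ | y) hxb hby hx hy
    all_goals first | exact hxb.elim | exact hby.elim | skip
    · rw [free_attach] at hx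
      rw [free_attach_none] at hy
      -- Here `y` is the cell added last, hanging from `b` only. The fish is regrown in another
      -- order: the new cell goes to the lower right edge of `x`, and then `y` is glued to it and to
      -- `b`.
      have hLb : ∀ z, L z ↔ z = b := fun z => ⟨fun hz => h.unique_low hz hby, fun hz => hz ▸ hby⟩
      have hU : ∀ z, ¬ U z := hy.1 rfl
      have h1 : P.Step (fun _ => False) (fun z => z = x) :=
        ⟨fun h => h.elim, fun h => h ▸ hx.1, fun h => h.elim, fun h h' => h.trans h'.symm,
          fun h => h.elim, ⟨x, Or.inr rfl⟩⟩
      have hbx : b ≠ x := fun hb => hx.2.2 rfl (hb ▸ hby)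
      have h2 : (P.attach (fun _ => False) (fun z => z = x)).Step (fun z => z = none)
          (fun z => z = some b) := by
        refine ⟨?_, ?_, fun h h' => h.trans h'.symm, fun h h' => h.trans h'.symm, ?_,
          ⟨none, Or.inl rfl⟩⟩
        · rintro _ rfl
          exact free_attach_ur
        · rintro _ rfl
          exact free_attach.2 ⟨h.free_low hby, by simp, fun _ => hbx⟩
        · rintro _ _ rfl rfl
          exact ⟨some x, hxb, rfl⟩
      refine ((hP.attach h1).attach h2).rename ⟨swapCells P.Cell, rfl, ?_, ?_⟩
      · rintro (_ | _ | a) (_ | _ | c)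
        · exact Iff.rfl
        · exact Iff.rfl
        · exact Iff.rfl
        · exact iff_of_true rfl rfl
        · exact Iff.rfl
        · exact iff_of_false id (fun h => nomatch h)
        · exact iff_of_false (fun h => nomatch h) (hU a)
        · exact Iff.rfl
        · exact Iff.rfl
      · rintro (_ | _ | a) (_ | _ | c)
        · exact Iff.rfl
        · exact iff_of_false id (fun h => nomatch h)
        · exact Iff.rfl
        · exact iff_of_false (fun h => nomatch h) id
        · exact Iff.rfl
        · exact Iff.rfl
        · exact (Option.some_injective _).eq_iff.trans (hLb a).symm
        · exact (Option.some_injective _).eq_iff.symm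
        · exact Iff.rfl
    · rw [free_attach] at hx hy
      exact ((ih hxb hby hx.1 hy.1).attach (h.underAttach (by rintro z rfl; exact hx.2.2 rfl))).rename
        (attach_underAttach (fun z => (Option.some_injective _).eq_iff.symm) (fun h => nomatch h))
  | rename P Q hP e ih =>
    obtain ⟨e, he⟩ := iso_iff.1 e
    intro x b y hxb hby hx hy
    have hs := he.symm
    have := (ih ((hs.up _ _).1 hxb) ((hs.low _ _).1 hby) (hs.free.2 hx) (hs.free.2 hy)).rename
      (he.underAttach (X' := fun z => z = x) (fun z => e.eq_symm_apply))
    simpa [he.head] using this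

/-- A lower right edge is followed by a lower left edge only in a dent. -/
theorem Coherent.exists_of_boundaryNext {P : GluedCells} (hP : P.Coherent) {x y : P.Cell}
    (hx : P.Free (x, LR)) (h : P.BoundaryNext (x, LR) (y, LL)) : ∃ b, P.up x b ∧ P.low b y := by
  rcases h with _ | ⟨h1, h⟩
  cases h1 with | @up _ b h1 =>
  rcases h with _ | ⟨h2, h⟩
  cases h2 with | low h2 =>
  rcases h with _ | ⟨h3, h⟩
  · exact ⟨b, h1, h2⟩
  cases h3 with | up' h3 =>
  obtain ⟨a, h4, h5⟩ := hP.square h2 h3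
  obtain rfl := hP.up_left h4 h1
  exact absurd h5 (free_lr.1 hx _)

/-- Filling a dent replaces the letters `LR LL` by `LL LR`, so the exposed `LR` travels one step to
the right. This is how a strip acts on words. -/
theorem IsBoundary.underAttach {P : GluedCells} {l₁ l₂ : List P.Edge} {x y : P.Cell}
    (h : P.IsBoundary (l₁ ++ (x, LR) :: (y, LL) :: l₂)) :
    (P.underAttach (some P.head) (fun z => z = x) y).IsBoundary
      (l₁.map (edgeMap some) ++ (none, LL) :: (none, LR) :: l₂.map (edgeMap some)) := by
  refine (IsBoundary.subst (isHom_underAttach P (some P.head) (fun z => z = x) y)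
    (Option.some_injective _) rfl (m := [(x, LR), (y, LL)]) (m' := [(none, LL), (none, LR)])
    (by simpa using h) (by simp) (by simp) (by simp) (by simp) ?_ (by simp) ?_ ?_ ?_ ?_ ?_).2.2
  · simp only [List.isChain_cons_cons, List.IsChain.singleton, and_true]
    exact .here (free_underAttach_none.2 (by simp [Side.next]))
  · simp only [List.head?_cons, Option.mem_def, Option.some.injEq, forall_eq']
    exact .cross (f := ((none : Option P.Cell), UL)) 
      (glued_underAttach_low (X := fun z => z = x) rfl)
      (.here (free_underAttach_none.2 (by simp [Side.next])))
  · simp only [List.getLast?_cons_cons, List.getLast?_singleton, Option.mem_def, Option.some.injEq,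
      forall_eq']
    intro g hg
    exact .cross (f := (some y, LL)) glued_underAttach hg
  · rintro ⟨z, s⟩
    refine free_underAttach.trans ?_
    simp only [List.mem_cons, Prod.mk.injEq, List.not_mem_nil, or_false]
    cases s <;> simp
  · simp
  · rintro ⟨z, s⟩ hz
    obtain rfl : z = none := exists_edgeMap_some hz
    refine free_underAttach_none.trans ?_
    cases s <;> simp

/-- The new head covers the old nose edge; it contributes `LL LR` at the beginning and `UL` at the
end. This is the strip along a single edge. -/
theorem IsBoundary.precede {P : GluedCells} {l : List P.Edge}
    (h : P.IsBoundary ((P.head, LL) :: l)) :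
    (P.underAttach none (fun _ => False) P.head).IsBoundary
      ((none, LL) :: (none, LR) :: (l.map (edgeMap some) ++ [(none, UL)])) := by
  have hinj : Function.Injective (edgeMap (some : P.Cell → Option P.Cell)) :=
    (Option.some_injective _).prodMap Function.injective_id
  have hnone : ∀ s, ((none : Option P.Cell), s) ∉ l.map (edgeMap some) := by
    simp
  have hn := List.nodup_cons.1 h.nodup
  have hc := h.chain
  have hfree : ∀ e ∈ l, (P.underAttach none (fun _ => False) P.head).Free (edgeMap some e) := by
    rintro ⟨x, s⟩ he
    refine free_underAttach.2 ⟨(h.mem _).1 (List.mem_cons_of_mem _ he), ?_, by simp⟩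
    rintro rfl rfl
    exact hn.1 he
  obtain ⟨e, l', rfl⟩ : ∃ e l', l = e :: l' := by
    cases l with
    | nil => have := h.last; simp at this
    | cons e l' => exact ⟨e, l', rfl⟩
  rw [List.isChain_cons_cons] at hc
  refine ⟨rfl, ?_, ?_, ?_, ?_⟩
  · rw [← List.cons_append, ← List.cons_append, List.getLast?_concat]
  · refine List.nodup_cons.2 ⟨?_, List.nodup_cons.2 ⟨?_, ?_⟩⟩
    · simpa using hnone LL
    · simpa using hnone LR
    refine List.nodup_append.2 ⟨hn.2.map hinj, by simp, ?_⟩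
    rintro a ha b hb rfl
    rw [List.mem_singleton] at hb
    exact hnone _ (hb ▸ ha)
  · rintro ⟨_ | x, s⟩
    · refine Iff.trans ?_ free_underAttach_none.symm
      rw [List.mem_cons, List.mem_cons, List.mem_append]
      simp only [hnone, false_or, List.mem_singleton, Prod.mk.injEq, true_and]
      cases s <;> simp
    · refine Iff.trans ?_ free_underAttach.symm
      rw [← h.mem, List.mem_cons, List.mem_cons, List.mem_append,
        show ((some x, s) : Option P.Cell × Side) = edgeMap some (x, s) from rfl,
        List.mem_map_of_injective hinj]
      have : (P.head, LL) ∉ e :: l' := hn.1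
      simp only [List.mem_singleton, edgeMap, Prod.map, Prod.mk.injEq, reduceCtorEq, false_and,
        false_or, or_false, not_false_eq_true, implies_true, and_true]
      constructor
      · intro hx
        exact ⟨List.mem_cons_of_mem _ hx, by rintro rfl rfl; exact this hx⟩
      · rintro ⟨hx, hx'⟩
        rcases List.mem_cons.1 hx with hx | hx
        · simp at hx
          exact absurd hx.1 (hx' hx.2)
        · exact hx
  · refine List.isChain_cons_cons.2 ⟨.here (free_underAttach_none.2 (by simp [Side.next])), ?_⟩
    refine List.isChain_cons_cons.2 ⟨?_, ?_⟩
    · refine .cross (f := (some P.head, LL)) glued_underAttach ?_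
      exact (isHom_underAttach P none (fun _ => False) P.head).turn hc.1
        (.here (hfree e (by simp)))
    · refine List.isChain_append.2 ⟨isChain_edgeMap (isHom_underAttach P _ _ _) hc.2 hfree,
        by simp, ?_⟩
      intro a ha b hb
      have hl := h.last
      rw [List.getLast?_cons_cons] at hl
      rw [List.getLast?_map, hl] at ha
      simp only [Option.map_some, Option.mem_def, Option.some.injEq] at ha
      simp only [List.head?_cons, Option.mem_def, Option.some.injEq] at hb
      subst ha hb
      exact .cross (f := ((none : Option P.Cell), UR)) glued_underAttach.symm
        (.here (free_underAttach_none.2 (by simp [Side.next])))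

end GluedCells

namespace GluedCells

/-! ### Gluing the head of a fish -/

theorem free_glueHead_inl {Q R : GluedCells} {x c : Q.Cell} {s : Side} :
    (Q.glueHead x R).Free (.inl c, s) ↔ Q.Free (c, s) ∧ (s = LR → c ≠ x) := by
  cases s
  · rw [free_ll, free_ll]
    simp [Sum.forall]
  · rw [free_lr, free_lr]
    simp [Sum.forall]
  · rw [free_ur, free_ur]
    simp [Sum.forall]
  · rw [free_ul, free_ul]
    simp [Sum.forall]

theorem free_glueHead_inr {Q R : GluedCells} {x : Q.Cell} {c : R.Cell} {s : Side} :
    (Q.glueHead x R).Free (.inr c, s) ↔ R.Free (c, s) ∧ (s = UL → c ≠ R.head) := by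
  cases s
  · rw [free_ll, free_ll]
    simp [Sum.forall]
  · rw [free_lr, free_lr]
    simp [Sum.forall]
  · rw [free_ur, free_ur]
    simp [Sum.forall]
  · rw [free_ul, free_ul]
    simp [Sum.forall]
    tauto

theorem isHom_inl_glueHead (Q R : GluedCells) (x : Q.Cell) : IsHom Q (Q.glueHead x R) .inl :=
  ⟨id, id⟩

theorem isHom_inr_glueHead (Q R : GluedCells) (x : Q.Cell) : IsHom R (Q.glueHead x R) .inr :=
  ⟨id, id⟩

theorem glued_glueHead {Q R : GluedCells} {x : Q.Cell} :
    (Q.glueHead x R).Glued (.inl x, LR) (.inr R.head, UL) :=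
  .low (P := Q.glueHead x R) (a := .inl x) (b := .inr R.head) ⟨rfl, rfl⟩

/-- The growth of `R` is repeated on top of `Q`, starting with the head of `R` glued to the lower
right edge of `x`. -/
theorem IsFish.glueHead {Q R : GluedCells} (hQ : Q.IsFish) (hR : R.IsFish) {x : Q.Cell}
    (hx : Q.Free (x, LR)) : (Q.glueHead x R).IsFish := by
  induction hR using IsFish.growth with
  | single =>
    refine (hQ.attach (U := fun _ => False) (L := fun y => y = x) ⟨fun h => h.elim,
      fun h => h ▸ hx, fun h => h.elim, fun h h' => h.trans h'.symm, fun h => h.elim,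
      ⟨x, Or.inr rfl⟩⟩).rename ⟨Equiv.optionEquivSumPUnit _, by simp, ?_, ?_⟩
    · rintro (_ | a) (_ | b) <;> simp
    · rintro (_ | a) (_ | b) <;> simp
  | attach P U L hP h ih =>
    have hs : (Q.glueHead x P).Step (Sum.elim (fun _ => False) U) (Sum.elim (fun _ => False) L) := by
      refine ⟨?_, ?_, ?_, ?_, ?_, ?_⟩
      · rintro (a | a) ha
        · exact ha.elim
        · exact free_glueHead_inr.2 ⟨h.free_up ha, by simp⟩
      · rintro (a | a) ha
        · exact ha.elim
        · exact free_glueHead_inr.2 ⟨h.free_low ha, by simp⟩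
      · rintro (a | a) (b | b) ha hb
        all_goals first | exact ha.elim | exact hb.elim | skip
        exact congrArg _ (h.unique_up ha hb)
      · rintro (a | a) (b | b) ha hb
        all_goals first | exact ha.elim | exact hb.elim | skip
        exact congrArg _ (h.unique_low ha hb)
      · rintro (a | a) (b | b) ha hb
        all_goals first | exact ha.elim | exact hb.elim | skip
        obtain ⟨c, h1, h2⟩ := h.square ha hb
        exact ⟨.inr c, h1, h2⟩
      · obtain ⟨a, ha | ha⟩ := h.nonempty
        · exact ⟨.inr a, Or.inl ha⟩
        · exact ⟨.inr a, Or.inr ha⟩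
    refine (ih.attach hs).rename ⟨⟨fun z => z.elim (.inr none) (Sum.map id some),
      Sum.elim (fun a => some (.inl a)) (fun b => b.elim none (fun b => some (.inr b))),
      by rintro (_ | a | a) <;> rfl, by rintro (a | _ | a) <;> rfl⟩, rfl, ?_, ?_⟩
    · rintro (_ | a | a) (_ | b | b) <;> exact Iff.rfl
    · rintro (_ | a | a) (_ | b | b)
      all_goals first | exact Iff.rfl | skip
      · exact iff_of_false id (fun h => nomatch h.2)
      · exact ⟨fun h => ⟨h.1, congrArg some h.2⟩, fun h => ⟨h.1, Option.some_injective _ h.2⟩⟩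
  | rename P P' hP e ih =>
    obtain ⟨e, h1, h2, h3⟩ := e
    refine ih.rename ⟨Equiv.sumCongr (Equiv.refl _) e, rfl, ?_, ?_⟩
    · rintro (a | a) (b | b)
      · exact Iff.rfl
      · exact Iff.rfl
      · exact Iff.rfl
      · exact h2 a b
    · rintro (a | a) (b | b)
      · exact Iff.rfl
      · exact and_congr_right fun _ => by rw [← h1]; exact e.injective.eq_iff.symm
      · exact Iff.rfl
      · exact h3 a b

/-- The boundary of `R`, cut open at the upper left edge of its head, takes the place of the covered
edge `(x, LR)`. -/
theorem IsBoundary.glueHead {Q R : GluedCells} {x : Q.Cell} {l₁ l₂ : List Q.Edge}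
    {m : List R.Edge} (hQ : Q.IsBoundary (l₁ ++ (x, LR) :: l₂))
    (hR : R.IsBoundary (m ++ [(R.head, UL)])) :
    (Q.glueHead x R).IsBoundary
      (l₁.map (edgeMap .inl) ++ (m.map (edgeMap .inr) ++ l₂.map (edgeMap .inl))) := by
  obtain ⟨m', rfl⟩ : ∃ m', m = (R.head, LL) :: m' := by
    have := hR.head
    cases m with
    | nil => simp at this
    | cons e m' => simp at this; exact ⟨m', by rw [this]⟩
  have hn := hR.nodup
  rw [List.nodup_append] at hn
  have hc := hR.chain
  rw [List.isChain_append] at hc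
  have hmem : ∀ e, e ∈ (R.head, LL) :: m' ↔ R.Free e ∧ e ≠ (R.head, UL) := by
    intro e
    rw [← hR.mem, List.mem_append, List.mem_singleton]
    exact ⟨fun h => ⟨Or.inl h, fun h' => hn.2.2 e h _ (by simp) h'⟩, fun h => h.1.resolve_right h.2⟩
  have hfree : ∀ e, e ∈ (R.head, LL) :: m' ↔ (Q.glueHead x R).Free (edgeMap .inr e) := by
    rintro ⟨c, s⟩
    refine (hmem _).trans (Iff.trans ?_ free_glueHead_inr.symm)
    simp only [ne_eq, Prod.mk.injEq, not_and', id_eq]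
  have hinj : Function.Injective (edgeMap (.inr : R.Cell → Q.Cell ⊕ R.Cell)) :=
    Sum.inr_injective.prodMap Function.injective_id
  refine (IsBoundary.subst (isHom_inl_glueHead Q R x) Sum.inl_injective rfl (m := [(x, LR)])
    (m' := ((R.head, LL) :: m').map (edgeMap .inr)) (by simpa using hQ) (by simp) (by simp)
    (by simp) (by simp) ?_ (hn.1.map hinj) ?_ ?_ ?_ ?_ ?_).2.2
  · exact isChain_edgeMap (isHom_inr_glueHead Q R x) hc.1 fun e he => (hfree e).1 he
  · simp only [List.head?_cons, Option.mem_def, Option.some.injEq, forall_eq', List.map_cons]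
    exact .cross (f := ((Sum.inr R.head : Q.Cell ⊕ R.Cell), UL)) glued_glueHead
      (.here ((hfree (R.head, LL)).1 (by simp)))
  · simp only [List.getLast?_singleton, Option.mem_def, Option.some.injEq, forall_eq',
      List.getLast?_map, Option.map_eq_some_iff, forall_exists_index, and_imp]
    rintro _ e he rfl g hg
    refine (isHom_inr_glueHead Q R x).turn (hc.2.2 e he (R.head, UL) (by simp)) ?_
    exact .cross (f := ((Sum.inl x : Q.Cell ⊕ R.Cell), LR)) glued_glueHead.symm hg
  · rintro ⟨c, s⟩
    refine free_glueHead_inl.trans ?_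
    simp only [List.mem_singleton, Prod.mk.injEq, not_and']
    rfl
  · intro e he y hy
    obtain ⟨z, -, rfl⟩ := List.mem_map.1 he
    exact nomatch congrArg Prod.fst hy
  · rintro ⟨c | c, s⟩ hc
    · exact absurd rfl (hc (c, s))
    · exact (hfree (c, s)).symm.trans (List.mem_map_of_injective hinj (a := (c, s))).symm

/-! ### Adding a strip -/

theorem carrier_inl {P : GluedCells} {l : List P.Edge} {c : P.Cell} {e : P.Edge} :
    Carrier P l (.inl c) e ↔ e = (c, LR) :=
  ⟨by rintro ⟨⟩; rfl, by rintro rfl; exact .old c⟩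

theorem carrier_inr {P : GluedCells} {l : List P.Edge} {d : {c : P.Cell // (c, LL) ∈ l}}
    {e : P.Edge} : Carrier P l (.inr d) e ↔ e = (d.1, LL) :=
  ⟨by rintro ⟨⟩; rfl, by rintro rfl; exact .new d⟩

theorem carrier_inr_congr {P : GluedCells} {l l' : List P.Edge} {d : {c : P.Cell // (c, LL) ∈ l}}
    {d' : {c : P.Cell // (c, LL) ∈ l'}} {e : P.Edge} (h : d.1 = d'.1) :
    Carrier P l (.inr d) e ↔ Carrier P l' (.inr d') e := by
  rw [carrier_inr, carrier_inr, h]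

theorem Carrier.unique {P : GluedCells} {l : List P.Edge}
    {x y : P.Cell ⊕ {c : P.Cell // (c, LL) ∈ l}} {e : P.Edge} (hx : Carrier P l x e)
    (hy : Carrier P l y e) : x = y := by
  rcases x with x | x <;> rcases y with y | y <;>
    simp only [carrier_inl, carrier_inr] at hx hy <;> subst hx <;>
    simp only [Prod.mk.injEq, reduceCtorEq, and_true, and_false] at hy
  · rw [hy]
  · rw [Subtype.ext hy]

theorem pair_infix_concat {α : Type*} {a b c : α} {l : List α} :
    [a, b] <:+: l ++ [c] ↔ [a, b] <:+: l ∨ l.getLast? = some a ∧ b = c := by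
  constructor
  · rintro ⟨s, t, h⟩
    rcases List.eq_nil_or_concat' t with rfl | ⟨t, d, rfl⟩
    · right
      rw [List.append_nil, show s ++ [a, b] = (s ++ [a]) ++ [b] by simp] at h
      obtain ⟨rfl, h⟩ := List.append_inj' h rfl
      simpa using h
    · left
      rw [← List.append_assoc] at h
      exact ⟨s, t, (List.append_inj' h rfl).1⟩
  · rintro (⟨s, t, rfl⟩ | ⟨h, rfl⟩)
    · exact ⟨s, t ++ [c], by simp⟩
    · obtain ⟨l, rfl⟩ := List.getLast?_eq_some_iff.1 h
      exact ⟨l, [], by simp⟩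

theorem mem_of_pair_infix {α : Type*} {a b : α} {l : List α} (h : [a, b] <:+: l) : b ∈ l :=
  h.subset (by simp)

theorem mem_of_pair_infix_left {α : Type*} {a b : α} {l : List α} (h : [a, b] <:+: l) : a ∈ l :=
  h.subset (by simp)

theorem iso_strip_single (P : GluedCells) (h : (P.head, LL) ∈ [(P.head, LL)]) :
    ∃ e, IsIso (P.underAttach none (fun _ => False) P.head) (P.strip [(P.head, LL)] h) e ∧
      (∀ a, e (some a) = .inl a) ∧ e none = .inr ⟨P.head, h⟩ := by
  have hd : ∀ d : {c : P.Cell // (c, LL) ∈ [(P.head, LL)]}, d = ⟨P.head, h⟩ := by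
    rintro ⟨c, hc⟩
    simpa using hc
  have hl : ∀ e f, ¬ [e, f] <:+: [(P.head, LL)] := fun e f h' => by
    have := h'.length_le
    simp at this
  refine ⟨⟨fun z => z.elim (.inr ⟨P.head, h⟩) .inl, Sum.elim some (fun _ => none), ?_, ?_⟩,
    ⟨rfl, ?_, ?_⟩, fun _ => rfl, rfl⟩
  · rintro (_ | a) <;> rfl
  · rintro (a | d)
    · rfl
    · rw [hd d]; rfl
  · rintro (_ | a) (_ | b)
    · exact Iff.rfl
    · exact eq_comm
    · exact Iff.rfl
    · exact Iff.rfl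
  · rintro (_ | a) (_ | b)
    · exact iff_of_false id (fun ⟨e, _, he⟩ => hl _ _ he)
    · exact Iff.rfl
    · exact iff_of_false id (fun ⟨e, _, he⟩ => hl _ _ he)
    · exact Iff.rfl

/-- Extending the strip over a lower right edge adds no cell; only the exposed edge changes. -/
theorem iso_strip_concat_lr (P : GluedCells) {F : List P.Edge} (h : (P.head, LL) ∈ F) {c : P.Cell}
    (h' : (P.head, LL) ∈ F ++ [(c, LR)]) :
    ∃ e, IsIso (P.strip F h) (P.strip (F ++ [(c, LR)]) h') e ∧ (∀ a, e (.inl a) = .inl a) ∧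
      e (.inr ⟨P.head, h⟩) = .inr ⟨P.head, h'⟩ := by
  have hm : ∀ a, (a, LL) ∈ F ↔ (a, LL) ∈ F ++ [(c, LR)] := by simp
  have hi : ∀ e a, [e, (a, LL)] <:+: F ++ [(c, LR)] ↔ [e, (a, LL)] <:+: F := by
    intro e a
    rw [pair_infix_concat]
    simp
  refine ⟨Equiv.sumCongr (Equiv.refl _) (Equiv.subtypeEquivRight hm), ⟨rfl, ?_, ?_⟩, fun _ => rfl,
    rfl⟩
  · rintro (a | d) (b | d')
    · exact Iff.rfl
    · exact Iff.rfl
    · exact Iff.rfl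
    · exact Iff.rfl
  · rintro (a | d) (b | d')
    · exact Iff.rfl
    · exact exists_congr fun e => and_congr (carrier_inl.trans carrier_inl.symm) (hi e d').symm
    · exact Iff.rfl
    · exact exists_congr fun e => and_congr (carrier_inr_congr rfl) (hi e d').symm

/-- Extending the strip over a lower left edge adds one cell from below, glued also to the edge
exposed so far. -/
theorem iso_strip_concat_ll (P : GluedCells) {F : List P.Edge} (h : (P.head, LL) ∈ F) {c : P.Cell}
    (hc : (c, LL) ∉ F) (h' : (P.head, LL) ∈ F ++ [(c, LL)]) {x : (P.strip F h).Cell} {g : P.Edge}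
    (hg : F.getLast? = some g) (hx : Carrier P F x g) :
    ∃ e, IsIso ((P.strip F h).underAttach (some (P.strip F h).head) (fun z => z = x) (.inl c))
      (P.strip (F ++ [(c, LL)]) h') e ∧ (∀ a, e (some (.inl a)) = .inl a) ∧
      e none = .inr ⟨c, by simp⟩ ∧ e (some (.inr ⟨P.head, h⟩)) = .inr ⟨P.head, h'⟩ := by
  classical
  have hm : ∀ {a}, (a, LL) ∈ F → (a, LL) ∈ F ++ [(c, LL)] := fun h => by simp [h]
  have hm' : ∀ {a}, (a, LL) ∈ F ++ [(c, LL)] → (a, LL) ∉ F → a = c := fun h h' => by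
    simpa [h'] using h
  have hi : ∀ {e a}, (a, LL) ∈ F → ([e, (a, LL)] <:+: F ++ [(c, LL)] ↔ [e, (a, LL)] <:+: F) := by
    intro e a ha
    rw [pair_infix_concat, or_iff_left]
    rintro ⟨-, he⟩
    exact hc (he ▸ ha)
  have hi' : ∀ {e}, [e, (c, LL)] <:+: F ++ [(c, LL)] ↔ e = g := by
    intro e
    rw [pair_infix_concat, hg]
    constructor
    · rintro (he | he)
      · exact absurd (mem_of_pair_infix he) hc
      · exact (Option.some_injective _ he.1).symm
    · rintro rfl
      exact Or.inr ⟨rfl, rfl⟩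
  have hgF : g ∈ F := List.mem_of_getLast? hg
  refine ⟨⟨fun z => z.elim (.inr ⟨c, by simp⟩) (Sum.map id fun d => ⟨d.1, hm d.2⟩),
    Sum.elim (fun a => some (.inl a)) (fun d => if hd : (d.1, LL) ∈ F then
      some (.inr ⟨d.1, hd⟩) else none), ?_, ?_⟩, ⟨rfl, ?_, ?_⟩, fun _ => rfl, rfl, rfl⟩
  · rintro (_ | a | d)
    · exact dif_neg hc
    · rfl
    · exact dif_pos d.2
  · rintro (a | d)
    · rfl
    · by_cases hd : (d.1, LL) ∈ F
      · simp [hd]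
      · simp [hd, ← hm' d.2 hd]
  · rintro (_ | a | d) (_ | b | d')
    all_goals first | exact Iff.rfl | skip
    · exact ⟨fun h => (Sum.inl_injective h).symm, fun h => congrArg _ (Eq.symm h)⟩
    · exact iff_of_false (fun h => nomatch h) id
  · rintro (_ | a | d) (_ | b | d')
    all_goals first | exact Iff.rfl | skip
    · refine iff_of_false id ?_
      rintro ⟨e, he, he'⟩
      rw [carrier_inr.1 he, hi'] at he'
      exact hc (he' ▸ hgF)
    · refine iff_of_false id ?_
      rintro ⟨e, he, he'⟩
      rw [carrier_inr.1 he, hi d'.2] at he'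
      exact hc (mem_of_pair_infix_left he')
    · constructor
      · rintro rfl
        exact ⟨g, carrier_inl.2 (carrier_inl.1 hx), hi'.2 rfl⟩
      · rintro ⟨e, he, he'⟩
        obtain rfl := hi'.1 he'
        exact Carrier.unique (carrier_inl.2 (carrier_inl.1 he)) hx
    · exact exists_congr fun e => and_congr (carrier_inl.trans carrier_inl.symm) (hi d'.2).symm
    · constructor
      · rintro rfl
        exact ⟨g, (carrier_inr_congr (d := d) (d' := ⟨d.1, hm d.2⟩) rfl).1 hx, hi'.2 rfl⟩
      · rintro ⟨e, he, he'⟩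
        obtain rfl := hi'.1 he'
        exact Carrier.unique ((carrier_inr_congr (d := d) (d' := ⟨d.1, hm d.2⟩) rfl).2 he) hx
    · exact exists_congr fun e => and_congr (carrier_inr_congr rfl) (hi d'.2).symm

/-- Edge by edge along `F`. The boundary keeps the letters of `F`, then has the exposed `LR`, then
the rest of the old boundary, and finally the `UL` of the new head. -/
theorem strip_spec {P : GluedCells} (hP : P.IsFish) (F : List P.Edge) : ∀ {r : List P.Edge},
    P.IsBoundary (F ++ r) → F ≠ [] → IsLower (F.map Prod.snd) → ∀ h : (P.head, LL) ∈ F,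
    (P.strip F h).IsFish ∧ ∃ (B : List (P.strip F h).Edge) (x : (P.strip F h).Cell),
      (∃ g ∈ F.getLast?, Carrier P F x g) ∧ B.map Prod.snd = F.map Prod.snd ∧
      (P.strip F h).IsBoundary
        (B ++ (x, LR) :: (r.map (edgeMap .inl) ++ [(.inr ⟨P.head, h⟩, UL)])) := by
  induction F using List.reverseRecOn with
  | nil => intro r _ h; exact absurd rfl h
  | append_singleton F g ih =>
    intro r hb _ hlow h
    rw [List.append_assoc, List.singleton_append] at hb
    rcases eq_or_ne F [] with rfl | hF
    · have hg := hb.head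
      rw [List.nil_append, List.head?_cons, Option.some.injEq] at hg
      subst hg
      obtain ⟨e, he, he1, he2⟩ := iso_strip_single P h
      refine ⟨hP.precede.rename ⟨e, he.1, he.2, he.3⟩, [(.inr ⟨P.head, h⟩, LL)],
        .inr ⟨P.head, h⟩, ⟨_, rfl, carrier_inr.2 rfl⟩, rfl, ?_⟩
      have := he.isBoundary (IsBoundary.precede hb)
      change (P.strip [(P.head, LL)] h).IsBoundary _
      convert this using 1
      simp [he1, he2]
    · have hhead : (P.head, LL) ∈ F := by
        have := hb.head
        rw [List.head?_append_of_ne_nil _ hF] at this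
        exact List.mem_of_mem_head? this
      rw [List.map_append, isLower_append] at hlow
      obtain ⟨hf, B, x, ⟨g', hg', hx⟩, hB, hbS⟩ := ih hb hF hlow.1 hhead
      obtain ⟨c, s⟩ := g
      have hs : s = LL ∨ s = LR := hlow.2 s (by simp)
      rcases hs with rfl | rfl
      · have hc : (c, LL) ∉ F := by
          have := hb.nodup
          rw [List.nodup_append] at this
          exact fun hc => this.2.2 _ hc _ (by simp) rfl
        obtain ⟨e, he, he1, he2, he3⟩ := iso_strip_concat_ll P hhead hc h hg' hx
        rw [List.map_cons, List.cons_append] at hbS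
        have hxf : (P.strip F hhead).Free (x, LR) := (hbS.mem _).1 (by simp)
        have hcf : (P.strip F hhead).Free (.inl c, LL) := (hbS.mem _).1 (by simp)
        have hch := hbS.chain
        rw [List.isChain_append, List.isChain_cons_cons] at hch
        -- The exposed `LR` is followed by the next lower left edge of the fin, so there is a dent,
        -- which the new cell fills.
        obtain ⟨b, hxb, hbc⟩ := hf.coherent.exists_of_boundaryNext hxf hch.2.1.1
        refine ⟨(hf.underAttach hxb hbc hxf hcf).rename ⟨e, he.1, he.2, he.3⟩,
          (B.map (edgeMap some)).map (edgeMap e) ++ [(.inr ⟨c, by simp⟩, LL)], .inr ⟨c, by simp⟩,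
          ⟨(c, LL), by simp, carrier_inr.2 rfl⟩, ?_, ?_⟩
        · rw [List.map_append, List.map_append, map_snd_edgeMap, map_snd_edgeMap, hB]
          rfl
        · have := he.isBoundary (IsBoundary.underAttach hbS)
          convert this using 1
          simp [he1, he2, he3]
      -- The edge exposed before becomes an ordinary letter of `B`, and the lower right edge of `c`
      -- is exposed instead.
      · obtain ⟨e, he, he1, he2⟩ := iso_strip_concat_lr P hhead h
        refine ⟨hf.rename ⟨e, he.1, he.2, he.3⟩, B.map (edgeMap e) ++ [(e x, LR)], .inl c,
          ⟨(c, LR), by simp, carrier_inl.2 rfl⟩, ?_, ?_⟩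
        · rw [List.map_append, List.map_append, map_snd_edgeMap, hB]
          rfl
        · have := he.isBoundary hbS
          convert this using 1
          simp [he1, he2]

end GluedCells

/-! ### Composing words -/

/-- The length of the part of a word before its first upper right edge. -/
def finLength (w : List Side) : ℕ := (w.takeWhile (fun s => decide (s ≠ UR))).length

/-- The number of lower right edges that are followed by an upper right edge. -/
def tails : List Side → ℕ
  | [] => 0
  | s :: w => (if s = LR ∧ w.head? = some UR then 1 else 0) + tails w

/-- The factor contributed by the first argument of a composition. -/
def insertion (w : List Side) : List Side := if w = [LL, UR] then [LR] else w.dropLast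

/-- The composition of the words of two fish. -/
def waist (w₁ w₂ : List Side) (i : ℕ) : List Side :=
  w₂.take (finLength w₂ - i) ++ (insertion w₁ ++ (w₂.drop (finLength w₂ - i) ++ [UL]))

theorem finLength_lower_append {f t : List Side} (hf : IsLower f) :
    finLength (f ++ t) = f.length + finLength t := by
  unfold finLength
  rw [List.takeWhile_append_of_pos, List.length_append]
  intro s hs
  rcases hf s hs with rfl | rfl <;> rfl

theorem finLength_append_of_mem {v t : List Side} (hv : UR ∈ v) :
    finLength (v ++ t) = finLength v := by
  induction v with
  | nil => simp at hv
  | cons s v ih =>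
    by_cases hs : s = UR
    · subst hs; rfl
    · have := ih (by simpa [Ne.symm hs] using hv)
      simp [finLength, hs] at this ⊢
      exact this

@[simp] theorem finLength_ur (t : List Side) : finLength (UR :: t) = 0 := rfl

theorem finLength_eq_zero {t : List Side} (ht : t ≠ []) : finLength t = 0 ↔ t.head? = some UR := by
  cases t with
  | nil => exact absurd rfl ht
  | cons s t => cases s <;> simp [finLength]

theorem tails_append (u v : List Side) : tails (u ++ v) = tails u + tails v +
    if u.getLast? = some LR ∧ v.head? = some UR then 1 else 0 := by
  induction u with
  | nil => simp [tails]
  | cons s u ih =>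
    cases u with
    | nil => simp [tails]; omega
    | cons r u =>
      have key : ∀ w, tails (s :: r :: w) = (if s = LR ∧ r = UR then 1 else 0) + tails (r :: w) := by
        intro w
        rw [tails]
        simp
      rw [List.cons_append, List.cons_append, key, key, ← List.cons_append, ih,
        List.getLast?_cons_cons]
      omega

theorem IsLower.tails {f : List Side} (hf : IsLower f) : tails f = 0 := by
  induction f with
  | nil => rfl
  | cons s f ih =>
    rw [isLower_cons] at hf
    rw [_root_.tails, ih hf.2, if_neg]
    rintro ⟨-, h⟩
    rcases hf.2 UR (List.mem_of_mem_head? h) with h | h <;> cases h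

namespace IsFishWord

variable {w₁ w₂ : List Side} {i : ℕ}

theorem finLength_le {f t : List Side} (h : IsFishWord (f ++ t)) (hf : IsLower f) :
    finLength (f ++ t) = f.length + finLength t ∧ t ≠ [] :=
  ⟨finLength_lower_append hf, (h.head_of_lower hf).1⟩

theorem exists_split (h : IsFishWord w₂) (hi : i < finLength w₂) :
    ∃ f t, w₂ = f ++ t ∧ f ≠ [] ∧ IsLower f ∧ f.length = finLength w₂ - i ∧ finLength t = i ∧
      t ≠ [] := by
  obtain ⟨g, z, rfl, hg⟩ := h.exists_fin
  rw [finLength_lower_append hg, finLength_ur, add_zero] at hi ⊢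
  have hl : IsLower (g.take (g.length - i)) := fun s hs => hg s (List.mem_of_mem_take hs)
  have hl' : IsLower (g.drop (g.length - i)) := fun s hs => hg s (List.mem_of_mem_drop hs)
  refine ⟨g.take (g.length - i), g.drop (g.length - i) ++ UR :: z, ?_, ?_, hl, ?_, ?_, by simp⟩
  · rw [← List.append_assoc, List.take_append_drop]
  · rw [← List.length_pos_iff, List.length_take]
    omega
  · rw [List.length_take]
    omega
  · rw [finLength_lower_append hl', List.length_drop, finLength_ur]
    omega

theorem insertion_append (h : IsFishWord w₁) (hne : w₁ ≠ [LL, UR]) :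
    insertion w₁ ++ [UL] = w₁ := by
  obtain ⟨v, rfl⟩ := h.exists_append_ul hne
  rw [insertion, if_neg hne]
  simp

theorem isPiece_insertion {t : List Side} (h : IsFishWord w₁)
    (ht : w₁ = [LL, UR] → t.head? = some UR) : IsPiece (insertion w₁) t := by
  by_cases hne : w₁ = [LL, UR]
  · exact Or.inl ⟨if_pos hne, ht hne⟩
  · exact Or.inr (by rwa [h.insertion_append hne])

/-- The factor of a nonempty fish begins with `LL`, so it never equals the `LR` contributed by the
empty fish. -/
theorem insertion_injective (h₁ : IsFishWord w₁) (h₂ : IsFishWord w₂)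
    (h : insertion w₁ = insertion w₂) : w₁ = w₂ := by
  have key : ∀ {w}, IsFishWord w → w ≠ [LL, UR] → insertion w ≠ [LR] := by
    intro w hw hne h
    have h' := hw.insertion_append hne
    obtain ⟨u, rfl⟩ := hw.start
    rw [h] at h'
    simp at h'
  by_cases hne₁ : w₁ = [LL, UR]
  · by_cases hne₂ : w₂ = [LL, UR]
    · rw [hne₁, hne₂]
    · exact absurd (h.symm.trans (if_pos hne₁)) (key h₂ hne₂)
  · by_cases hne₂ : w₂ = [LL, UR]
    · exact absurd (h.trans (if_pos hne₂)) (key h₁ hne₁)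
    · rw [← h₁.insertion_append hne₁, ← h₂.insertion_append hne₂, h]

end IsFishWord

theorem waist_eq {w₁ f t : List Side} {i : ℕ}
    (hl : f.length = finLength (f ++ t) - i) :
    waist w₁ (f ++ t) i = f ++ (insertion w₁ ++ (t ++ [UL])) := by
  rw [waist, ← hl, List.take_left, List.drop_left]

theorem waist_ne_empty (w₁ w₂ : List Side) (i : ℕ) : waist w₁ w₂ i ≠ [LL, UR] := by
  intro h
  have := congrArg List.getLast? h
  rw [waist, ← List.append_assoc, ← List.append_assoc, List.getLast?_concat] at this
  simp at this

namespace IsFishWord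

variable {w₁ w₂ : List Side} {i : ℕ}

/-- The arguments of a composition are determined by the result. -/
theorem waist_injective {w₁' w₂' : List Side} {i' : ℕ} (h₁ : IsFishWord w₁) (h₂ : IsFishWord w₂)
    (hi : i < finLength w₂) (h0 : w₁ = [LL, UR] → i = 0) (h₁' : IsFishWord w₁')
    (h₂' : IsFishWord w₂') (hi' : i' < finLength w₂') (h0' : w₁' = [LL, UR] → i' = 0)
    (heq : waist w₁ w₂ i = waist w₁' w₂' i') : w₁ = w₁' ∧ w₂ = w₂' ∧ i = i' := by
  obtain ⟨f, t, rfl, hf0, hf, hl, ht, htne⟩ := h₂.exists_split hi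
  obtain ⟨f', t', rfl, hf0', hf', hl', ht', htne'⟩ := h₂'.exists_split hi'
  rw [waist_eq hl, waist_eq hl'] at heq
  obtain ⟨rfl, hv, rfl⟩ := decomposition_unique hf0 hf hf0' hf'
    (h₁.isPiece_insertion fun h => (finLength_eq_zero htne).1 (ht.trans (h0 h)))
    (h₁'.isPiece_insertion fun h => (finLength_eq_zero htne').1 (ht'.trans (h0' h))) h₂ h₂' heq
  exact ⟨insertion_injective h₁ h₁' hv, rfl, ht.symm.trans ht'⟩

/-- Every word of a fish is a composition. -/
theorem exists_waist {w : List Side} (h : IsFishWord w) (hne : w ≠ [LL, UR]) :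
    ∃ w₁ w₂ i, IsFishWord w₁ ∧ IsFishWord w₂ ∧ i < finLength w₂ ∧ (w₁ = [LL, UR] → i = 0) ∧
      w₁.length < w.length ∧ w₂.length < w.length ∧ w = waist w₁ w₂ i := by
  obtain ⟨f, v, t, rfl, hf0, hf, hv, h₂⟩ := h.exists_decomposition hne
  have hfl := h₂.finLength_le hf
  have hpos := List.length_pos_iff.2 hf0
  have htpos := List.length_pos_iff.2 hfl.2
  rcases hv with ⟨rfl, ht⟩ | hv
  · have ht0 := (finLength_eq_zero hfl.2).2 ht
    refine ⟨[LL, UR], f ++ t, 0, .empty, h₂, by omega, fun _ => rfl, ?_, ?_, ?_⟩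
    · simp; omega
    · simp
    · rw [waist_eq (by omega)]; rfl
  · have hne' : v ++ [UL] ≠ [LL, UR] := fun h => by
      have := congrArg List.getLast? h
      simp at this
    refine ⟨v ++ [UL], f ++ t, finLength t, hv, h₂, by omega, fun h => absurd h hne', ?_, ?_, ?_⟩
    · simp; omega
    · simp; omega
    · rw [waist_eq (by omega), insertion, if_neg hne', List.dropLast_concat]

/-- The new fin is `f` followed by the fin of `w₁`. For the empty fish, `LR` adds one letter, in
agreement with `finLength [LL, UR] = 1`, since then `t` begins with `UR`. -/
theorem finLength_waist (h₁ : IsFishWord w₁) (h₂ : IsFishWord w₂)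
    (hi : i < finLength w₂) (h0 : w₁ = [LL, UR] → i = 0) :
    finLength (waist w₁ w₂ i) + i = finLength w₁ + finLength w₂ := by
  obtain ⟨f, t, rfl, hf0, hf, hl, ht, htne⟩ := h₂.exists_split hi
  rw [waist_eq hl, finLength_lower_append hf]
  by_cases hne : w₁ = [LL, UR]
  · obtain ⟨t, rfl⟩ : ∃ t', t = UR :: t' := by
      have := (finLength_eq_zero htne).1 (ht.trans (h0 hne))
      cases t with
      | nil => simp at this
      | cons s t => simp at this; exact ⟨t, by rw [this]⟩
    rw [insertion, if_pos hne, hne, finLength_lower_append (by simp [IsLower]), List.cons_append,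
      finLength_ur, show finLength [LL, UR] = 1 from rfl]
    simp
    omega
  · have hur : UR ∈ insertion w₁ := by
      have h' := h₁.insertion_append hne
      obtain ⟨g, z, rfl, hg⟩ := h₁.exists_fin
      have : UR ∈ insertion (g ++ UR :: z) ++ [UL] := by rw [h']; simp
      simpa using this
    rw [finLength_append_of_mem hur]
    have : finLength w₁ = finLength (insertion w₁) := by
      conv_lhs => rw [← h₁.insertion_append hne]
      exact finLength_append_of_mem hur
    omega

theorem count_insertion {s : Side} (hs : s ≠ UL) (h₁ : IsFishWord w₁) :
    (insertion w₁).count s = if w₁ = [LL, UR] then [LR].count s else w₁.count s := by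
  split_ifs with hne
  · rw [insertion, if_pos hne]
  · conv_rhs => rw [← h₁.insertion_append hne]
    rw [List.count_append]
    simp [Ne.symm hs]

theorem count_waist {s : Side} (hs : s ≠ UL) (h₁ : IsFishWord w₁) : (waist w₁ w₂ i).count s =
    (if w₁ = [LL, UR] then [LR].count s else w₁.count s) + w₂.count s := by
  rw [waist, List.count_append, List.count_append, List.count_append, count_insertion hs h₁]
  conv_rhs => rw [← List.take_append_drop (finLength w₂ - i) w₂, List.count_append]
  simp [Ne.symm hs]
  omega

/-- Only the seams matter. For `i = 0` the factor `LR UR` at the end of the fin of `w₂` is broken,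
unless `w₂` is the empty word, which has none. The inserted factor creates a tail at a seam only
when it is the single `LR`: otherwise it begins with `LL` and cannot end with `LR`, as `LR UL` would
be balanced. -/
theorem tails_waist (h₁ : IsFishWord w₁) (h₂ : IsFishWord w₂)
    (hi : i < finLength w₂) (h0 : w₁ = [LL, UR] → i = 0) :
    tails (waist w₁ w₂ i) + (if i = 0 ∧ w₂ ≠ [LL, UR] then 1 else 0) =
      (if w₁ = [LL, UR] then 1 else tails w₁) + tails w₂ := by
  obtain ⟨f, t, rfl, hf0, hf, hl, ht, htne⟩ := h₂.exists_split hi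
  rw [waist_eq hl, tails_append, tails_append, tails_append, tails_append, hf.tails]
  have hur : t.head? = some UR ↔ i = 0 := by rw [← finLength_eq_zero htne, ht]
  have e1 : ¬ (f.getLast? = some LR ∧ (insertion w₁ ++ (t ++ [UL])).head? = some UR) := by
    rintro ⟨-, h⟩
    by_cases hne : w₁ = [LL, UR]
    · rw [insertion, if_pos hne] at h; simp at h
    · have h' := h₁.insertion_append hne
      obtain ⟨u, rfl⟩ := h₁.start
      cases hv : insertion (LL :: u) with
      | nil => rw [hv] at h'; simp at h'
      | cons s v => rw [hv] at h h'; simp at h h'; rw [h] at h'; simp at h'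
  have e2 : (t ++ [UL]).head? = t.head? := by cases t with
    | nil => exact absurd rfl htne
    | cons s t => rfl
  have e3 : (f.getLast? = some LR ∧ t.head? = some UR) ↔ (i = 0 ∧ f ++ t ≠ [LL, UR]) := by
    rw [hur, and_comm]
    refine and_congr_right fun hi => ?_
    rw [← hur] at hi
    obtain ⟨t, rfl⟩ : ∃ t', t = UR :: t' := by
      cases t with
      | nil => simp at hi
      | cons s t => simp at hi; exact ⟨t, by rw [hi]⟩
    obtain ⟨g, s, rfl⟩ := List.eq_nil_or_concat' f |>.resolve_left hf0
    rw [List.getLast?_concat]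
    rcases (isLower_append.1 hf).2 s (by simp) with rfl | rfl
    · have := h₂.conn g [LL, UR] t (by simp) (by simp) (by simp [IsBalanced])
      simp [this.1, this.2]
    · refine iff_of_true rfl fun h => ?_
      have h' : (g ++ [LR]) ++ UR :: t = [LL] ++ [UR] := h
      have hlen := congrArg List.length h'
      simp only [List.length_append, List.length_cons, List.length_nil] at hlen
      have := (List.append_inj h' (by
        simp only [List.length_append, List.length_cons, List.length_nil]; omega)).1
      simp [List.append_eq_singleton_iff] at this
  simp only [e1, e2, e3, if_false, List.head?_cons]
  by_cases hne : w₁ = [LL, UR]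
  · have hi0 := h0 hne
    rw [insertion, if_pos hne, if_pos hne]
    simp [tails, hur, hi0]
    omega
  · have h' := h₁.insertion_append hne
    have e4 : (insertion w₁).getLast? ≠ some LR := by
      intro h
      obtain ⟨v, hv⟩ := List.getLast?_eq_some_iff.1 h
      rw [hv] at h'
      have := (h₁.conn v [LR, UL] [] (by rw [← h']; simp) (by simp) (by simp [IsBalanced])).1
      obtain ⟨u, rfl⟩ := h₁.start
      simp [this] at h'
    have e5 : tails w₁ = tails (insertion w₁) := by
      conv_lhs => rw [← h', tails_append]
      simp [tails]
    rw [if_neg hne, e5]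
    simp [e4, tails]
    omega

end IsFishWord

namespace GluedCells

/-! ### Reading statistics off the boundary word -/

theorem IsBoundary.freeCount {P : GluedCells} {l : List P.Edge} (hl : P.IsBoundary l) (s : Side) :
    P.freeCount s = (l.map Prod.snd).count s := by
  classical
  have h1 : {c : P.Cell | P.Free (c, s)} =
      ((l.filter (fun e => e.2 = s)).map Prod.fst).toFinset := by
    ext c
    simp [hl.mem]
  rw [GluedCells.freeCount, h1, Set.ncard_coe_finset, List.toFinset_card_of_nodup,
    List.length_map, List.count, List.countP_map, List.countP_eq_length_filter]
  · congr 1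
  · refine (hl.nodup.filter _).map_on ?_
    rintro ⟨a, s₁⟩ h₁ ⟨b, s₂⟩ h₂ rfl
    simp at h₁ h₂
    rw [h₁.2, h₂.2]

theorem IsBoundary.lowerFreeCount {P : GluedCells} {l : List P.Edge} (hl : P.IsBoundary l) :
    P.lowerFreeCount = (l.map Prod.snd).count LL + (l.map Prod.snd).count LR := by
  rw [← hl.freeCount, ← hl.freeCount, GluedCells.lowerFreeCount, GluedCells.freeCount,
    GluedCells.freeCount]
  have := P.finite
  rw [← Set.ncard_image_of_injective {c : P.Cell | P.Free (c, LL)} (Prod.mk_left_injective LL),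
    ← Set.ncard_image_of_injective {c : P.Cell | P.Free (c, LR)} (Prod.mk_left_injective LR),
    ← Set.ncard_union_eq ?_ (Set.toFinite _) (Set.toFinite _)]
  · congr 1
    ext ⟨c, s⟩
    cases s <;> simp
  · rw [Set.disjoint_left]
    rintro _ ⟨a, -, rfl⟩ ⟨b, -, hb⟩
    simp at hb

/-- The successor on the boundary. -/
theorem Coherent.chain_next {P : GluedCells} (hP : P.Coherent) {e g g' : P.Edge}
    {l₁ l₂ : List P.Edge} (hl : (l₁ ++ e :: g :: l₂).IsChain P.BoundaryNext)
    (h : P.BoundaryNext e g') : g = g' := by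
  rw [List.isChain_append, List.isChain_cons_cons] at hl
  exact hP.turn hl.2.1.1 h

/-- After `(c, LR)` the boundary continues with `(c, UR)` when this edge is free, and an `UR`
following `(c, LR)` always belongs to `c`. So tails correspond to factors `LR UR`. -/
theorem ncard_tails {P : GluedCells} (hP : P.Coherent) : ∀ {l : List P.Edge},
    l.IsChain P.BoundaryNext → l.Nodup → (∀ e ∈ l, P.Free e) → (∀ e ∈ l.getLast?, e.2 ≠ LR) →
    {c : P.Cell | P.Free (c, UR) ∧ (c, LR) ∈ l}.ncard = tails (l.map Prod.snd)
  | [], _, _, _, _ => by simp [tails]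
  | [(c, s)], _, _, _, h => by
    have hs : s ≠ LR := h (c, s) (by simp)
    simp [tails, Ne.symm hs]
  | (c, s) :: (y, s') :: l, hc, hn, hf, hlast => by
    have hfin := P.finite
    have ih := ncard_tails hP (List.isChain_cons_cons.1 hc).2 (List.nodup_cons.1 hn).2
      (fun e he => hf e (List.mem_cons_of_mem _ he)) (by simpa using hlast)
    have key : tails (((c, s) :: (y, s') :: l).map Prod.snd) =
        (if s = LR ∧ s' = UR then 1 else 0) + tails (((y, s') :: l).map Prod.snd) := by
      rw [List.map_cons, tails]
      simp
    rw [key, ← ih]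
    by_cases hs : s = LR
    · subst hs
      by_cases hs' : s' = UR
      · subst hs'
        obtain rfl := hP.eq_of_boundaryNext (hf (c, LR) (by simp)) (List.isChain_cons_cons.1 hc).1
        have hu : {x : P.Cell | P.Free (x, UR) ∧ (x, LR) ∈ (c, LR) :: (c, UR) :: l} =
            insert c {x : P.Cell | P.Free (x, UR) ∧ (x, LR) ∈ (c, UR) :: l} := by
          ext x
          simp only [Set.mem_ofPred_eq, List.mem_cons, Prod.mk.injEq, Set.mem_insert_iff]
          have := hf (c, UR) (by simp)
          constructor
          · rintro ⟨h1, ⟨h2, -⟩ | h2⟩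
            · exact Or.inl h2
            · exact Or.inr ⟨h1, h2⟩
          · rintro (rfl | h)
            · exact ⟨this, Or.inl ⟨rfl, trivial⟩⟩
            · exact ⟨h.1, Or.inr h.2⟩
        rw [hu, Set.ncard_insert_of_notMem]
        · simp [add_comm]
        · exact fun h => (List.nodup_cons.1 hn).1 h.2
      · have : ¬ P.Free (c, UR) := fun hfree => by
          have := hP.chain_next (l₁ := []) hc (.here hfree)
          exact hs' (congrArg Prod.snd this)
        simp only [hs', and_false, if_false, zero_add]
        congr 1
        ext x
        simp only [Set.mem_ofPred_eq, List.mem_cons, Prod.mk.injEq]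
        constructor
        · rintro ⟨h1, ⟨rfl, -⟩ | h2⟩
          · exact absurd h1 this
          · exact ⟨h1, h2⟩
        · exact fun h => ⟨h.1, Or.inr h.2⟩
    · simp [hs, Ne.symm hs]

theorem IsBoundary.tailCount {P : GluedCells} (hP : P.Coherent) {l : List P.Edge}
    (hl : P.IsBoundary l) : P.tailCount = tails (l.map Prod.snd) := by
  rw [← ncard_tails hP hl.chain hl.nodup (fun e he => (hl.mem e).1 he) (by simp [hl.last])]
  simp only [hl.mem]
  rfl

/-- The fin is the part of the boundary before the first upper right edge. -/
theorem IsBoundary.exists_fin {P : GluedCells} (hP : P.IsFish) {l : List P.Edge}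
    (hl : P.IsBoundary l) : ∃ f t, l = f ++ t ∧ IsLower (f.map Prod.snd) ∧
      f.length = finLength (l.map Prod.snd) ∧ f ≠ [] ∧ ∀ g, P.IsFin g ↔ g = f := by
  have hw := hl.isFishWord hP
  obtain ⟨f', t', hw', hf'⟩ := hw.exists_fin
  obtain ⟨f, t, rfl, rfl, ht⟩ := List.map_eq_append_iff.1 hw'
  obtain ⟨⟨y, s⟩, t, rfl, hs, rfl⟩ := List.map_eq_cons_iff.1 ht
  obtain rfl : s = UR := hs
  have hf0 : f ≠ [] := by
    rintro rfl
    have := hl.head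
    simp at this
  have hhead := hl.head
  rw [List.head?_append_of_ne_nil _ hf0] at hhead
  obtain ⟨f, ⟨x, s⟩, rfl⟩ := List.eq_nil_or_concat' f |>.resolve_left hf0
  obtain rfl : s = LR := by
    rcases hf' s (by simp) with rfl | rfl
    · have := hw.conn (f.map Prod.snd) [LL, UR] (t.map Prod.snd) (by simp) (by simp)
        (by simp [IsBalanced])
      simp at this
      have h1 := hl.last
      simp [this.1, this.2] at h1
    · rfl
  have hchain := hl.chain
  have hxf : P.Free (x, LR) := (hl.mem _).1 (by simp)
  have hyf : P.Free (y, UR) := (hl.mem _).1 (by simp)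
  obtain rfl : x = y := by
    rw [List.append_assoc, List.singleton_append, List.isChain_append, List.isChain_cons_cons]
      at hchain
    exact hP.coherent.eq_of_boundaryNext hxf hchain.2.1.1
  have hfin : P.IsFin (f ++ [(x, LR)]) := by
    refine ⟨hhead, ?_, ⟨(x, LR), by simp, rfl, hxf, hyf⟩, ?_⟩
    · rw [List.isChain_append] at hchain
      exact hchain.1
    · rw [List.dropLast_concat]
      rintro ⟨z, s⟩ he ⟨hs, h1, h2⟩
      obtain rfl : s = LR := hs
      obtain ⟨u, v, rfl⟩ := List.append_of_mem he
      -- A tail before the last fin edge would be followed by its own `UR`, which is not a lower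
      -- letter.
      obtain ⟨g, v', hv⟩ : ∃ g v', v ++ [(x, LR)] = g :: v' := by
        cases v with
        | nil => exact ⟨_, _, rfl⟩
        | cons g v => exact ⟨_, _, rfl⟩
      have hmem : g ∈ v ++ [(x, LR)] := by rw [hv]; simp
      rw [show u ++ (z, LR) :: v ++ [(x, LR)] ++ (x, UR) :: t =
        u ++ (z, LR) :: ((v ++ [(x, LR)]) ++ (x, UR) :: t) by simp, hv] at hchain
      obtain rfl := hP.coherent.chain_next hchain (.here h2 : P.BoundaryNext (z, LR) (z, UR))
      rcases hf' UR (by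
        refine List.mem_map.2 ⟨(z, UR), ?_, rfl⟩
        rw [List.append_assoc, List.cons_append]
        exact List.mem_append_right _ (List.mem_cons_of_mem _ hmem)) with h | h <;> cases h
  refine ⟨f ++ [(x, LR)], _, rfl, hf', ?_, by simp, fun g => ⟨fun hg => ?_, fun hg => hg ▸ hfin⟩⟩
  · rw [List.map_append, finLength_lower_append hf']
    simp
  -- A fin ends at a tail and meets none before, so it is not a proper prefix of another fin.
  have hpre : ∀ {u v : List P.Edge}, P.IsFin u → P.IsFin v → u <+: v → u = v := by
    rintro u v hu hv ⟨r, rfl⟩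
    obtain rfl | ⟨r, e, rfl⟩ := List.eq_nil_or_concat' r
    · simp
    · exfalso
      obtain ⟨e', he', ht⟩ := hu.2.2.1
      refine hv.2.2.2 e' ?_ ht
      rw [← List.append_assoc, List.dropLast_concat]
      exact List.mem_append_left _ (List.mem_of_getLast? he')
  rcases isChain_prefix (R := P.BoundaryNext) (fun _ _ _ h h' => hP.coherent.turn h h') hg.2.1
    hfin.2.1 (by rw [hg.1, hfin.1]) with h | h
  · exact hpre hg hfin h
  · exact (hpre hfin hg h).symm

theorem HasWord.ne_empty {P : GluedCells} {w : List Side} (h : P.HasWord w) : w ≠ [LL, UR] := by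
  rintro rfl
  obtain ⟨-, l, hl, hw⟩ := h
  have := congrArg List.getLast? hw
  rw [List.getLast?_map, hl.last] at this
  simp at this

theorem HasWord.statistics {P : GluedCells} {w : List Side} (h : P.HasWord w) :
    P.lowerFreeCount = w.count LL + w.count LR ∧ P.freeCount LL = w.count LL ∧
      P.freeCount LR = w.count LR ∧ P.HasFinLength (finLength w) ∧ P.tailCount = tails w := by
  obtain ⟨hP, l, hl, rfl⟩ := h
  obtain ⟨f, t, -, -, hf, -, hfin⟩ := hl.exists_fin hP
  exact ⟨hl.lowerFreeCount, hl.freeCount _, hl.freeCount _, ⟨f, (hfin f).2 rfl, hf⟩,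
    hl.tailCount hP.coherent⟩

/-! ### The word of a composition of fish -/

/-- The strip and the edge on which a head can be glued. -/
theorem HasWord.strip {P₂ : GluedCells} {w₂ : List Side} (h₂ : P₂.HasWord w₂) {f : List P₂.Edge}
    (hf : P₂.IsFin f) {i : ℕ} (hi : i < f.length) :
    f.length = finLength w₂ ∧ ∃ h : (P₂.head, LL) ∈ f.take (f.length - i),
      (P₂.strip _ h).IsFish ∧ ∃ (B B' : List (P₂.strip _ h).Edge) (x : (P₂.strip _ h).Cell),
        (∃ g ∈ (f.take (f.length - i)).getLast?, Carrier P₂ _ x g) ∧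
        (P₂.strip _ h).IsBoundary (B ++ (x, LR) :: B') ∧
        B.map Prod.snd = w₂.take (f.length - i) ∧
        B'.map Prod.snd = w₂.drop (f.length - i) ++ [UL] := by
  obtain ⟨hP, l, hl, rfl⟩ := h₂
  obtain ⟨f', t, rfl, hlow, hlen, hf0, hfin⟩ := hl.exists_fin hP
  obtain rfl := (hfin f).1 hf
  have hsplit : f ++ t = f.take (f.length - i) ++ (f.drop (f.length - i) ++ t) := by
    rw [← List.append_assoc, List.take_append_drop]
  have hne : f.take (f.length - i) ≠ [] := by
    rw [← List.length_pos_iff, List.length_take]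
    omega
  have hmem : (P₂.head, LL) ∈ f.take (f.length - i) := by
    have := hl.head
    rw [hsplit, List.head?_append_of_ne_nil _ hne] at this
    exact List.mem_of_mem_head? this
  have hl' := hl
  rw [hsplit] at hl'
  obtain ⟨h1, B, x, hx, hB, hb⟩ := strip_spec hP _ hl' hne (by
    intro s hs
    rw [List.map_take] at hs
    exact hlow s (List.mem_of_mem_take hs)) hmem
  refine ⟨hlen, hmem, h1, B, _, x, hx, hb, ?_, ?_⟩
  · rw [hB, ← List.map_take, List.take_append_of_le_length (by omega)]
  · rw [List.map_append, map_snd_edgeMap, ← List.map_drop, List.drop_append_of_le_length (by omega)]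
    rfl

theorem HasWord.glueHead {Q P₁ : GluedCells} (hQ : Q.IsFish) {B B' : List Q.Edge} {x : Q.Cell}
    (hb : Q.IsBoundary (B ++ (x, LR) :: B')) {w₁ : List Side} (h₁ : P₁.HasWord w₁) :
    (Q.glueHead x P₁).HasWord (B.map Prod.snd ++ (insertion w₁ ++ B'.map Prod.snd)) := by
  have hne := h₁.ne_empty
  obtain ⟨hP, l, hl, rfl⟩ := h₁
  obtain ⟨m, rfl⟩ := List.getLast?_eq_some_iff.1 hl.last
  refine ⟨hQ.glueHead hP ((hb.mem _).1 (by simp)), _, hb.glueHead hl, ?_⟩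
  rw [List.map_append, List.map_append, map_snd_edgeMap, map_snd_edgeMap, map_snd_edgeMap,
    insertion, if_neg hne, List.map_append]
  simp

/-- The exposed edge is determined by the last covered edge, so the word does not depend on the
witness chosen in `IsWaist`. -/
theorem HasWord.of_isWaist {P₁ P₂ Q : GluedCells} {w₁ w₂ : List Side} (h₁ : P₁.HasWord w₁)
    (h₂ : P₂.HasWord w₂) {f : List P₂.Edge} (hf : P₂.IsFin f) {i : ℕ} (hi : i < f.length)
    (hQ : IsWaist P₁ P₂ (f.take (f.length - i)) Q) : Q.HasWord (waist w₁ w₂ i) := by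
  obtain ⟨hlen, h, hs, B, B', x, ⟨g, hg, hx⟩, hb, hB, hB'⟩ := h₂.strip hf hi
  obtain ⟨_, x', ⟨g', hg', hx'⟩, e⟩ := hQ
  obtain rfl : g = g' := Option.some_injective _ (hg.symm.trans hg')
  obtain rfl := hx.unique hx'
  have := (h₁.glueHead hs hb).of_iso e.symm
  rwa [hB, hB', hlen] at this

theorem HasWord.exists_isWaist {P₁ P₂ : GluedCells} {w₂ : List Side}
    (h₂ : P₂.HasWord w₂) {f : List P₂.Edge} (hf : P₂.IsFin f) {i : ℕ} (hi : i < f.length) :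
    ∃ Q, IsWaist P₁ P₂ (f.take (f.length - i)) Q := by
  obtain ⟨hlen, h, hs, B, B', x, hx, hb, hB, hB'⟩ := h₂.strip hf hi
  exact ⟨_, h, x, hx, Iso.refl _⟩

theorem HasWord.exists_isFin {P : GluedCells} {w : List Side} (h : P.HasWord w) :
    ∃ f, P.IsFin f ∧ f.length = finLength w :=
  h.statistics.2.2.2.1

theorem IsFin.length_eq {P : GluedCells} {w : List Side} (h : P.HasWord w) {f : List P.Edge}
    (hf : P.IsFin f) : f.length = finLength w ∧ 0 < f.length := by
  obtain ⟨hP, l, hl, rfl⟩ := h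
  obtain ⟨f', t, -, -, hlen, h0, hfin⟩ := hl.exists_fin hP
  obtain rfl := (hfin f).1 hf
  exact ⟨hlen, List.length_pos_iff.2 h0⟩

theorem HasWord.of_isC2 {P₁ P₂ Q : GluedCells} {w₁ w₂ : List Side} {i : ℕ} (h₁ : P₁.HasWord w₁)
    (h₂ : P₂.HasWord w₂) (hQ : IsC2 P₁ P₂ i Q) : Q.HasWord (waist w₁ w₂ i) := by
  obtain ⟨f, hf, -, hi, hw⟩ := hQ
  exact h₁.of_isWaist h₂ hf hi hw

theorem HasWord.exists_isC2 {P₁ P₂ : GluedCells} {w₂ : List Side} {i : ℕ} (h₂ : P₂.HasWord w₂)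
    (hi : 1 ≤ i) (hi' : i < finLength w₂) : ∃ Q, IsC2 P₁ P₂ i Q := by
  obtain ⟨f, hf, hlen⟩ := h₂.exists_isFin
  obtain ⟨Q, hQ⟩ := h₂.exists_isWaist (P₁ := P₁) hf (hlen ▸ hi')
  exact ⟨Q, f, hf, hi, hlen ▸ hi', hQ⟩

/-- The word of a possibly empty fish. -/
def OptHasWord : Option GluedCells → List Side → Prop
  | none, w => w = [LL, UR]
  | some P, w => P.HasWord w

theorem hasWord_single : single.HasWord [LL, LR, UR, UL] :=
  ⟨.head, _, isBoundary_single, rfl⟩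

/-- The conventions for the empty fish, `LL UR` as its word and `LR` as its insertion, make `waist`
with `i = 0` right in all four cases. -/
theorem OptHasWord.of_isC1 {F₁ F₂ : Option GluedCells} {Q : GluedCells} {w₁ w₂ : List Side}
    (h₁ : OptHasWord F₁ w₁) (h₂ : OptHasWord F₂ w₂) (hQ : IsC1 F₁ F₂ Q) :
    Q.HasWord (waist w₁ w₂ 0) := by
  rcases F₁ with _ | P₁ <;> rcases F₂ with _ | P₂
  · obtain rfl : w₁ = _ := h₁
    obtain rfl : w₂ = _ := h₂
    exact hasWord_single.of_iso (Iso.symm hQ)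
  · obtain rfl : w₁ = _ := h₁
    obtain ⟨f, h, hf, e⟩ := hQ
    have hpos := (IsFin.length_eq h₂ hf).2
    obtain ⟨hlen, h', hs, B, B', x, -, hb, hB, hB'⟩ := HasWord.strip h₂ hf hpos
    have hst : (P₂.strip _ h').HasWord (waist [LL, UR] w₂ 0) :=
      ⟨hs, _, hb, by rw [List.map_append, List.map_cons, hB, hB', waist, ← hlen]; rfl⟩
    refine HasWord.of_iso ?_ (Iso.symm e)
    have hft : f.take (f.length - 0) = f := by simp
    convert hst using 2
    exact hft.symm
  · obtain rfl : w₂ = _ := h₂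
    -- With empty `w₂` the fish is glued to a single cell, and only `LL` precedes the covered edge:
    -- `LL · insertion w₁ · UR · UL`.
    exact HasWord.of_iso (HasWord.glueHead IsFish.head (B := [((), LL)]) isBoundary_single h₁)
      (Iso.symm hQ)
  · obtain ⟨f, hf, hw⟩ := hQ
    have hpos := (IsFin.length_eq h₂ hf).2
    refine HasWord.of_isWaist h₁ h₂ hf hpos ?_
    rwa [Nat.sub_zero, List.take_length]

theorem OptHasWord.exists_isC1 {F₁ F₂ : Option GluedCells} {w₂ : List Side}
    (h₂ : OptHasWord F₂ w₂) : ∃ Q, IsC1 F₁ F₂ Q := by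
  rcases F₁ with _ | P₁ <;> rcases F₂ with _ | P₂
  · exact ⟨_, Iso.refl _⟩
  · obtain ⟨f, hf, -⟩ := HasWord.exists_isFin h₂
    exact ⟨_, f, List.mem_of_mem_head? hf.1, hf, Iso.refl _⟩
  · exact ⟨_, Iso.refl _⟩
  · obtain ⟨f, hf, -⟩ := HasWord.exists_isFin h₂
    have hpos := (IsFin.length_eq h₂ hf).2
    obtain ⟨Q, hQ⟩ := HasWord.exists_isWaist (P₁ := P₁) h₂ hf hpos
    rw [Nat.sub_zero, List.take_length] at hQ
    exact ⟨Q, f, hf, hQ⟩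

end GluedCells

open GluedCells

/-! ### Permutations and words -/

/-- The recursive correspondence between two-stack sortable permutations and the words of fish. -/
inductive HasFishWord : List ℕ → List Side → Prop
  | nil : HasFishWord [] [LL, UR]
  | step {π₁ π₂ : List ℕ} {w₁ w₂ : List Side} {i a : ℕ} : HasFishWord π₁ w₁ → HasFishWord π₂ w₂ →
      (0 :: lrMaxima (stackSort π₂))[i]? = some a → (π₁ = [] → i = 0) →
      HasFishWord (permC2 π₁ π₂ a) (waist w₁ w₂ i)

/-- The properties of corresponding permutations and words. -/
structure WordSpec (π : List ℕ) (w : List Side) : Prop where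
  perm : IsTwoStack π
  word : IsFishWord w
  nil_iff : π = [] ↔ w = [LL, UR]
  fin : finLength w = (lrMaxima (stackSort π)).length + 1
  left : w.count LL = ascents π + 1
  right : w.count LR = if π = [] then 0 else descents π + 1
  tails : tails w = if π = [] then 0 else leftDescents (stackSort π) + 1
  length : π ≠ [] → ascents π + descents π + 1 = π.length

theorem permC2_ne_nil (π₁ π₂ : List ℕ) (a : ℕ) : permC2 π₁ π₂ a ≠ [] := by simp [permC2]

theorem isPermDatum_of_getElem? {π₁ π₂ : List ℕ} {i a : ℕ} (h₁ : IsTwoStack π₁)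
    (h₂ : IsTwoStack π₂) (ha : (0 :: lrMaxima (stackSort π₂))[i]? = some a)
    (h0 : π₁ = [] → i = 0) : IsPermDatum π₁ π₂ a := by
  refine ⟨h₁, h₂, List.mem_of_getElem? ha, fun h => ?_⟩
  rw [h0 h] at ha
  simpa using ha.symm

theorem eq_zero_iff_of_getElem? {π₂ : List ℕ} {i a : ℕ} (h₂ : IsTwoStack π₂)
    (ha : (0 :: lrMaxima (stackSort π₂))[i]? = some a) : i = 0 ↔ a = 0 := by
  constructor
  · rintro rfl
    simpa using ha.symm
  · rintro rfl
    cases i with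
    | zero => rfl
    | succ i =>
      have := (List.pairwise_cons.1 (IsPermDatum.pairwise_values h₂)).1 0 (List.mem_of_getElem? ha)
      omega

/-- The indices of `0 :: lrMaxima` are exactly the admissible cuts of the fin; this is where the two
recursions fit together. -/
theorem WordSpec.lt_finLength {π₂ : List ℕ} {w₂ : List Side} {i a : ℕ} (h₂ : WordSpec π₂ w₂)
    (ha : (0 :: lrMaxima (stackSort π₂))[i]? = some a) : i < finLength w₂ := by
  have := (List.getElem?_eq_some_iff.1 ha).1
  rw [h₂.fin]
  simpa using this

theorem WordSpec.step {π₁ π₂ : List ℕ} {w₁ w₂ : List Side} {i a : ℕ} (h₁ : WordSpec π₁ w₁)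
    (h₂ : WordSpec π₂ w₂) (ha : (0 :: lrMaxima (stackSort π₂))[i]? = some a)
    (h0 : π₁ = [] → i = 0) (hw : IsFishWord (waist w₁ w₂ i)) :
    WordSpec (permC2 π₁ π₂ a) (waist w₁ w₂ i) := by
  have hd := isPermDatum_of_getElem? h₁.perm h₂.perm ha h0
  have hi := h₂.lt_finLength ha
  have h0' : w₁ = [LL, UR] → i = 0 := fun h => h0 (h₁.nil_iff.2 h)
  have hia := eq_zero_iff_of_getElem? h₂.perm ha
  have hne := permC2_ne_nil π₁ π₂ a
  refine ⟨hd.isTwoStack, hw, iff_of_false hne (waist_ne_empty _ _ _), ?_, ?_, ?_, ?_, ?_⟩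
  · have e1 := h₁.word.finLength_waist h₂.word hi h0'
    have e2 := hd.lrMaxima_permC2 ha
    rw [h₁.fin, h₂.fin] at e1
    omega
  · rw [h₁.word.count_waist (by simp), hd.ascents_permC2, h₂.left, h₁.left]
    simp only [← h₁.nil_iff]
    split_ifs with h
    · subst h; simp [ascents]
    · omega
  · rw [h₁.word.count_waist (by simp), hd.descents_permC2, h₂.right, h₁.right, if_neg hne]
    simp only [← h₁.nil_iff]
    split_ifs with h h' h'
    · subst h h'; simp [descents]
    · subst h; simp [descents]; omega
    · subst h'; simp [descents]
    · omega
  · have e1 := h₁.word.tails_waist h₂.word hi h0'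
    rw [h₁.tails, h₂.tails] at e1
    rw [hd.leftDescents_permC2, if_neg hne]
    simp only [ne_eq, ← h₁.nil_iff, ← h₂.nil_iff, hia] at e1
    have hnil : leftDescents (stackSort []) = 0 := by rw [stackSort_nil]; rfl
    by_cases h : π₁ = []
    · have ha0 : a = 0 := hia.1 (h0 h)
      subst h
      by_cases h' : π₂ = []
      · subst h'; simp [ha0, hnil] at e1 ⊢; omega
      · simp [ha0, hnil, h'] at e1 ⊢; omega
    · by_cases h' : π₂ = []
      · have ha0 : a = 0 := by
          subst h'
          have := (List.getElem?_eq_some_iff.1 ha).1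
          rw [stackSort_nil] at this
          simp [lrMaxima] at this
          exact hia.1 this
        subst h'; simp [ha0, hnil, h] at e1 ⊢; omega
      · by_cases ha0 : a = 0
        · simp [ha0, h, h'] at e1 ⊢; omega
        · simp [ha0, h, h'] at e1 ⊢; omega
  · intro _
    rw [hd.ascents_permC2, hd.descents_permC2, length_permC2]
    by_cases h : π₁ = [] <;> by_cases h' : π₂ = []
    · subst h h'; simp [ascents, descents]
    · have := h₂.length h'
      subst h
      rw [if_pos rfl, if_neg h', show ascents [] = 0 from rfl, show descents [] = 0 from rfl,
        List.length_nil]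
      omega
    · have := h₁.length h
      subst h'
      rw [if_neg h, if_pos rfl, show ascents [] = 0 from rfl, show descents [] = 0 from rfl,
        List.length_nil]
      omega
    · have := h₁.length h
      have := h₂.length h'
      simp [h, h']; omega

theorem WordSpec.nil : WordSpec [] [LL, UR] := by
  refine ⟨isTwoStack_nil, .empty, by simp, ?_, ?_, ?_, ?_, fun h => absurd rfl h⟩
  · rw [stackSort_nil]; rfl
  · simp [ascents]
  · simp
  · rfl

namespace HasFishWord

/-- The induction also constructs a fish. Its existence supplies the hypothesis of `WordSpec.step`
that the composed word is a fish word. -/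
theorem spec {π : List ℕ} {w : List Side} (h : HasFishWord π w) :
    WordSpec π w ∧ ∃ F, OptHasWord F w ∧ Corresponds π F := by
  induction h with
  | nil => exact ⟨.nil, none, rfl, .empty⟩
  | @step π₁ π₂ w₁ w₂ i a _ _ ha h0 ih₁ ih₂ =>
    obtain ⟨s₁, F₁, hF₁, c₁⟩ := ih₁
    obtain ⟨s₂, F₂, hF₂, c₂⟩ := ih₂
    have hia := eq_zero_iff_of_getElem? s₂.perm ha
    have key : ∃ Q, Q.HasWord (waist w₁ w₂ i) ∧ Corresponds (permC2 π₁ π₂ a) (some Q) := by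
      by_cases hi : i = 0
      · obtain ⟨Q, hQ⟩ := OptHasWord.exists_isC1 (F₁ := F₁) hF₂
        rw [hia.1 hi, hi, ← permC1_eq_permC2 s₂.perm]
        exact ⟨Q, hF₁.of_isC1 hF₂ hQ, .c1 c₁ c₂ hQ⟩
      · have hi' := s₂.lt_finLength ha
        obtain ⟨P₁, rfl⟩ : ∃ P, F₁ = some P := by
          cases F₁ with
          | none => exact absurd (h0 (s₁.nil_iff.2 hF₁)) hi
          | some P => exact ⟨P, rfl⟩
        obtain ⟨P₂, rfl⟩ : ∃ P, F₂ = some P := by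
          cases F₂ with
          | none =>
            obtain rfl : w₂ = _ := hF₂
            change i < 1 at hi'
            omega
          | some P => exact ⟨P, rfl⟩
        obtain ⟨Q, hQ⟩ := HasWord.exists_isC2 (P₁ := P₁) hF₂ (Nat.one_le_iff_ne_zero.2 hi) hi'
        refine ⟨Q, HasWord.of_isC2 hF₁ hF₂ hQ, .c2 c₁ c₂ (Nat.one_le_iff_ne_zero.2 hi) ?_ hQ⟩
        obtain ⟨i, rfl⟩ := Nat.exists_eq_succ_of_ne_zero hi
        simpa using ha
    obtain ⟨Q, hQ, hc⟩ := key
    exact ⟨s₁.step s₂ ha h0 hQ.isFishWord, some Q, hQ, hc⟩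

/-- The permutation determines `π₁`, `π₂` and `a`, and `a` determines the index `i` because the list
of admissible values is strictly increasing. -/
theorem unique {π : List ℕ} {w w' : List Side} (h : HasFishWord π w) (h' : HasFishWord π w') :
    w = w' := by
  induction h generalizing w' with
  | nil =>
    generalize hπ : ([] : List ℕ) = π at h'
    cases h' with
    | nil => rfl
    | step => exact absurd hπ.symm (permC2_ne_nil _ _ _)
  | @step π₁ π₂ w₁ w₂ i a r₁ r₂ ha h0 ih₁ ih₂ =>
    generalize hπ : permC2 π₁ π₂ a = π at h'
    cases h' with
    | nil => exact absurd hπ (permC2_ne_nil _ _ _)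
    | @step π₁' π₂' w₁' w₂' i' a' r₁' r₂' ha' h0' =>
      obtain ⟨rfl, rfl, rfl⟩ := (isPermDatum_of_getElem? r₁.spec.1.perm r₂.spec.1.perm ha h0).unique
        (isPermDatum_of_getElem? r₁'.spec.1.perm r₂'.spec.1.perm ha' h0') hπ
      obtain ⟨hi, hi'⟩ := List.getElem?_eq_some_iff.1 ha
      have hn : (0 :: lrMaxima (stackSort π₂)).Nodup :=
        (IsPermDatum.pairwise_values r₂.spec.1.perm).imp (fun h => h.ne)
      rw [ih₁ r₁', ih₂ r₂', (List.getElem?_inj hi hn).1 (ha.trans ha'.symm)]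

theorem injective {π π' : List ℕ} {w : List Side} (h : HasFishWord π w) (h' : HasFishWord π' w) :
    π = π' := by
  induction h generalizing π' with
  | nil =>
    generalize hw : [LL, UR] = w at h'
    cases h' with
    | nil => rfl
    | step => exact absurd hw.symm (waist_ne_empty _ _ _)
  | @step π₁ π₂ w₁ w₂ i a r₁ r₂ ha h0 ih₁ ih₂ =>
    generalize hw : waist w₁ w₂ i = w at h'
    cases h' with
    | nil => exact absurd hw (waist_ne_empty _ _ _)
    | @step π₁' π₂' w₁' w₂' i' a' r₁' r₂' ha' h0' =>
      obtain ⟨s₁, -⟩ := r₁.spec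
      obtain ⟨s₂, -⟩ := r₂.spec
      obtain ⟨s₁', -⟩ := r₁'.spec
      obtain ⟨s₂', -⟩ := r₂'.spec
      obtain ⟨rfl, rfl, rfl⟩ := s₁.word.waist_injective s₂.word (s₂.lt_finLength ha)
        (fun h => h0 (s₁.nil_iff.2 h)) s₁'.word s₂'.word (s₂'.lt_finLength ha')
        (fun h => h0' (s₁'.nil_iff.2 h)) hw
      obtain rfl := ih₁ r₁'
      obtain rfl := ih₂ r₂'
      rw [Option.some_injective _ (ha.symm.trans ha')]

end HasFishWord

/-! ### The bijection -/

theorem IsTwoStack.exists_word {π : List ℕ} (h : IsTwoStack π) : ∃ w, HasFishWord π w := by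
  induction hn : π.length using Nat.strong_induction_on generalizing π with
  | _ n ih =>
    subst hn
    rcases eq_or_ne π [] with rfl | hne
    · exact ⟨_, .nil⟩
    obtain ⟨π₁, π₂, a, hd, rfl⟩ := h.exists_datum hne
    rw [length_permC2] at ih
    obtain ⟨w₁, r₁⟩ := ih _ (by omega) hd.left rfl
    obtain ⟨w₂, r₂⟩ := ih _ (by omega) hd.right rfl
    by_cases ha : a = 0
    · exact ⟨_, .step r₁ r₂ (i := 0) (by simp [ha]) fun _ => rfl⟩
    · obtain ⟨i, hi⟩ := List.mem_iff_getElem?.1 hd.mem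
      exact ⟨_, .step r₁ r₂ hi fun h => absurd (hd.eq_zero h) ha⟩

theorem IsFishWord.exists_perm {w : List Side} (h : IsFishWord w) : ∃ π, HasFishWord π w := by
  induction hn : w.length using Nat.strong_induction_on generalizing w with
  | _ n ih =>
    subst hn
    rcases eq_or_ne w [LL, UR] with rfl | hne
    · exact ⟨_, .nil⟩
    obtain ⟨w₁, w₂, i, h₁, h₂, hi, h0, hl₁, hl₂, rfl⟩ := h.exists_waist hne
    obtain ⟨π₁, r₁⟩ := ih _ hl₁ h₁ rfl
    obtain ⟨π₂, r₂⟩ := ih _ hl₂ h₂ rfl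
    have hi' : i < (0 :: lrMaxima (stackSort π₂)).length := by
      rw [r₂.spec.1.fin] at hi
      simpa using hi
    exact ⟨_, .step r₁ r₂ (List.getElem?_eq_getElem hi') fun h => h0 (r₁.spec.1.nil_iff.1 h)⟩

/-- The correspondence between permutations and fish factors through words. Hence its uniqueness
follows from that of `HasFishWord`, up to renaming of cells. -/
theorem Corresponds.exists_word {π : List ℕ} {F : Option GluedCells} (h : Corresponds π F) :
    ∃ w, HasFishWord π w ∧ OptHasWord F w := by
  induction h with
  | empty => exact ⟨_, .nil, rfl⟩
  | @c1 π₁ π₂ F₁ F₂ Q _ _ hQ ih₁ ih₂ =>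
    obtain ⟨w₁, r₁, h₁⟩ := ih₁
    obtain ⟨w₂, r₂, h₂⟩ := ih₂
    refine ⟨_, ?_, h₁.of_isC1 h₂ hQ⟩
    rw [permC1_eq_permC2 r₂.spec.1.perm]
    exact .step r₁ r₂ rfl fun _ => rfl
  | @c2 π₁ π₂ P₁ P₂ Q i a _ _ hi ha hQ ih₁ ih₂ =>
    obtain ⟨w₁, r₁, h₁⟩ := ih₁
    obtain ⟨w₂, r₂, h₂⟩ := ih₂
    refine ⟨_, .step r₁ r₂ (i := i) ?_ fun h => ?_, HasWord.of_isC2 h₁ h₂ hQ⟩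
    · obtain ⟨i, rfl⟩ := Nat.exists_eq_add_of_le' hi
      simpa using ha
    · exact absurd (r₁.spec.1.nil_iff.1 h) (HasWord.ne_empty h₁)

theorem GluedCells.IsWaist.of_iso {P₁ P₂ P Q : GluedCells} {l : List P₂.Edge}
    (h : IsWaist P₁ P₂ l Q) (e : Iso Q P) : IsWaist P₁ P₂ l P := by
  obtain ⟨h, x, hx, e'⟩ := h
  exact ⟨h, x, hx, e.symm.trans e'⟩

theorem GluedCells.IsC1.of_iso {F₁ F₂ : Option GluedCells} {P Q : GluedCells} (h : IsC1 F₁ F₂ Q)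
    (e : Iso Q P) : IsC1 F₁ F₂ P := by
  rcases F₁ with _ | P₁ <;> rcases F₂ with _ | P₂
  · exact e.symm.trans h
  · obtain ⟨l, hl, hf, e'⟩ := h
    exact ⟨l, hl, hf, e.symm.trans e'⟩
  · exact e.symm.trans h
  · obtain ⟨l, hl, hw⟩ := h
    exact ⟨l, hl, hw.of_iso e⟩

theorem Corresponds.of_iso {π : List ℕ} {P Q : GluedCells} (h : Corresponds π (some Q))
    (e : Iso Q P) : Corresponds π (some P) := by
  cases h with
  | c1 h₁ h₂ hQ => exact .c1 h₁ h₂ (hQ.of_iso e)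
  | c2 h₁ h₂ hi ha hQ =>
    obtain ⟨l, hl, h1, h2, hw⟩ := hQ
    exact .c2 h₁ h₂ hi ha ⟨l, hl, h1, h2, hw.of_iso e⟩

/-- The fish with a given word represent the permutations with this word. -/
theorem HasFishWord.corresponds_iff {π : List ℕ} {w : List Side} (h : HasFishWord π w)
    {P : GluedCells} : Corresponds π (some P) ↔ P.HasWord w := by
  constructor
  · intro hc
    obtain ⟨w', h', hP⟩ := hc.exists_word
    rwa [h.unique h']
  · intro hP
    obtain ⟨-, F, hF, c⟩ := h.spec
    cases F with
    | none => exact absurd hF hP.ne_empty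
    | some Q => exact c.of_iso (HasWord.iso hF hP)

theorem theorem1 :
    ∃ φ : TwoStackSortable → FightingFish, Function.Bijective φ ∧
      (∀ (π : TwoStackSortable) (P : GluedCells),
        (φ π).IsRep P ↔ Corresponds π.1 (some P)) ∧
      (∀ (π : TwoStackSortable) (P : GluedCells), (φ π).IsRep P →
        P.lowerFreeCount = π.1.length + 1 ∧
        P.freeCount Side.lowerLeft = ascents π.1 + 1 ∧
        P.freeCount Side.lowerRight = descents π.1 + 1 ∧
        P.HasFinLength ((lrMaxima (stackSort π.1)).length + 1) ∧
        P.tailCount = leftDescents (stackSort π.1) + 1) := by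
  have hex : ∀ π : TwoStackSortable, ∃ w, HasFishWord π.1 w ∧ ∃ P : GluedCells, P.HasWord w := by
    intro π
    obtain ⟨hne, h⟩ := isTwoStackSortable_iff.1 π.2
    obtain ⟨w, hw⟩ := h.exists_word
    obtain ⟨s, F, hF, -⟩ := hw.spec
    cases F with
    | none => exact absurd (s.nil_iff.2 hF) hne
    | some P => exact ⟨w, hw, P, hF⟩
  choose w hw P hP using hex
  -- The representatives of the image of `π` are precisely the fish whose boundary word is `w π`;
  -- the remaining claims become statements about words.
  have hrep : ∀ π Q, FightingFish.IsRep (Quotient.mk fishSetoid ⟨P π, (hP π).1⟩) Q ↔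
      Q.HasWord (w π) := by
    intro π Q
    constructor
    · rintro ⟨hQ, h⟩
      exact (hP π).of_iso (Iso.symm (Quotient.exact h))
    · intro hQ
      exact ⟨hQ.1, Quotient.sound (hQ.iso (hP π))⟩
  refine ⟨fun π => Quotient.mk fishSetoid ⟨P π, (hP π).1⟩, ⟨?_, ?_⟩, ?_, ?_⟩
  · intro π π' h
    have := (hP π).of_iso (Quotient.exact h)
    have hww := this.unique (hP π')
    have hπ' := hw π'
    rw [← hww] at hπ'
    exact Subtype.ext ((hw π).injective hπ')
  · intro F
    obtain ⟨⟨Q, hQ⟩, rfl⟩ := Quotient.exists_rep F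
    obtain ⟨v, hv⟩ := hQ.exists_hasWord
    obtain ⟨π, hπ⟩ := hv.isFishWord.exists_perm
    have hs := hπ.spec.1
    have hne : π ≠ [] := fun h => hv.ne_empty (hs.nil_iff.1 h)
    refine ⟨⟨π, isTwoStackSortable_iff.2 ⟨hne, hs.perm⟩⟩, Quotient.sound ?_⟩
    have := (hw ⟨π, isTwoStackSortable_iff.2 ⟨hne, hs.perm⟩⟩).unique hπ
    rw [← this] at hv
    exact (hP _).iso hv
  · intro π Q
    rw [hrep, (hw π).corresponds_iff]
  · intro π Q hQ
    have hst := ((hrep π Q).1 hQ).statistics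
    have hs := (hw π).spec.1
    have hne : π.1 ≠ [] := π.2.1
    rw [hs.left, hs.right, hs.fin, hs.tails, if_neg hne, if_neg hne] at hst
    refine ⟨?_, hst.2⟩
    -- The count of lower free edges uses that a nonempty permutation without repetitions has one
    -- entry more than it has ascents and descents.
    have := hs.length hne
    omega
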